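/- Let $k$ be an algebraically closed field, let $t>1$, and let $p_1,\dots,p_t$ be distinct closed points of $\mathbb P^2=\mathbb P V$, where $V$ is a three-dimensional $k$-vector space. Let $b\colon X\to\mathbb P^2$ be the blow-up of $\mathbb P^2$ at $p_1,\dots,p_t$, let $R_i$ be the exceptional divisor over $p_i$, and let $H$ be the pull-back to $X$ of a line in $\mathbb P^2$. Put $$\mathcal T=\mathcal O_X\oplus\mathcal O(R_1)\oplus\dots\oplus\mathcal O(R_t)\oplus\mathcal O(H)\oplus\mathcal O(2H),\qquad A_X=\operatorname{End}(\mathcal T).$$ (This is the direct sum of the exceptional sequence of the toric system $R_t,\,R_{t-1}-R_t,\dots,R_1-R_2,\,H-R_1,\,H,\,H-\sum_i R_i$.) Let $V^*$ be the space of linear forms on $\mathbb P^2$, identified with $\Gamma(X,\mathcal O(H))$, let $S^2V^*$ be the space of quadratic forms, and let $H_i\subset V^*$ be the space of linear forms that vanish at $p_i$. Then $H_i$ is a two-dimensional subspace of $V^*$, and under the identification $V^*=\Gamma(X,\mathcal O(H))$ it is $\Gamma(X,\mathcal O(H-R_i))=\operatorname{Hom}(\mathcal O(R_i),\mathcal O(H))$.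 Let $Q$ be the quiver with vertices $e_{t+1},e_1,\dots,e_t,e_{t+2},e_{t+3}$, standing for $\mathcal O_X,\mathcal O(R_1),\dots,\mathcal O(R_t),\mathcal O(H),\mathcal O(2H)$, with one arrow from $e_{t+1}$ to $e_i$ and two arrows from $e_i$ to $e_{t+2}$ for each $1\le i\le t$, and with three arrows from $e_{t+2}$ to $e_{t+3}$. Let $A=kQ$ be its path algebra, paths being multiplied from right to left, like maps. Choose a basis of each $H_i$ and a basis of $V^*$, and identify these bases with the arrows from $e_i$ to $e_{t+2}$ and with the arrows from $e_{t+2}$ to $e_{t+3}$, respectively. This gives $$e_{t+2}Ae_i=H_i,\quad e_{t+3}Ae_{t+2}=V^*,\quad e_{t+3}Ae_i=H_i\otimes V^*,\quad e_{t+2}Ae_{t+1}=\bigoplus_{i=1}^tH_i,\quad e_{t+3}Ae_{t+1}=\Big(\bigoplus_{i=1}^tH_i\Big)\otimes V^*.$$ There is exactly one homomorphism of $k$-algebras $\pi\colon A\to A_X$ that sends the trivial path at each vertex to the projection onto the corresponding summand of $\mathcal T$, the arrow $e_{t+1}\to e_i$ to the inclusion $\mathcal O_X\subset\mathcal O(R_i)$,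 and the arrows $e_i\to e_{t+2}$ and $e_{t+2}\to e_{t+3}$ to the morphisms $\mathcal O(R_i)\to\mathcal O(H)$ and $\mathcal O(H)\to\mathcal O(2H)$ given by multiplication with the corresponding elements of $H_i\subset\Gamma(X,\mathcal O(H))$ and of $V^*=\Gamma(X,\mathcal O(H))$. The homomorphism $\pi$ is surjective, so that $A_X\cong A/I_X$ with $I_X=\ker\pi$, and the two-sided ideal $I_X$ is generated by the following subspaces of $A$: 1. $\ker\big(H_i\otimes V^*\to S^2V^*\big)\subset e_{t+3}Ae_i$, for $1\le i\le t$, where the map is multiplication; 2. $\ker\big(\bigoplus_{i=1}^tH_i\to V^*\big)\subset e_{t+2}Ae_{t+1}$, where the map is the sum of the inclusions; 3. the elements of $e_{t+3}Ae_{t+1}=\big(\bigoplus_{i=1}^tH_i\big)\otimes V^*$ whose image in $V^*\otimes V^*$ lies in $\ker\big(V^*\otimes V^*\to S^2V^*\big)$, where the last map is multiplication. -/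

import Mathlib

open CategoryTheory AlgebraicGeometry TopologicalSpace
open scoped TensorProduct

universe u

namespace BlowupPlane

noncomputable section

/-! ### Path algebras -/

section PathAlgebra

/-- Generators of the path algebra of a quiver: the trivial paths and the arrows. -/
inductive PathGen (V : Type*) [Quiver V]
  | vertex (v : V) : PathGen V
  | arrow {v w : V} (a : v ⟶ w) : PathGen V

/-- The relations of the path algebra: the trivial paths are orthogonal idempotents with sum `1`,
and an arrow `a : v ⟶ w` satisfies `e_w a = a = a e_v` (composition from right to left). -/
inductive PathRel (k : Type*) [CommRing k] (V : Type*) [Quiver V] [Fintype V] :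
    FreeAlgebra k (PathGen V) → FreeAlgebra k (PathGen V) → Prop
  | idem (v : V) : PathRel k V
      (FreeAlgebra.ι k (.vertex v) * FreeAlgebra.ι k (.vertex v)) (FreeAlgebra.ι k (.vertex v))
  | orth (v w : V) (h : v ≠ w) : PathRel k V
      (FreeAlgebra.ι k (.vertex v) * FreeAlgebra.ι k (.vertex w)) 0
  | one : PathRel k V (∑ v : V, FreeAlgebra.ι k (.vertex v)) 1
  | source {v w : V} (a : v ⟶ w) : PathRel k V
      (FreeAlgebra.ι k (.arrow a) * FreeAlgebra.ι k (.vertex v)) (FreeAlgebra.ι k (.arrow a))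
  | target {v w : V} (a : v ⟶ w) : PathRel k V
      (FreeAlgebra.ι k (.vertex w) * FreeAlgebra.ι k (.arrow a)) (FreeAlgebra.ι k (.arrow a))

/-- The path algebra `kQ` of a quiver `Q` with finite vertex set `V`, by generators and relations.
Paths are multiplied from right to left, like maps. -/
abbrev PathAlgebra (k : Type*) [CommRing k] (V : Type*) [Quiver V] [Fintype V] : Type _ :=
  RingQuot (PathRel k V)

variable (k : Type*) [CommRing k] {V : Type*} [Quiver V] [Fintype V]

/-- The trivial path at a vertex. -/
def pathIdem (v : V) : PathAlgebra k V :=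
  RingQuot.mkAlgHom k (PathRel k V) (FreeAlgebra.ι k (.vertex v))

/-- An arrow as an element of the path algebra. -/
def pathArrow {v w : V} (a : v ⟶ w) : PathAlgebra k V :=
  RingQuot.mkAlgHom k (PathRel k V) (FreeAlgebra.ι k (.arrow a))

end PathAlgebra

/-! ### The quiver -/

/-- The vertices of the quiver; they stand for the invertible sheaves
`O`, `O(R_i)`, `O(H)` and `O(2H)`. -/
inductive Vertex (t : ℕ) : Type
  | zero : Vertex t
  | exc (i : Fin t) : Vertex t
  | line : Vertex t
  | conic : Vertex t
  deriving DecidableEq, Fintype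

/-- The arrows of the quiver: one from `O` to each `O(R_i)`, two from each `O(R_i)` to `O(H)`,
and three from `O(H)` to `O(2H)`. -/
inductive Arrow (t : ℕ) : Vertex t → Vertex t → Type
  | a (i : Fin t) : Arrow t .zero (.exc i)
  | b (i : Fin t) (j : Fin 2) : Arrow t (.exc i) .line
  | c (j : Fin 3) : Arrow t .line .conic

instance (t : ℕ) : Quiver (Vertex t) := ⟨Arrow t⟩

/-! ### The projective plane -/

section Plane

variable (k : Type u) [Field k]

/-- The grading of `k[x₀, x₁, x₂]` by degree. -/
abbrev grading : ℕ → Submodule k (MvPolynomial (Fin 3) k) :=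
  MvPolynomial.homogeneousSubmodule (Fin 3) k

instance : GradedAlgebra (grading k) := MvPolynomial.gradedAlgebra

/-- The projective plane `ℙ²` over `k`. -/
abbrev Plane : Scheme.{u} := Proj (grading k)

/-- The structure morphism of the projective plane. -/
def Plane.toBase : Plane k ⟶ Spec (.of k) :=
  Proj.toSpecZero (grading k) ≫ Spec.map (CommRingCat.ofHom (algebraMap k (grading k 0)))

/-- The space `V*` of linear forms on the plane. -/
abbrev LinearForms : Submodule k (MvPolynomial (Fin 3) k) := grading k 1

variable {k}

/-- The linear forms that vanish at a point `x` of the plane: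
for a closed point, the hyperplane in `V*` dual to it. -/
def formsThrough (x : Plane k) : Submodule k (MvPolynomial (Fin 3) k) where
  carrier := {f | f ∈ LinearForms k ∧ f ∈ x.asHomogeneousIdeal}
  add_mem' hf hg := ⟨add_mem hf.1 hg.1, add_mem hf.2 hg.2⟩
  zero_mem' := ⟨zero_mem _, zero_mem _⟩
  smul_mem' r f hf := by
    refine ⟨Submodule.smul_mem _ r hf.1, ?_⟩
    rw [MvPolynomial.smul_eq_C_mul]
    exact Ideal.mul_mem_left _ _ hf.2

lemma formsThrough_le (x : Plane k) : formsThrough x ≤ LinearForms k := fun _ hf ↦ hf.1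

/-- The ideal sheaf of the line `h = 0` in the plane, for a nonzero linear form `h`. -/
def lineIdeal (h : MvPolynomial (Fin 3) k) : (Plane k).IdealSheafData :=
  .vanishingIdeal (Proj.basicOpen (grading k) h).compl

/-- The ideal sheaf of a closed point (with its reduced structure). -/
def pointIdeal {Y : Scheme.{u}} (x : Y) (hx : IsClosed {x}) : Y.IdealSheafData :=
  .vanishingIdeal ⟨{x}, hx⟩

/-- The ideal sheaf of a finite set of closed points (with its reduced structure). -/
def pointsIdeal {Y : Scheme.{u}} {t : ℕ} (p : Fin t → Y) (hp : ∀ i, IsClosed {p i}) :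
    Y.IdealSheafData :=
  .vanishingIdeal ⟨Set.range p, by
    rw [← Set.iUnion_singleton_eq_range]
    exact isClosed_iUnion_of_finite hp⟩

end Plane

/-! ### Blow-ups -/

/-- An ideal sheaf is invertible if it is locally generated by one nonzerodivisor, that is, if it
is the ideal sheaf of an effective Cartier divisor. -/
def IsInvertibleIdeal {X : Scheme.{u}} (J : X.IdealSheafData) : Prop :=
  ∀ x : X, ∃ U : X.affineOpens, x ∈ U.1 ∧
    ∃ a ∈ nonZeroDivisors Γ(X, U.1), J.ideal U = Ideal.span {a}

/-- `b : X ⟶ Y` is the blow-up of `Y` along the ideal sheaf `I`: the inverse image ideal sheaf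
`I · O_X` is invertible, and `b` is universal with this property. -/
structure IsBlowup {X Y : Scheme.{u}} (b : X ⟶ Y) (I : Y.IdealSheafData) : Prop where
  invertible : IsInvertibleIdeal (I.comap b)
  universal : ∀ {Z : Scheme.{u}} (f : Z ⟶ Y), IsInvertibleIdeal (I.comap f) →
    ∃! g : Z ⟶ X, g ≫ b = f

/-! ### The sheaf `O_X(D)` of an effective Cartier divisor -/

section DivisorSheaf

variable {X : Scheme.{u}} [IsIntegral X]

/-- The image of a section at a point `x` in the function field. -/
def toFunctionField {U : X.Opens} (x : U) : Γ(X, U) →+* X.functionField :=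
  (algebraMap (X.presheaf.stalk x.1) X.functionField).comp (X.presheaf.germ U x.1 x.2).hom

lemma toFunctionField_map {U V : X.Opens} (i : V ⟶ U) (x : V) (r : Γ(X, U)) :
    toFunctionField x (X.presheaf.map i.op r) = toFunctionField ⟨x.1, i.le x.2⟩ r := by
  simp only [toFunctionField, RingHom.comp_apply]
  congr 1
  exact X.presheaf.germ_res_apply i x.1 x.2 r

/-- The stalk at `x` of `O_X(D)`, where `J` is the ideal sheaf of the divisor `D`: the rational
functions `f` with `f · J_x ⊆ O_{X,x}`. -/
def divisorStalk (J : X.IdealSheafData) (x : X) :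
    Submodule (X.presheaf.stalk x) X.functionField where
  carrier := {f | ∀ (U : X.affineOpens) (hx : x ∈ U.1), ∀ g ∈ J.ideal U,
    f * toFunctionField ⟨x, hx⟩ g ∈ (algebraMap (X.presheaf.stalk x) X.functionField).range}
  add_mem' hf hg U hx g hgJ := by
    rw [add_mul]
    exact add_mem (hf U hx g hgJ) (hg U hx g hgJ)
  zero_mem' U hx g hgJ := by
    rw [zero_mul]
    exact zero_mem _
  smul_mem' r f hf U hx g hgJ := by
    rw [Algebra.smul_def, mul_assoc]
    exact mul_mem ⟨r, rfl⟩ (hf U hx g hgJ)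

/-- The local predicate that cuts out the sections of `O_X(D)` among all maps from an open set to
the function field: locally constant maps whose value at each `x` lies in the stalk `O_X(D)_x`.
As `X` is irreducible, a section over a nonempty open set is a single rational function. -/
def divisorPredicate (J : X.IdealSheafData) :
    TopCat.LocalPredicate (X := X.toTopCat) (fun _ ↦ X.functionField) where
  pred {U} s := (∀ x : U, ∃ V : X.Opens, x.1 ∈ V ∧ ∀ y : U, y.1 ∈ V → s y = s x) ∧
    ∀ x : U, s x ∈ divisorStalk J x.1
  res {U V} i s hs := by
    refine ⟨fun x ↦ ?_, fun x ↦ hs.2 (i x)⟩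
    obtain ⟨W, hxW, hW⟩ := hs.1 (i x)
    exact ⟨W, hxW, fun y hy ↦ hW (i y) hy⟩
  locality {U} s hs := by
    refine ⟨fun x ↦ ?_, fun x ↦ ?_⟩
    · obtain ⟨V, hxV, i, h, -⟩ := hs x
      obtain ⟨W, hxW, hW⟩ := h ⟨x.1, hxV⟩
      exact ⟨V ⊓ W, ⟨hxV, hxW⟩, fun y hy ↦ hW ⟨y.1, hy.1⟩ hy.2⟩
    · obtain ⟨V, hxV, i, -, h⟩ := hs x
      exact h ⟨x.1, hxV⟩

/-- The sections of `O_X(D)` over `U`. -/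
def divisorSections (J : X.IdealSheafData) (U : X.Opens) :
    AddSubgroup (U → X.functionField) where
  carrier := {s | (divisorPredicate J).pred s}
  add_mem' {s s'} hs hs' := by
    refine ⟨fun x ↦ ?_, fun x ↦ add_mem (hs.2 x) (hs'.2 x)⟩
    obtain ⟨V, hxV, hV⟩ := hs.1 x
    obtain ⟨W, hxW, hW⟩ := hs'.1 x
    refine ⟨V ⊓ W, ⟨hxV, hxW⟩, fun y hy ↦ ?_⟩
    rw [Pi.add_apply, Pi.add_apply, hV y hy.1, hW y hy.2]
  zero_mem' := ⟨fun _ ↦ ⟨⊤, trivial, fun _ _ ↦ rfl⟩, fun _ ↦ zero_mem _⟩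
  neg_mem' {s} hs := by
    refine ⟨fun x ↦ ?_, fun x ↦ neg_mem (hs.2 x)⟩
    obtain ⟨V, hxV, hV⟩ := hs.1 x
    refine ⟨V, hxV, fun y hy ↦ ?_⟩
    rw [Pi.neg_apply, Pi.neg_apply, hV y hy]

lemma toFunctionField_eq {U : X.Opens} (x y : U) (r : Γ(X, U)) :
    toFunctionField x r = toFunctionField y r := by
  have : Nonempty U := ⟨x⟩
  simp only [toFunctionField, RingHom.comp_apply]
  exact (Scheme.algebraMap_germ_eq_germToFunctionField X x.2 r).trans
    (Scheme.algebraMap_germ_eq_germToFunctionField X y.2 r).symm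

instance (J : X.IdealSheafData) (U : X.Opens) : SMul Γ(X, U) (divisorSections J U) where
  smul r s := ⟨fun x ↦ toFunctionField x r * s.1 x, by
    refine ⟨fun x ↦ ?_, fun x ↦ (divisorStalk J x.1).smul_mem _ (s.2.2 x)⟩
    obtain ⟨V, hxV, hV⟩ := s.2.1 x
    exact ⟨V, hxV, fun y hy ↦ by
      change toFunctionField y r * s.1 y = toFunctionField x r * s.1 x
      rw [hV y hy, toFunctionField_eq y x]⟩⟩

lemma smul_val {J : X.IdealSheafData} {U : X.Opens} (r : Γ(X, U)) (s : divisorSections J U)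
    (x : U) : (r • s).1 x = toFunctionField x r * s.1 x := rfl

instance (J : X.IdealSheafData) (U : X.Opens) : Module Γ(X, U) (divisorSections J U) where
  one_smul s := by ext x; simp [smul_val]
  mul_smul r r' s := by ext x; simp [smul_val, mul_assoc]
  smul_zero r := by ext x; simp [smul_val]
  smul_add r s s' := by ext x; simp [smul_val, mul_add]
  add_smul r r' s := by ext x; simp [smul_val, add_mul]
  zero_smul s := by ext x; simp [smul_val]

/-- The presheaf of abelian groups underlying `O_X(D)`. -/
def divisorPresheaf (J : X.IdealSheafData) : TopCat.Presheaf Ab.{u} X.toTopCat where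
  obj U := .of (divisorSections J U.unop)
  map {U V} i := AddCommGrpCat.ofHom
    { toFun s := ⟨fun x ↦ s.1 (i.unop x), (divisorPredicate J).res i.unop s.1 s.2⟩
      map_zero' := rfl
      map_add' _ _ := rfl }

lemma divisorPresheaf_isSheaf (J : X.IdealSheafData) : (divisorPresheaf J).IsSheaf := by
  rw [TopCat.Presheaf.isSheaf_iff_isSheaf_comp (forget Ab.{u})]
  exact TopCat.subpresheafToTypes.isSheaf (divisorPredicate J)

instance (J : X.IdealSheafData) (U : X.Opensᵒᵖ) :
    Module (X.ringCatSheaf.obj.obj U) ((divisorPresheaf J).obj U) :=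
  inferInstanceAs (Module Γ(X, U.unop) (divisorSections J U.unop))

/-- The sheaf of `O_X`-modules `O_X(D)`, where `J` is the ideal sheaf of the effective Cartier
divisor `D`, as a subsheaf of the constant sheaf of rational functions. -/
def divisorSheaf (J : X.IdealSheafData) : X.Modules where
  val := PresheafOfModules.ofPresheaf (R := X.ringCatSheaf.obj) (divisorPresheaf J) (by
    intro U V i r m
    refine Subtype.ext (funext fun x ↦ ?_)
    exact congrArg (· * _) (toFunctionField_map i.unop x r).symm)
  isSheaf := divisorPresheaf_isSheaf J

/-- The values of a section of `O_X(D)`, as rational functions. -/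
def sectionValue {J : X.IdealSheafData} {U : X.Opens} (s : Γ(divisorSheaf J, U)) :
    U → X.functionField :=
  (show divisorSections J U from s).1

/-- A morphism `O_X(D) ⟶ O_X(D')` is multiplication by the rational function `r`. -/
def IsMultiplication {J J' : X.IdealSheafData} (φ : divisorSheaf J ⟶ divisorSheaf J')
    (r : X.functionField) : Prop :=
  ∀ (U : X.Opens) (s : Γ(divisorSheaf J, U)) (x : U),
    sectionValue (φ.app U s) x = r * sectionValue s x

end DivisorSheaf

/-! ### The tilting sheaf and its endomorphism ring -/

section Tilting

variable {k : Type u} [Field k] {X : Scheme.{u}} [IsIntegral X] (b : X ⟶ Plane k)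

open Classical in
/-- The rational function `f / h` on the plane, for linear forms `f` and `h`, pulled back to `X`
along `b`. (The preimage of the set `h ≠ 0` is nonempty when `b` is dominant and `h` is a nonzero
form.) -/
def formRatio {h : MvPolynomial (Fin 3) k} (hh : h ∈ LinearForms k)
    {f : MvPolynomial (Fin 3) k} (hf : f ∈ LinearForms k) : X.functionField :=
  if hne : Nonempty (b ⁻¹ᵁ Proj.basicOpen (grading k) h) then
    X.germToFunctionField (b ⁻¹ᵁ Proj.basicOpen (grading k) h)
      (b.app (Proj.basicOpen (grading k) h)
        (Proj.awayToSection (grading k) h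
          (HomogeneousLocalization.Away.mk (grading k) hh 1 f (by simpa using hf))))
  else 0

/-- The constant `c` as a section of `O_X` over an open set. -/
def constSection (U : X.Opens) (c : k) : Γ(X, U) :=
  (b ≫ Plane.toBase k).appLE ⊤ U le_top ((Scheme.ΓSpecIso (.of k)).inv c)

variable {t : ℕ} (p : Fin t → Plane k) (hp : ∀ i, IsClosed {p i})
  (h : MvPolynomial (Fin 3) k)

/-- The ideal sheaves of the divisors `0`, `R_i`, `H`, `2H` on `X`, where `R_i` is the exceptional
divisor over `p i` and `H` is represented by the total transform of the line `h = 0`. -/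
def divisorIdeal : Vertex t → X.IdealSheafData
  | .zero => ⊤
  | .exc i => (pointIdeal (p i) (hp i)).comap b
  | .line => (lineIdeal h).comap b
  | .conic => (lineIdeal h).comap b ^ 2

/-- The strongly exceptional sequence `O`, `O(R_1)`, …, `O(R_t)`, `O(H)`, `O(2H)`. -/
def exceptionalSheaf (v : Vertex t) : X.Modules :=
  divisorSheaf (divisorIdeal b p hp h v)

instance (Y : Scheme.{u}) : Limits.HasFiniteBiproducts Y.Modules :=
  Abelian.hasFiniteBiproducts

/-- The tilting sheaf: the direct sum of the sheaves of the exceptional sequence. Its endomorphism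
ring `End (tiltingSheaf …)` is the algebra `A_X`. -/
def tiltingSheaf : X.Modules :=
  ⨁ (exceptionalSheaf b p hp h)

variable {h} (hh : h ∈ LinearForms k)
  (β : ∀ i, Module.Basis (Fin 2) k (formsThrough (p i)))
  (γ : Module.Basis (Fin 3) k (LinearForms k))

/-- The rational function attached to an arrow, for chosen bases `β i` of `H_i` and `γ` of `V*`:
the canonical section `1` of `O(R_i)`, the elements of the basis `β i` of `H_i`,
and those of the basis `γ` of `V*`. -/
def arrowFunction : ∀ {v w : Vertex t}, (v ⟶ w) → X.functionField
  | _, _, .a _ => 1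
  | _, _, .b i j => formRatio b hh (β i j).2.1
  | _, _, .c j => formRatio b hh (γ j).2

/-- The canonical homomorphism from the path algebra to `A_X = End T`: it is `k`-linear, it sends
the trivial paths to the projections onto the summands of `T`, and an arrow `v ⟶ w` to the morphism
between the summands at `v` and `w` that multiplies by the rational function of the arrow. -/
structure IsCanonical
    (π : PathAlgebra k (Vertex t) →+* End (tiltingSheaf b p hp h)) : Prop where
  const (c : k) (U : X.Opens) (s : Γ(tiltingSheaf b p hp h, U)) :
    Scheme.Modules.Hom.app (π (algebraMap k _ c)) U s = constSection b U c • s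
  idem (v : Vertex t) : π (pathIdem k v) =
    (Limits.biproduct.π (exceptionalSheaf b p hp h) v ≫
      Limits.biproduct.ι (exceptionalSheaf b p hp h) v :)
  arrow {v w : Vertex t} (a : v ⟶ w) :
    ∃ φ : exceptionalSheaf b p hp h v ⟶ exceptionalSheaf b p hp h w,
      IsMultiplication φ (arrowFunction b p hh β γ a) ∧
      π (pathArrow k a) =
        (Limits.biproduct.π (exceptionalSheaf b p hp h) v ≫ φ ≫
          Limits.biproduct.ι (exceptionalSheaf b p hp h) w :)

end Tilting

/-! ### The relations -/

section Relations

variable {k : Type u} [Field k] {t : ℕ} (p : Fin t → Plane k)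
  (β : ∀ i, Module.Basis (Fin 2) k (formsThrough (p i)))
  (γ : Module.Basis (Fin 3) k (LinearForms k))

/-- The identification of `H_i` with the span of the arrows from `O(R_i)` to `O(H)`. -/
def embH (i : Fin t) : formsThrough (p i) →ₗ[k] PathAlgebra k (Vertex t) :=
  (β i).constr k fun j ↦ pathArrow k (Arrow.b i j : Vertex.exc i ⟶ Vertex.line)

/-- The identification of `V*` with the span of the arrows from `O(H)` to `O(2H)`. -/
def embV : LinearForms k →ₗ[k] PathAlgebra k (Vertex t) :=
  γ.constr k fun j ↦ pathArrow k (Arrow.c j : (Vertex.line : Vertex t) ⟶ Vertex.conic)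

/-- The identification of `H_i ⊗ V*` with the span of the paths from `O(R_i)` to `O(2H)`. -/
def embHV (i : Fin t) :
    formsThrough (p i) ⊗[k] LinearForms k →ₗ[k] PathAlgebra k (Vertex t) :=
  TensorProduct.lift
    ((LinearMap.mul k (PathAlgebra k (Vertex t))).flip.compl₁₂ (embH p β i) (embV γ))

/-- The identification of `⊕ H_i` with the span of the paths from `O` to `O(H)`. -/
def embSum : (∀ i, formsThrough (p i)) →ₗ[k] PathAlgebra k (Vertex t) :=
  ∑ i, LinearMap.mulRight k (pathArrow k (Arrow.a i : Vertex.zero ⟶ Vertex.exc i)) ∘ₗ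
    embH p β i ∘ₗ LinearMap.proj i

/-- The identification of `(⊕ H_i) ⊗ V*` with the span of the paths from `O` to `O(2H)`. -/
def embSumV : (∀ i, formsThrough (p i)) ⊗[k] LinearForms k →ₗ[k] PathAlgebra k (Vertex t) :=
  TensorProduct.lift
    ((LinearMap.mul k (PathAlgebra k (Vertex t))).flip.compl₁₂ (embSum p β) (embV γ))

/-- The map `⊕ H_i → V*` induced by the inclusions. -/
def sumToV : (∀ i, formsThrough (p i)) →ₗ[k] LinearForms k :=
  ∑ i, Submodule.inclusion (formsThrough_le (p i)) ∘ₗ LinearMap.proj i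

/-- The multiplication map `M ⊗ V* → S²V*` for a subspace `M` of `V*`, with `S²V*` the space of
quadratic forms. -/
def multToS2 (M : Submodule k (MvPolynomial (Fin 3) k)) (hM : M ≤ LinearForms k) :
    M ⊗[k] LinearForms k →ₗ[k] grading k 2 :=
  (Submodule.mulMap M (LinearForms k)).codRestrict (grading k 2) fun x ↦ by
    induction x with
    | zero => simp
    | add x y hx hy => rw [map_add]; exact add_mem hx hy
    | tmul m v => exact MvPolynomial.IsHomogeneous.mul (hM m.2) v.2

/-- The generators of the ideal `I_X`. -/
def relations : Set (PathAlgebra k (Vertex t)) :=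
  (⋃ i, embHV p β γ i '' {x | multToS2 (formsThrough (p i)) (formsThrough_le (p i)) x = 0}) ∪
  embSum p β '' {x | sumToV p x = 0} ∪
  embSumV p β γ ''
    {x | multToS2 (LinearForms k) le_rfl ((sumToV p).rTensor (LinearForms k) x) = 0}

end Relations

end

end BlowupPlane

open BlowupPlane

/-! Every sheaf of the sequence is a subsheaf of the constant sheaf K of rational functions on X, so
a morphism between two of them is multiplication by an element of K. Hence End T embeds into the
matrices over K indexed by the vertices (`endMatrix`, `endMatrix_injective`). The path algebra maps
to the same matrix ring, each arrow going to a matrix with one entry (`valueMatrix`). Generators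
have values in the image of End T, so the homomorphism π exists by lifting (`exists_lift`). Its
kernel is that of `valueMatrix`, and its surjectivity is a question about which rational functions
occur as entries.

Those functions are found by local tests (`exists_form_of_isMultiplier`). From the universal
property, the blow-up is an isomorphism outside the points and is surjective, so over the generic
point of every curve q = 0 in the plane it is a local isomorphism. Regularity there leaves no
denominators except the powers of h that come from representing H by h = 0: a morphism from v to w
is f h^d(v) / h^d(w), where d is 0, 0, 1, 2 on O, O(R_i), O(H), O(2H) and f is a form of degree d(w)
- d(v), zero if that is negative. If the source is O(R_i) and the target is another sheaf, f also
vanishes at p_i: some germ of O(R_i) over p_i has a pole, and the target has no room for it.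

Surjectivity is now linear algebra of forms (`exists_valueMatrix_eq_single`): quadrics through p_i
lie in H_i V* (`mem_formsThrough_mul`), all quadrics lie in V* V*, and H_i + H_j = V* for two
different points (`exists_add_of_ne`), which is where t > 1 enters.

For the kernel (`ker_valueMatrix`), cut an element into pieces by the trivial paths on both sides.
Each piece comes from an explicit space of tensors, and its entry is the image of the tensor under
multiplication or summation, divided by a power of h. So the entry vanishes exactly when the tensor
lies in the kernel of that map, and these kernels are the listed generators or zero. -/

namespace BlowupPlane

/-! ### Inverse image ideal sheaves on affine opens -/

section Comap

variable {X Y : Scheme.{u}}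

/-- Both inclusions come from the adjunction of `comap` and `map`: on affine schemes an ideal sheaf
is its ideal of global sections, and `map` is contraction of ideals. -/
lemma ideal_comap_top [IsAffine X] [IsAffine Y] (f : X ⟶ Y) (I : Y.IdealSheafData) :
    (I.comap f).ideal ⟨⊤, isAffineOpen_top X⟩ =
      (I.ideal ⟨⊤, isAffineOpen_top Y⟩).map f.appTop.hom := by
  apply le_antisymm
  · have key : I.comap f ≤
        .ofIdealTop ((I.ideal ⟨⊤, isAffineOpen_top Y⟩).map f.appTop.hom) := by
      rw [← Scheme.IdealSheafData.le_map_iff_comap_le]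
      apply Scheme.IdealSheafData.le_of_isAffine
      rw [Scheme.IdealSheafData.ideal_map _ f ⟨⊤, isAffineOpen_top Y⟩ (isAffineOpen_top X)]
      rw [← Ideal.map_le_iff_le_comap]
      exact (Scheme.IdealSheafData.equivOfIsAffine.apply_symm_apply
        ((I.ideal ⟨⊤, isAffineOpen_top Y⟩).map f.appTop.hom)).ge
    exact (key _).trans (Scheme.IdealSheafData.equivOfIsAffine.apply_symm_apply
        ((I.ideal ⟨⊤, isAffineOpen_top Y⟩).map f.appTop.hom)).le
  · rw [Ideal.map_le_iff_le_comap]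
    have := Scheme.IdealSheafData.le_map_comap I f ⟨⊤, isAffineOpen_top Y⟩
    rwa [Scheme.IdealSheafData.ideal_map _ f ⟨⊤, isAffineOpen_top Y⟩ (isAffineOpen_top X)] at this

lemma ideal_comap_of_opensRange_eq [IsAffine X] (j : X ⟶ Y) [IsOpenImmersion j]
    (I : Y.IdealSheafData) (V : Y.affineOpens) (hV : j ''ᵁ ⊤ = V.1) (e : ⊤ ≤ j ⁻¹ᵁ V.1) :
    (I.comap j).ideal ⟨⊤, isAffineOpen_top X⟩ = (I.ideal V).map (j.appLE V.1 ⊤ e).hom := by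
  obtain ⟨V, hVa⟩ := V
  dsimp only at hV
  subst hV
  rw [Scheme.IdealSheafData.ideal_comap_of_isOpenImmersion]
  have : (j.appLE (j ''ᵁ ⊤) ⊤ e) = (j.appIso ⊤).hom := by
    rw [Scheme.Hom.appIso_hom']
  rw [this]
  exact (Ideal.map_symm (j.appIso ⊤).symm.commRingCatIsoToRingEquiv).symm

/-- Restrict the morphism to the two affine opens, where the affine case applies, and transport the
result back along the isomorphisms with the open subschemes. -/
lemma ideal_comap (f : X ⟶ Y) (I : Y.IdealSheafData) (V : Y.affineOpens) (U : X.affineOpens)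
    (e : U.1 ≤ f ⁻¹ᵁ V.1) :
    (I.comap f).ideal U = (I.ideal V).map (f.appLE V.1 U.1 e).hom := by
  have : IsAffine U.1.toScheme := U.2
  have : IsAffine V.1.toScheme := V.2
  have h1 := ideal_comap_of_opensRange_eq U.1.ι (I.comap f) U (by simp) (by simp)
  have h2 := ideal_comap_of_opensRange_eq V.1.ι I V (by simp) (by simp)
  have h3 := ideal_comap_top (f.resLE V.1 U.1 e) (I.comap V.1.ι)
  rw [← Scheme.IdealSheafData.comap_comp] at h1 h3
  rw [Scheme.Hom.resLE_comp_ι, h1, h2, Ideal.map_map, ← CommRingCat.hom_comp] at h3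
  have h4 : V.1.ι.appLE V.1 ⊤ (by simp) ≫ (f.resLE V.1 U.1 e).appTop =
      f.appLE V.1 U.1 e ≫ U.1.ι.appLE U.1 ⊤ (by simp) := by
    have h : (f.resLE V.1 U.1 e).appTop = (f.resLE V.1 U.1 e).appLE ⊤ ⊤ le_top :=
      Scheme.Hom.app_eq_appLE _
    rw [h]
    refine (Scheme.Hom.appLE_comp_appLE _ _ _ _ _ _ _).trans
      (Eq.trans ?_ (Scheme.Hom.appLE_comp_appLE _ _ _ _ _ _ _).symm)
    simp_rw [Scheme.Hom.resLE_comp_ι]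
  rw [h4, CommRingCat.hom_comp, ← Ideal.map_map] at h3
  have h5 : IsIso (U.1.ι.appLE U.1 ⊤ (by simp)) := by
    have : U.1.ι.appLE U.1 ⊤ (by simp) = U.1.topIso.inv := by
      simp [Scheme.Opens.ι_appLE]
      rfl
    rw [this]; infer_instance
  -- Extension of ideals along an isomorphism is injective, so the identity may be checked after
  -- passing to `U` as a scheme.
  have h6 : Function.Injective (Ideal.map (U.1.ι.appLE U.1 ⊤ (by simp)).hom) :=
    Function.LeftInverse.injective (g := Ideal.map (inv (U.1.ι.appLE U.1 ⊤ _)).hom)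
      fun J ↦ by rw [Ideal.map_map, ← CommRingCat.hom_comp, IsIso.hom_inv_id, CommRingCat.hom_id, Ideal.map_id]
  exact h6 h3

end Comap

/-! ### Stalks of the divisor sheaves -/

noncomputable section

variable {X : Scheme.{u}} [IsIntegral X]

/-- The ring structure of the function field that underlies its field structure. -/
local instance functionFieldCommRing : CommRing X.functionField := Field.toCommRing

/-- The local ring at a point of an integral scheme, as a subring of the function field. -/
def localSubring (x : X) : Subring X.functionField :=
  (algebraMap (X.presheaf.stalk x) X.functionField).range

lemma toFunctionField_mem_localSubring {U : X.Opens} {x : X} (hx : x ∈ U) (r : Γ(X, U)) :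
    toFunctionField ⟨x, hx⟩ r ∈ localSubring x := ⟨_, rfl⟩

/-- The elements f of B for which g times the image of f lies in R form a B-submodule, so generators
of the extended ideal suffice. -/
lemma forall_mem_map_mul_mem_iff {A B K : Type*} [CommRing A] [CommRing B] [CommRing K]
    (φ : A →+* B) (ψ : B →+* K) (R : Subring K) (hR : ∀ b, ψ b ∈ R) (I : Ideal A) (g : K) :
    (∀ f ∈ I.map φ, g * ψ f ∈ R) ↔ ∀ s ∈ I, g * ψ (φ s) ∈ R := by
  refine ⟨fun h s hs ↦ h _ (Ideal.mem_map_of_mem φ hs), fun h f hf ↦ ?_⟩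
  induction hf using Submodule.span_induction with
  | mem x hx => obtain ⟨s, hs, rfl⟩ := hx; exact h s hs
  | zero => rw [map_zero, mul_zero]; exact zero_mem _
  | add x y _ _ hx hy => rw [map_add, mul_add]; exact add_mem hx hy
  | smul a x _ hx =>
    rw [smul_eq_mul, map_mul, mul_left_comm]
    exact mul_mem (hR a) hx

lemma mem_divisorStalk_iff {J : X.IdealSheafData} {x : X} {g : X.functionField} :
    g ∈ divisorStalk J x ↔ ∀ (U : X.affineOpens) (hx : x ∈ U.1), ∀ f ∈ J.ideal U,
      g * toFunctionField ⟨x, hx⟩ f ∈ localSubring x := Iff.rfl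

lemma toFunctionField_homOfLE {U V : X.Opens} (h : V ≤ U) {x : X} (hx : x ∈ V) (r : Γ(X, U)) :
    toFunctionField (⟨x, hx⟩ : V) ((X.presheaf.map (homOfLE h).op).hom r) =
      toFunctionField (⟨x, h hx⟩ : U) r :=
  toFunctionField_map (homOfLE h) ⟨x, hx⟩ r

/-- One affine neighbourhood is enough: two of them share a neighbourhood of x that is a basic open
of both, and there the ideal is extended from either side. -/
lemma mem_divisorStalk_iff_of_mem {J : X.IdealSheafData} {x : X} {g : X.functionField}
    (U : X.affineOpens) (hx : x ∈ U.1) :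
    g ∈ divisorStalk J x ↔
      ∀ f ∈ J.ideal U, g * toFunctionField ⟨x, hx⟩ f ∈ localSubring x := by
  rw [mem_divisorStalk_iff]
  refine ⟨fun h ↦ h U hx, fun h U' hx' f hf ↦ ?_⟩
  obtain ⟨f₀, g₀, hfg, hxf⟩ := exists_basicOpen_le_affine_inter U.2 U'.2 x ⟨hx, hx'⟩
  have h1 := J.map_ideal (U := X.affineBasicOpen f₀) (V := U) (X.basicOpen_le f₀)
  have hle : X.affineBasicOpen f₀ ≤ U' := hfg.trans_le (X.basicOpen_le g₀)
  have h2 := (J.map_ideal (U := X.affineBasicOpen f₀) (V := U') hle).le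
    (Ideal.mem_map_of_mem _ hf)
  rw [← h1] at h2
  have h3 := (forall_mem_map_mul_mem_iff (X.presheaf.map (homOfLE (X.basicOpen_le f₀)).op).hom
    (toFunctionField (⟨x, hxf⟩ : X.basicOpen f₀)) (localSubring x)
    (toFunctionField_mem_localSubring hxf) (J.ideal U) g).mpr (fun s hs ↦ by
      rw [toFunctionField_homOfLE (X.basicOpen_le f₀) hxf]
      exact h s hs) _ h2
  rw [← toFunctionField_homOfLE hle hxf]
  exact h3

lemma mem_divisorStalk_comap_iff {Y : Scheme.{u}} (b : X ⟶ Y) (I : Y.IdealSheafData) {x : X}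
    {g : X.functionField} (V : Y.affineOpens) (hx : b x ∈ V.1) :
    g ∈ divisorStalk (I.comap b) x ↔
      ∀ s ∈ I.ideal V, g * toFunctionField (U := b ⁻¹ᵁ V.1) ⟨x, hx⟩ (b.app V.1 s) ∈
        localSubring x := by
  obtain ⟨_, ⟨U, hU, rfl⟩, hxU, hUV⟩ :=
    X.isBasis_affineOpens.exists_subset_of_mem_open (show x ∈ (b ⁻¹ᵁ V.1 : X.Opens) from hx)
      (b ⁻¹ᵁ V.1).isOpen
  have e : U ≤ b ⁻¹ᵁ V.1 := hUV
  rw [mem_divisorStalk_iff_of_mem ⟨U, hU⟩ hxU, ideal_comap b I V ⟨U, hU⟩ e]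
  rw [forall_mem_map_mul_mem_iff _ _ (localSubring x) (toFunctionField_mem_localSubring hxU)]
  refine forall₂_congr fun s _ ↦ ?_
  rw [← toFunctionField_homOfLE e hxU]
  rfl

lemma divisorStalk_top (x : X) {g : X.functionField} :
    g ∈ divisorStalk ⊤ x ↔ g ∈ localSubring x := by
  rw [mem_divisorStalk_iff]
  constructor
  · intro h
    obtain ⟨_, ⟨U, hU, rfl⟩, hxU, -⟩ :=
      X.isBasis_affineOpens.exists_subset_of_mem_open (Set.mem_univ x) isOpen_univ
    have := h ⟨U, hU⟩ hxU 1 trivial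
    rwa [map_one, mul_one] at this
  · intro h U hx f _
    exact (localSubring x).mul_mem h (toFunctionField_mem_localSubring hx f)

lemma mem_divisorStalk_of_mem (J : X.IdealSheafData) (x : X) {g : X.functionField}
    (hg : g ∈ localSubring x) : g ∈ divisorStalk J x := by
  rw [mem_divisorStalk_iff]
  intro U hx f _
  exact (localSubring x).mul_mem hg (toFunctionField_mem_localSubring hx f)

end

end BlowupPlane

namespace BlowupPlane

/-! ### Divisibility of forms -/

section Polynomials

open MvPolynomial

variable {k : Type u} [Field k]

lemma eval₂_mul_of_isHomogeneous {R S σ : Type*} [CommSemiring R] [CommSemiring S] (φ : R →+* S)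
    (c : S) (g : σ → S) {f : MvPolynomial σ R} {n : ℕ} (hf : f.IsHomogeneous n) :
    f.eval₂ φ (fun i ↦ c * g i) = c ^ n * f.eval₂ φ g := by
  rw [eval₂_eq, eval₂_eq, Finset.mul_sum]
  refine Finset.sum_congr rfl fun d hd ↦ ?_
  simp_rw [mul_pow, Finset.prod_mul_distrib, Finset.prod_pow_eq_pow_sum]
  rw [mul_left_comm, hf.degree_eq_sum_deg_support hd]

/-- In lowest terms, an irreducible factor q of the reduced denominator would divide the reduced
numerator times u, hence one of them. This lets divisibility be tested in the local ring at each
prime, where u prime to q is an admissible denominator. -/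
lemma dvd_of_forall_irreducible {R : Type*} [CommRing R] [IsDomain R]
    [UniqueFactorizationMonoid R] {N D : R} (hD : D ≠ 0)
    (H : ∀ q, Irreducible q → ∃ u, ¬ q ∣ u ∧ D ∣ N * u) : D ∣ N := by
  obtain ⟨D', N', c, hrel, rfl, rfl⟩ := UniqueFactorizationMonoid.exists_reduced_factors D hD N
  have hc : c ≠ 0 := left_ne_zero_of_mul hD
  by_cases hu : IsUnit D'
  · exact mul_dvd_mul_left c (hu.dvd)
  · exfalso
    obtain ⟨q, hq, hqD⟩ := WfDvdMonoid.exists_irreducible_factor hu (right_ne_zero_of_mul hD)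
    obtain ⟨u, hqu, hdvd⟩ := H q hq
    rw [mul_assoc] at hdvd
    have h1 : q ∣ N' * u := hqD.trans ((mul_dvd_mul_iff_left hc).mp hdvd)
    rcases (UniqueFactorizationMonoid.irreducible_iff_prime.mp hq).dvd_or_dvd h1 with h | h
    · exact hq.not_isUnit (hrel hqD h)
    · exact hqu h

/-- Compare the components of degree m of both sides. The second alternative is what makes morphisms
towards sheaves of lower degree vanish. -/
lemma exists_homogeneous_quotient {N D f : MvPolynomial (Fin 3) k} {m n : ℕ}
    (hN : N ∈ grading k m) (hD : D ∈ grading k n) (hD0 : D ≠ 0) (h : N = D * f) :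
    (n ≤ m ∧ f ∈ grading k (m - n)) ∨ (m < n ∧ f = 0) := by
  have h1 : (DirectSum.decompose (grading k) N m : MvPolynomial (Fin 3) k) = N :=
    DirectSum.decompose_of_mem_same _ hN
  rcases le_or_gt n m with hnm | hnm
  · refine .inl ⟨hnm, ?_⟩
    rw [h, DirectSum.coe_decompose_mul_of_left_mem_of_le _ hD hnm] at h1
    rw [← mul_left_cancel₀ hD0 h1]
    exact SetLike.coe_mem _
  · refine .inr ⟨hnm, ?_⟩
    rw [h, DirectSum.coe_decompose_mul_of_left_mem_of_not_le _ hD (not_le.mpr hnm)] at h1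
    exact (mul_eq_zero.mp h1.symm).resolve_left hD0

lemma irreducible_of_linear {h : MvPolynomial (Fin 3) k} (hh : h ∈ LinearForms k) (h0 : h ≠ 0) :
    Irreducible h := by
  refine irreducible_of_totalDegree_eq_one (IsHomogeneous.totalDegree hh h0) fun x hx ↦ ?_
  rw [isUnit_iff_ne_zero]
  rintro rfl
  exact h0 (MvPolynomial.ext _ _ fun i ↦ by simpa using hx i)

/-- A polynomial that is not a unit divides linear forms of at most one line. -/
lemma exists_smul_of_dvd_linear {q f g : MvPolynomial (Fin 3) k} (hq : ¬ IsUnit q)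
    (hf : f ∈ LinearForms k) (hg : g ∈ LinearForms k) (hf0 : f ≠ 0) (hqf : q ∣ f) (hqg : q ∣ g) :
    ∃ c : k, g = c • f := by
  have h1 := (irreducible_of_linear hf hf0).isUnit_or_isUnit (hqf.choose_spec)
  have hfq : f ∣ q := by
    obtain ⟨a, ha⟩ := hqf
    have hu := ((irreducible_of_linear hf hf0).isUnit_or_isUnit ha).resolve_left hq
    rw [ha]
    exact (hu.mul_right_dvd).mpr dvd_rfl
  obtain ⟨a, rfl⟩ := hfq.trans hqg
  rcases exists_homogeneous_quotient hg hf hf0 rfl with ⟨-, ha⟩ | ⟨h, -⟩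
  · rw [Nat.sub_self, mem_homogeneousSubmodule, ← totalDegree_zero_iff_isHomogeneous,
      totalDegree_eq_zero_iff_eq_C] at ha
    refine ⟨a.coeff 0, ?_⟩
    rw [smul_eq_C_mul, ← ha, mul_comm]
  · exact absurd h (lt_irrefl _)

lemma exists_X_not_dvd {q : MvPolynomial (Fin 3) k} (hq : Irreducible q) :
    ∃ i, ¬ q ∣ (X i : MvPolynomial (Fin 3) k) := by
  by_contra! h
  obtain ⟨c, hc⟩ := exists_smul_of_dvd_linear hq.not_isUnit (isHomogeneous_X k 0)
    (isHomogeneous_X k 1) (X_ne_zero 0) (h 0) (h 1)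
  have := congrArg (coeff (Finsupp.single 1 1)) hc
  simp [coeff_X, Finsupp.single_left_inj] at this

end Polynomials

/-! ### Closed points of the plane and the forms through them -/

section Points

open MvPolynomial

variable {k : Type u} [Field k]

lemma irrelevant_le_of_X_mem {I : Ideal (MvPolynomial (Fin 3) k)} (h : ∀ i, X i ∈ I) :
    (HomogeneousIdeal.irrelevant (grading k)).toIdeal ≤ I := by
  intro f hf
  have h1 : f ∈ Ideal.span (X '' (Set.univ : Set (Fin 3))) := by
    rw [mem_ideal_span_X_image]
    intro m hm
    by_contra! hm0
    have hm' : m = 0 := Finsupp.ext fun i ↦ hm0 i trivial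
    have h2 : f.coeff m = 0 := by
      have h3 := (HomogeneousIdeal.mem_irrelevant_iff (grading k) f).mp hf
      rw [GradedRing.proj_apply] at h3
      have h4 : homogeneousComponent 0 f = 0 := (decomposition.decompose'_apply f 0).symm.trans h3
      have h5 := congrArg (coeff 0) h4
      rw [coeff_homogeneousComponent] at h5
      simpa [hm'] using h5
    exact (mem_support_iff.mp hm) h2
  refine (Ideal.span_le.mpr ?_) h1
  rintro _ ⟨i, -, rfl⟩
  exact h i

/-- The point of the plane defined by the homogeneous elements of a prime ideal. -/
noncomputable def corePoint (P : Ideal (MvPolynomial (Fin 3) k)) (hP : P.IsPrime)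
    (hX : ∃ i, X i ∉ P) : Plane k :=
  ProjectiveSpectrum.mk (P.homogeneousCore (grading k)) hP.homogeneousCore (by
    obtain ⟨i, hi⟩ := hX
    intro h
    have h1 : (X i : MvPolynomial (Fin 3) k) ∈ HomogeneousIdeal.irrelevant (grading k) :=
      HomogeneousIdeal.mem_irrelevant_of_mem (grading k) one_pos (isHomogeneous_X k i)
    exact hi (Ideal.toIdeal_homogeneousCore_le (grading k) P (h h1)))

lemma mem_corePoint {P : Ideal (MvPolynomial (Fin 3) k)} {hP : P.IsPrime}
    {hX : ∃ i, X i ∉ P} {f : MvPolynomial (Fin 3) k} {n : ℕ} (hf : f ∈ grading k n) :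
    f ∈ (corePoint P hP hX).asHomogeneousIdeal ↔ f ∈ P := by
  refine ⟨fun h ↦ Ideal.toIdeal_homogeneousCore_le (grading k) P h, fun h ↦ ?_⟩
  exact Ideal.mem_homogeneousCore_of_homogeneous_of_mem ⟨n, hf⟩ h

lemma exists_X_notMem (y : Plane k) :
    ∃ i, (X i : MvPolynomial (Fin 3) k) ∉ y.asHomogeneousIdeal := by
  by_contra! h
  exact y.not_irrelevant_le (irrelevant_le_of_X_mem h)

lemma homogeneousIdeal_le_of_forall {I : HomogeneousIdeal (grading k)}
    {J : Ideal (MvPolynomial (Fin 3) k)}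
    (h : ∀ n, ∀ f ∈ grading k n, f ∈ I → f ∈ J) : I.toIdeal ≤ J := by
  classical
  intro f hf
  rw [← DirectSum.sum_support_decompose (grading k) f]
  exact sum_mem fun i _ ↦ h i _ (SetLike.coe_mem _) (I.isHomogeneous i hf)

lemma eq_of_isClosed_of_le {y z : Plane k} (hy : IsClosed {y})
    (h : y.asHomogeneousIdeal ≤ z.asHomogeneousIdeal) : z = y := by
  have := (ProjectiveSpectrum.le_iff_mem_closure (𝒜 := grading k) y z).mp h
  have h2 : closure ({y} : Set (Plane k)) = {y} := hy.closure_eq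
  exact h2.le this

lemma specializes_of_le {y z : Plane k}
    (h : y.asHomogeneousIdeal ≤ z.asHomogeneousIdeal) : y ⤳ z :=
  specializes_iff_mem_closure.mpr
    ((ProjectiveSpectrum.le_iff_mem_closure (𝒜 := grading k) y z).mp h)

lemma le_of_specializes {y z : Plane k} (h : y ⤳ z) :
    y.asHomogeneousIdeal ≤ z.asHomogeneousIdeal :=
  (ProjectiveSpectrum.le_iff_mem_closure (𝒜 := grading k) y z).mpr
    (specializes_iff_mem_closure.mp h)

lemma mem_formsThrough {y : Plane k} {f : MvPolynomial (Fin 3) k} :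
    f ∈ formsThrough y ↔ f ∈ LinearForms k ∧ f ∈ y.asHomogeneousIdeal := Iff.rfl

lemma finrank_linearForms : Module.finrank k (LinearForms k) = 3 := by
  rw [LinearForms, grading, homogeneousSubmodule_one_eq_span_X,
    finrank_span_eq_card (linearIndependent_X (Fin 3) k), Fintype.card_fin]

instance : Module.Finite k (LinearForms k) :=
  Module.finite_of_finrank_pos (by rw [finrank_linearForms]; norm_num)

variable [IsAlgClosed k]

/-- By the Nullstellensatz the affine cone of `y` has a point v other than the origin, since
otherwise all variables would lie in the ideal of `y`. The homogeneous core of the ideal of v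
contains that of `y`, and closedness of `y` makes them equal. -/
lemma exists_coordinates {y : Plane k} (hy : IsClosed {y}) :
    ∃ v : Fin 3 → k, v ≠ 0 ∧ ∀ n, ∀ f ∈ grading k n, f ∈ y.asHomogeneousIdeal ↔ eval v f = 0 := by
  have hprime : y.asHomogeneousIdeal.toIdeal.IsPrime := y.isPrime
  obtain ⟨v, hv, hv0⟩ : ∃ v ∈ zeroLocus k y.asHomogeneousIdeal.toIdeal, v ≠ 0 := by
    by_contra! h
    refine y.not_irrelevant_le (irrelevant_le_of_X_mem fun i ↦ ?_)
    change X i ∈ y.asHomogeneousIdeal.toIdeal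
    rw [← IsPrime.vanishingIdeal_zeroLocus (K := k) y.asHomogeneousIdeal.toIdeal,
      mem_vanishingIdeal_iff]
    intro x hx
    simp [h x hx]
  have hle : y.asHomogeneousIdeal.toIdeal ≤ RingHom.ker (eval v) := fun f hf ↦ by
    have := mem_zeroLocus_iff.mp hv f hf
    rwa [← coe_aeval_eq_eval]
  obtain ⟨i, hi⟩ := Function.ne_iff.mp hv0
  have hX : ∃ i, X i ∉ RingHom.ker (eval v) := ⟨i, by simpa [RingHom.mem_ker] using hi⟩
  have heq : corePoint (RingHom.ker (eval v)) (RingHom.ker_isPrime _) hX = y := by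
    refine eq_of_isClosed_of_le hy ?_
    exact homogeneousIdeal_le_of_forall fun n f hf hfy ↦ (mem_corePoint hf).mpr (hle hfy)
  refine ⟨v, hv0, fun n f hf ↦ ?_⟩
  rw [← heq, mem_corePoint hf, RingHom.mem_ker]

/-- The space is the kernel of a nonzero functional, evaluation at the coordinates of `y`, on a
space of dimension three. -/
lemma finrank_formsThrough {y : Plane k} (hy : IsClosed {y}) :
    Module.finrank k (formsThrough y) = 2 := by
  obtain ⟨v, hv0, hv⟩ := exists_coordinates hy
  let φ : LinearForms k →ₗ[k] k := (aeval v).toLinearMap ∘ₗ (LinearForms k).subtype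
  have hker : (LinearMap.ker φ).map (LinearForms k).subtype = formsThrough y := by
    ext f
    simp only [Submodule.mem_map, LinearMap.mem_ker, mem_formsThrough]
    constructor
    · rintro ⟨g, hg, rfl⟩
      refine ⟨g.2, (hv 1 _ g.2).mpr ?_⟩
      rw [← coe_aeval_eq_eval]
      exact hg
    · rintro ⟨h1, h2⟩
      refine ⟨⟨f, h1⟩, ?_, rfl⟩
      have := (hv 1 f h1).mp h2
      rwa [← coe_aeval_eq_eval] at this
  have hsurj : Function.Surjective φ := by
    refine LinearMap.surjective ?_
    obtain ⟨i, hi⟩ := Function.ne_iff.mp hv0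
    intro h
    apply hi
    have := LinearMap.congr_fun h ⟨X i, isHomogeneous_X k i⟩
    simpa [φ] using this
  have h1 := LinearMap.finrank_range_add_finrank_ker φ
  rw [LinearMap.range_eq_top.mpr hsurj, finrank_top, Module.finrank_self,
    finrank_linearForms] at h1
  have h2 := LinearEquiv.finrank_eq
    (Submodule.equivMapOfInjective (LinearForms k).subtype Subtype.val_injective (LinearMap.ker φ))
  rw [hker] at h2
  omega

lemma exists_sub_smul_mem_formsThrough {y : Plane k} (hy : IsClosed {y})
    {z : MvPolynomial (Fin 3) k} (hz : z ∈ LinearForms k) (hzy : z ∉ y.asHomogeneousIdeal)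
    {f : MvPolynomial (Fin 3) k} (hf : f ∈ LinearForms k) :
    ∃ c : k, f - c • z ∈ formsThrough y := by
  obtain ⟨v, hv0, hv⟩ := exists_coordinates hy
  have hzv : eval v z ≠ 0 := fun h ↦ hzy ((hv 1 z hz).mpr h)
  have hmem : f - (eval v f / eval v z) • z ∈ LinearForms k :=
    sub_mem hf (Submodule.smul_mem _ _ hz)
  refine ⟨eval v f / eval v z, hmem, (hv 1 _ hmem).mpr ?_⟩
  simp [smul_eval, hzv]

/-- Quadratic forms that vanish at a closed point are sums of products of a linear form through
the point and another linear form. -/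
lemma mem_formsThrough_mul {y : Plane k} (hy : IsClosed {y}) {f : MvPolynomial (Fin 3) k}
    (hf : f ∈ grading k 2) (hfy : f ∈ y.asHomogeneousIdeal) :
    f ∈ formsThrough y * LinearForms k := by
  obtain ⟨i, hi⟩ := exists_X_notMem y
  have hz : (X i : MvPolynomial (Fin 3) k) ∈ LinearForms k := isHomogeneous_X k i
  generalize (X i : MvPolynomial (Fin 3) k) = z at hi hz
  -- Modulo H_y V* every linear factor is a multiple of z, so every quadric is a multiple of z².
  -- Vanishing at `y`, where z does not vanish, then forces the multiple to be zero.
  have key : ∃ c : k, f - c • z ^ 2 ∈ formsThrough y * LinearForms k := by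
    have hf' : f ∈ LinearForms k * LinearForms k := by
      rw [← pow_two]
      exact (homogeneousSubmodule_one_pow (σ := Fin 3) (R := k) 2).ge hf
    clear hf hfy
    induction hf' using Submodule.mul_induction_on' with
    | mem_mul_mem a ha b hb =>
      obtain ⟨c, hc⟩ := exists_sub_smul_mem_formsThrough hy hz hi ha
      obtain ⟨d, hd⟩ := exists_sub_smul_mem_formsThrough hy hz hi hb
      refine ⟨c * d, ?_⟩
      have : a * b - (c * d) • z ^ 2 = (a - c • z) * b + (b - d • z) * (c • z) := by
        simp only [smul_eq_C_mul, map_mul]; ring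
      rw [this]
      exact add_mem (Submodule.mul_mem_mul hc hb)
        (Submodule.mul_mem_mul hd (Submodule.smul_mem _ _ hz))
    | add a _ b _ ha hb =>
      obtain ⟨c, hc⟩ := ha
      obtain ⟨d, hd⟩ := hb
      refine ⟨c + d, ?_⟩
      have : a + b - (c + d) • z ^ 2 = (a - c • z ^ 2) + (b - d • z ^ 2) := by
        simp only [smul_eq_C_mul, map_add]; ring
      rw [this]
      exact add_mem hc hd
  obtain ⟨c, hc⟩ := key
  have hle : ∀ g ∈ formsThrough y * LinearForms k, g ∈ y.asHomogeneousIdeal.toIdeal := by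
    intro g hg
    induction hg using Submodule.mul_induction_on' with
    | mem_mul_mem a ha b hb => exact Ideal.mul_mem_right _ _ ha.2
    | add a _ b _ ha hb => exact add_mem ha hb
  have h1 : c • z ^ 2 ∈ y.asHomogeneousIdeal.toIdeal := by
    have := sub_mem (show f ∈ y.asHomogeneousIdeal.toIdeal from hfy) (hle _ hc)
    simpa using this
  have hc0 : c = 0 := by
    by_contra hc0
    rw [smul_eq_C_mul] at h1
    rcases y.isPrime.mem_or_mem h1 with h | h
    · exact y.isPrime.ne_top (Ideal.eq_top_of_isUnit_mem _ h ((isUnit_iff_ne_zero.mpr hc0).map C))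
    · exact hi (y.isPrime.mem_of_pow_mem 2 h)
  simpa [hc0] using hc

/-- The forms v_j X_i - v_i X_j pass through the point with coordinates v. If they also vanish at w,
then w is proportional to v, and homogeneous forms cannot tell the two apart. -/
lemma eq_of_formsThrough_le {y z : Plane k} (hy : IsClosed {y}) (hz : IsClosed {z})
    (h : formsThrough y ≤ formsThrough z) : y = z := by
  obtain ⟨v, hv0, hv⟩ := exists_coordinates hy
  obtain ⟨w, hw0, hw⟩ := exists_coordinates hz
  obtain ⟨j, hj⟩ := Function.ne_iff.mp hv0
  have hprop : w = fun i ↦ (w j / v j) * v i := by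
    funext i
    have hmem : C (v j) * X i - C (v i) * X j ∈ LinearForms k :=
      sub_mem (isHomogeneous_C_mul_X _ _) (isHomogeneous_C_mul_X _ _)
    have h1 : C (v j) * X i - C (v i) * X j ∈ formsThrough y :=
      ⟨hmem, (hv 1 _ hmem).mpr (by simp [mul_comm])⟩
    have h2 := (hw 1 _ hmem).mp (h h1).2
    simp only [map_sub, map_mul, eval_C, eval_X] at h2
    have hj' : v j ≠ 0 := hj
    field_simp
    linear_combination h2
  refine (eq_of_isClosed_of_le hy ?_).symm
  refine homogeneousIdeal_le_of_forall fun n f hf hfy ↦ (hw n f hf).mpr ?_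
  rw [hprop]
  have := eval₂_mul_of_isHomogeneous (RingHom.id k) (w j / v j) v hf
  rw [← eval₂_id, this, eval₂_id, (hv n f hf).mp hfy, mul_zero]

/-- Some form through `z` does not vanish at `y`, and subtracting a multiple of it moves any form
into those through `y`. -/
lemma exists_add_of_ne {y z : Plane k} (hy : IsClosed {y}) (hz : IsClosed {z}) (hne : y ≠ z)
    {f : MvPolynomial (Fin 3) k} (hf : f ∈ LinearForms k) :
    ∃ a ∈ formsThrough y, ∃ b ∈ formsThrough z, f = a + b := by
  obtain ⟨b, hbz, hby⟩ := SetLike.not_le_iff_exists.mp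
    fun h ↦ hne.symm (eq_of_formsThrough_le hz hy h)
  obtain ⟨c, hc⟩ := exists_sub_smul_mem_formsThrough hy hbz.1 (fun h ↦ hby ⟨hbz.1, h⟩) hf
  exact ⟨_, hc, _, Submodule.smul_mem _ c hbz, by simp⟩

/-- All linear forms in the prime ideal of q are divisible by q, hence proportional, whereas those
through a closed point form a plane. So generic points of curves avoid the centre of the blow-up. -/
lemma ne_corePoint_span {y : Plane k} (hy : IsClosed {y}) {q : MvPolynomial (Fin 3) k}
    (hq : ¬ IsUnit q) {hP : (Ideal.span {q}).IsPrime} {hX : ∃ i, X i ∉ Ideal.span {q}} :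
    corePoint (Ideal.span {q}) hP hX ≠ y := by
  rintro rfl
  have h2 := finrank_formsThrough hy
  have hdvd : ∀ f ∈ formsThrough (corePoint (Ideal.span {q}) hP hX), q ∣ f := fun f hf ↦
    Ideal.mem_span_singleton.mp ((mem_corePoint hf.1).mp hf.2)
  have : Nontrivial (formsThrough (corePoint (Ideal.span {q}) hP hX)) :=
    Module.nontrivial_of_finrank_pos (R := k) (by omega)
  obtain ⟨f, hf0⟩ := exists_ne (0 : formsThrough (corePoint (Ideal.span {q}) hP hX))
  have h1 := finrank_le_one (R := k) f fun g ↦ by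
    obtain ⟨c, hc⟩ := exists_smul_of_dvd_linear hq f.2.1 g.2.1
      (fun h ↦ hf0 (Subtype.ext h)) (hdvd f f.2) (hdvd g g.2)
    exact ⟨c, Subtype.ext hc.symm⟩
  omega

end Points

end BlowupPlane

namespace BlowupPlane

/-! ### Consequences of the universal property of a blow-up -/

section Blowup

variable {X Y Z : Scheme.{u}}

lemma isInvertibleIdeal_top : IsInvertibleIdeal (⊤ : X.IdealSheafData) := by
  intro x
  obtain ⟨_, ⟨U, hU, rfl⟩, hxU, -⟩ :=
    X.isBasis_affineOpens.exists_subset_of_mem_open (Set.mem_univ x) isOpen_univ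
  exact ⟨⟨U, hU⟩, hxU, 1, one_mem _, by rw [Ideal.span_singleton_one]; rfl⟩

lemma comap_eq_top_of_forall_notMem {I : Y.IdealSheafData} {f : Z ⟶ Y}
    (h : ∀ z, f z ∉ I.support) : I.comap f = ⊤ := by
  rw [← Scheme.IdealSheafData.support_eq_bot_iff, Scheme.IdealSheafData.support_comap]
  exact Closeds.ext (Set.eq_empty_of_forall_notMem h)

variable {b : X ⟶ Y} {I : Y.IdealSheafData}

/-- A blow-up is an isomorphism over the complement of its centre. -/
lemma IsBlowup.isIso_restrict (hb : IsBlowup b I) (U : Y.Opens)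
    (hU : ∀ y ∈ U, y ∉ I.support) : IsIso (b ∣_ U) := by
  -- Over the complement of the centre the ideal becomes the unit ideal, which is invertible, so the
  -- inclusion of `U` lifts. The lift is the inverse.
  obtain ⟨g, hg, -⟩ := hb.universal U.ι (by
    rw [comap_eq_top_of_forall_notMem (f := U.ι) fun z ↦ hU _ z.2]
    exact isInvertibleIdeal_top)
  have hrange : Set.range g ⊆ Set.range (b ⁻¹ᵁ U).ι := by
    rintro _ ⟨z, rfl⟩
    rw [Scheme.Opens.range_ι]
    change b (g z) ∈ U
    rw [← Scheme.Hom.comp_apply, hg]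
    exact z.2
  let g' := IsOpenImmersion.lift (b ⁻¹ᵁ U).ι g hrange
  have hg' : g' ≫ (b ⁻¹ᵁ U).ι = g := IsOpenImmersion.lift_fac _ _ _
  refine ⟨g', ?_, ?_⟩
  · rw [← cancel_mono (b ⁻¹ᵁ U).ι, Category.assoc, hg', Category.id_comp]
    -- That the lift is also a left inverse is the uniqueness of liftings of the restricted blow-up
    -- map.
    obtain ⟨w, -, hw⟩ := hb.universal ((b ⁻¹ᵁ U).ι ≫ b) (by
      rw [comap_eq_top_of_forall_notMem (f := (b ⁻¹ᵁ U).ι ≫ b) fun z ↦ hU _ z.2]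
      exact isInvertibleIdeal_top)
    rw [hw (b ∣_ U ≫ g) (by
      dsimp only
      rw [Category.assoc, hg, morphismRestrict_ι]), hw (b ⁻¹ᵁ U).ι rfl]
  · rw [← cancel_mono U.ι, Category.assoc, morphismRestrict_ι, reassoc_of% hg', hg,
      Category.id_comp]

lemma IsBlowup.isIso_stalkMap (hb : IsBlowup b I) {x : X} (hx : b x ∉ I.support) :
    IsIso (b.stalkMap x) := by
  let U : Y.Opens := I.support.compl
  have : IsIso (b ∣_ U) := hb.isIso_restrict U fun y hy ↦ hy
  have hxU : x ∈ b ⁻¹ᵁ U := hx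
  have h1 (z) : IsIso ((b ∣_ U).stalkMap z) := inferInstance
  have := (MorphismProperty.isomorphisms CommRingCat).arrow_mk_iso_iff
    (morphismRestrictStalkMap b U ⟨x, hxU⟩)
  exact this.mp (h1 _)

/-- Finitely generated ideals of a valuation ring are principal, and a nonzero generator is regular
because the ring is a domain. -/
lemma isInvertibleIdeal_of_valuationRing {A : Type u} [CommRing A] [IsDomain A] [ValuationRing A]
    (J : (Spec (.of A)).IdealSheafData) (hfg : (J.ideal ⟨⊤, isAffineOpen_top _⟩).FG)
    (h0 : J ≠ ⊥) : IsInvertibleIdeal J := by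
  intro x
  refine ⟨⟨⊤, isAffineOpen_top _⟩, trivial, ?_⟩
  have e : Γ(Spec (.of A), ⊤) ≃+* A := (Scheme.ΓSpecIso (.of A)).commRingCatIsoToRingEquiv
  have hprinc : (J.ideal ⟨⊤, isAffineOpen_top _⟩).IsPrincipal := by
    have h1 : ((J.ideal ⟨⊤, isAffineOpen_top _⟩).map e.toRingHom).IsPrincipal :=
      IsBezout.isPrincipal_of_FG _ (hfg.map _)
    obtain ⟨a, ha⟩ := h1
    refine ⟨e.symm a, ?_⟩
    change _ = Ideal.span {a} at ha
    have h2 := congrArg (Ideal.map e.symm.toRingHom) ha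
    rw [Ideal.map_map, Ideal.map_span, Set.image_singleton] at h2
    have h3 : e.symm.toRingHom.comp e.toRingHom = RingHom.id _ := by ext; simp
    rw [h3, Ideal.map_id] at h2
    exact h2
  obtain ⟨a, ha⟩ := hprinc
  change _ = Ideal.span {a} at ha
  refine ⟨a, ?_, ha⟩
  have : IsDomain Γ(Spec (.of A), ⊤) := e.isDomain_iff.mpr inferInstance
  rw [mem_nonZeroDivisors_iff_ne_zero]
  rintro rfl
  apply h0
  apply Scheme.IdealSheafData.ext_of_isAffine
  rw [ha, Ideal.span_singleton_eq_bot.mpr rfl]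
  rfl

open IsLocalRing in
/-- A blow-up of a locally noetherian scheme is surjective over every point that has a
generization outside of the centre. -/
lemma IsBlowup.exists_eq_of_specializes [IsLocallyNoetherian Y] (hb : IsBlowup b I) {ξ y : Y}
    (h : ξ ⤳ y) (hξ : ξ ∉ I.support) : ∃ x, b x = y := by
  let φ : Y.presheaf.stalk y ⟶ Y.residueField ξ :=
    Y.presheaf.stalkSpecializes h ≫ Y.residue ξ
  -- A valuation ring of the residue field of ξ that dominates the image of the local ring at y
  -- gives a morphism from Spec A to Y that sends the closed point to y and the generic point to ξ.
  -- The pulled-back ideal is finitely generated, and nonzero because ξ is outside the centre. So it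
  -- is invertible and the morphism lifts.
  obtain ⟨A, hA, hA_local⟩ := exists_factor_valuationRing φ.hom
  let ψ : Y.presheaf.stalk y ⟶ .of A := CommRingCat.ofHom (φ.hom.codRestrict _ hA)
  let f : Spec (.of A) ⟶ Y := Spec.map ψ ≫ Y.fromSpecStalk y
  have w : Spec.map (CommRingCat.ofHom (algebraMap A (Y.residueField ξ))) ≫ f =
      Y.fromSpecResidueField ξ := by
    rw [Scheme.fromSpecResidueField, ← Scheme.SpecMap_stalkSpecializes_fromSpecStalk h]
    simp only [f, ← Spec.map_comp_assoc]
    rfl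
  have hy : f (closedPoint A) = y := by
    have h1 : Spec.map ψ (closedPoint A) = closedPoint (Y.presheaf.stalk y) :=
      comap_closedPoint (S := A) (φ.hom.codRestrict A.toSubring hA)
    change Y.fromSpecStalk y (Spec.map ψ (closedPoint A)) = y
    rw [h1, Scheme.fromSpecStalk_closedPoint]
  have hne : I.comap f ≠ ⊥ := by
    intro hbot
    have h1 : Spec.map (CommRingCat.ofHom (algebraMap A (Y.residueField ξ)))
        (closedPoint (Y.residueField ξ)) ∈ (I.comap f).support := by
      rw [hbot]; trivial
    rw [Scheme.IdealSheafData.support_comap] at h1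
    have h2 : f (Spec.map (CommRingCat.ofHom (algebraMap A (Y.residueField ξ)))
        (closedPoint (Y.residueField ξ))) ∈ I.support := h1
    have h3 := congrArg (fun g : Spec (Y.residueField ξ) ⟶ Y ↦
      g (closedPoint (Y.residueField ξ))) w
    have h4 := h3.trans (Scheme.fromSpecResidueField_apply ξ _)
    exact hξ (h4 ▸ h2)
  have hfg : ((I.comap f).ideal ⟨⊤, isAffineOpen_top _⟩).FG := by
    obtain ⟨_, ⟨V, hV, rfl⟩, hyV, -⟩ :=
      Y.isBasis_affineOpens.exists_subset_of_mem_open (Set.mem_univ y) isOpen_univ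
    -- Spec A is local: an open set that contains its closed point is everything.
    have htop : f ⁻¹ᵁ V = ⊤ :=
      Scheme.preimage_eq_top_of_closedPoint_mem f (by rw [hy]; exact hyV)
    have hN : IsNoetherianRing Γ(Y, V) :=
      IsLocallyNoetherian.component_noetherian ⟨V, hV⟩
    rw [ideal_comap f I ⟨V, hV⟩ ⟨⊤, isAffineOpen_top _⟩ htop.ge]
    exact Ideal.FG.map ((isNoetherianRing_iff_ideal_fg _).mp hN _) _
  obtain ⟨g, hg, -⟩ := hb.universal f (isInvertibleIdeal_of_valuationRing _ hfg hne)
  refine ⟨g (closedPoint A), ?_⟩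
  have h3 := congrArg (fun g : Spec (.of A) ⟶ Y ↦ g (closedPoint A)) hg
  exact h3.trans hy

end Blowup

/-! ### The generic point and surjectivity over the plane -/

section Plane

open MvPolynomial

variable {k : Type u} [Field k]

instance : IsLocallyNoetherian (Plane k) := by
  have h1 : IsNoetherianRing (grading k 0) := inferInstance
  have h3 : IsScalarTower k (grading k 0) (MvPolynomial (Fin 3) k) :=
    ⟨fun a b c ↦ by
      change ((a • b : grading k 0) : MvPolynomial (Fin 3) k) * c = a • ((b : MvPolynomial (Fin 3) k) * c)
      rw [← smul_mul_assoc]; rfl⟩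
  have h2 : Algebra.FiniteType (grading k 0) (MvPolynomial (Fin 3) k) :=
    Algebra.FiniteType.of_restrictScalars_finiteType k _ _
  exact LocallyOfFiniteType.isLocallyNoetherian (Proj.toSpecZero (grading k))

variable (k) in
/-- The generic point of the plane. -/
noncomputable def Plane.genericPt : Plane k :=
  corePoint ⊥ Ideal.isPrime_bot ⟨0, by simp⟩

lemma mem_genericPt {f : MvPolynomial (Fin 3) k} :
    f ∈ (Plane.genericPt k).asHomogeneousIdeal ↔ f = 0 := by
  constructor
  · intro h
    exact Ideal.toIdeal_homogeneousCore_le (grading k) ⊥ h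
  · rintro rfl
    exact zero_mem _

lemma genericPt_specializes (y : Plane k) : Plane.genericPt k ⤳ y := by
  refine specializes_of_le fun f hf ↦ ?_
  have : f = 0 := mem_genericPt.mp hf
  rw [this]
  exact zero_mem _

lemma eq_genericPt_of_specializes {y : Plane k} (h : y ⤳ Plane.genericPt k) :
    y = Plane.genericPt k := by
  refine ProjectiveSpectrum.ext (le_antisymm (le_of_specializes h)
    (le_of_specializes (genericPt_specializes y)))

lemma mem_support_pointIdeal {Y : Scheme.{u}} {x : Y} (hx : IsClosed {x}) {y : Y} :
    y ∈ (pointIdeal x hx).support ↔ y = x := Iff.of_eq (by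
  rw [← SetLike.mem_coe, pointIdeal, Scheme.IdealSheafData.coe_support_vanishingIdeal]
  rfl)

lemma mem_support_pointsIdeal {Y : Scheme.{u}} {t : ℕ} {p : Fin t → Y}
    (hp : ∀ i, IsClosed {p i}) {y : Y} :
    y ∈ (pointsIdeal p hp).support ↔ ∃ i, p i = y := Iff.of_eq (by
  rw [← SetLike.mem_coe, pointsIdeal, Scheme.IdealSheafData.coe_support_vanishingIdeal]
  rfl)

lemma genericPt_ne_of_isClosed [IsAlgClosed k] {y : Plane k} (hy : IsClosed {y}) :
    Plane.genericPt k ≠ y := by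
  rintro rfl
  have h1 := finrank_formsThrough hy
  have : formsThrough (Plane.genericPt k) = ⊥ := by
    rw [eq_bot_iff]
    intro f hf
    exact mem_genericPt.mp hf.2
  rw [this, finrank_bot] at h1
  omega

variable [IsAlgClosed k] {X : Scheme.{u}} {b : X ⟶ Plane k} {t : ℕ} {p : Fin t → Plane k}
  {hp : ∀ i, IsClosed {p i}}

lemma IsBlowup.surjective_of_points (hb : IsBlowup b (pointsIdeal p hp)) (y : Plane k) :
    ∃ x, b x = y := by
  refine hb.exists_eq_of_specializes (genericPt_specializes y) ?_
  rw [mem_support_pointsIdeal]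
  rintro ⟨i, hi⟩
  exact genericPt_ne_of_isClosed (hp i) hi.symm

/-- By surjectivity some point lies over the generic point of the plane. The generic point of X
specializes to it, and only the generic point of the plane specializes to itself. -/
lemma IsBlowup.apply_genericPoint [IsIntegral X] (hb : IsBlowup b (pointsIdeal p hp)) :
    b (genericPoint X) = Plane.genericPt k := by
  obtain ⟨x, hx⟩ := hb.surjective_of_points (Plane.genericPt k)
  apply eq_genericPt_of_specializes
  rw [← hx]
  exact ((genericPoint_spec X).specializes trivial).map b.continuous

end Plane

end BlowupPlane

namespace BlowupPlane

/-! ### Dehomogenization and pull-back of rational functions -/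

noncomputable section

open MvPolynomial

variable {k : Type u} [Field k]

attribute [local instance] functionFieldCommRing

instance (y : Plane k) : y.asHomogeneousIdeal.toIdeal.IsPrime := y.isPrime

section Dehomogenize

variable (y : Plane k) (hX : (X 0 : MvPolynomial (Fin 3) k) ∉ y.asHomogeneousIdeal)

/-- Evaluation of a polynomial at the coordinates `(1, X₁ / X₀, X₂ / X₀)` in the local ring at a
point of the plane. -/
def dehom : MvPolynomial (Fin 3) k →+*
    HomogeneousLocalization.AtPrime (grading k) y.asHomogeneousIdeal.toIdeal :=
  eval₂Hom ((HomogeneousLocalization.fromZeroRingHom (grading k) _).comp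
    (algebraMap k (grading k 0)))
    fun i ↦ HomogeneousLocalization.mk ⟨1, ⟨X i, isHomogeneous_X k i⟩, ⟨X 0, isHomogeneous_X k 0⟩, hX⟩

lemma val_dehom {f : MvPolynomial (Fin 3) k} {n : ℕ} (hf : f ∈ grading k n) :
    algebraMap (MvPolynomial (Fin 3) k)
      (Localization.AtPrime y.asHomogeneousIdeal.toIdeal) (X 0) ^ n *
      (dehom y hX f).val = algebraMap _ _ f := by
  have h1 : (dehom y hX f).val = f.eval₂ ((algebraMap (MvPolynomial (Fin 3) k)
      (Localization.AtPrime y.asHomogeneousIdeal.toIdeal)).comp C)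
      fun i ↦ Localization.mk (X i) ⟨X 0, hX⟩ := by
    change (algebraMap _ (Localization.AtPrime y.asHomogeneousIdeal.toIdeal)) (dehom y hX f) = _
    rw [dehom, coe_eval₂Hom, hom_eval₂]
    rfl
  rw [h1, ← eval₂_mul_of_isHomogeneous _ _ _ hf]
  have h2 : ∀ i, algebraMap (MvPolynomial (Fin 3) k)
      (Localization.AtPrime y.asHomogeneousIdeal.toIdeal) (X 0) *
        Localization.mk (X i) ⟨X 0, hX⟩ = algebraMap _ _ (X i) := fun i ↦ by
    rw [Localization.mk_eq_mk', mul_comm]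
    exact IsLocalization.mk'_spec _ _ (⟨X 0, hX⟩ : y.asHomogeneousIdeal.toIdeal.primeCompl)
  simp_rw [h2]
  exact ((hom_eval₂ f C (algebraMap _ _) X).symm.trans (by rw [eval₂_eta]))

/-- Multiplying by the power of X₀ given by the common degree turns the dehomogenized numerator and
denominator back into the forms themselves. Thus degree-zero fractions become quotients of values of
one ring homomorphism. -/
lemma mk_mul_dehom (c : HomogeneousLocalization.NumDenSameDeg (grading k)
    y.asHomogeneousIdeal.toIdeal.primeCompl) :
    HomogeneousLocalization.mk c * dehom y hX c.den = dehom y hX c.num := by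
  apply HomogeneousLocalization.val_injective
  have hu : IsUnit (algebraMap (MvPolynomial (Fin 3) k)
      (Localization.AtPrime y.asHomogeneousIdeal.toIdeal) (X 0) ^ c.deg) :=
    (IsLocalization.map_units _ (⟨X 0, hX⟩ : y.asHomogeneousIdeal.toIdeal.primeCompl)).pow _
  apply hu.mul_left_cancel
  rw [HomogeneousLocalization.val_mul, mul_left_comm, val_dehom y hX c.den.2,
    val_dehom y hX c.num.2, HomogeneousLocalization.val_mk, Localization.mk_eq_mk']
  exact IsLocalization.mk'_spec _ _ (⟨c.den, c.den_mem⟩ : y.asHomogeneousIdeal.toIdeal.primeCompl)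

lemma isUnit_dehom {n : ℕ} {s : MvPolynomial (Fin 3) k} (hs : s ∈ grading k n)
    (hsy : s ∉ y.asHomogeneousIdeal) : IsUnit (dehom y hX s) := by
  have h := mk_mul_dehom y hX ⟨n, ⟨X 0 ^ n, by simpa using (isHomogeneous_X k 0).pow n⟩, ⟨s, hs⟩, hsy⟩
  refine .of_mul_eq_one_right _ (h.trans ?_)
  have h0 : dehom y hX (X 0) = 1 := by
    rw [dehom, coe_eval₂Hom, eval₂_X]
    apply HomogeneousLocalization.val_injective
    rw [HomogeneousLocalization.val_mk, HomogeneousLocalization.val_one]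
    exact Localization.mk_self (⟨X 0, hX⟩ : y.asHomogeneousIdeal.toIdeal.primeCompl)
  change dehom y hX (X 0 ^ n) = 1
  rw [map_pow, h0, one_pow]

end Dehomogenize

variable {X : Scheme.{u}} [IsIntegral X] (b : X ⟶ Plane k)

/-- The map from a local ring to the function field. -/
def stalkToFunctionField (x : X) : X.presheaf.stalk x →+* X.functionField :=
  algebraMap (X.presheaf.stalk x) X.functionField

lemma toFunctionField_apply {U : X.Opens} {x : X} (hx : x ∈ U) (f : Γ(X, U)) :
    toFunctionField ⟨x, hx⟩ f = stalkToFunctionField x (X.presheaf.germ U x hx f) := rfl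

lemma mem_localSubring_iff {x : X} {g : X.functionField} :
    g ∈ localSubring x ↔ ∃ r, stalkToFunctionField x r = g := Iff.rfl

/-- The pull-back of rational functions on the plane. -/
def pullbackFunction : HomogeneousLocalization.AtPrime (grading k)
    (b (genericPoint X)).asHomogeneousIdeal.toIdeal →+* X.functionField :=
  ((stalkToFunctionField (genericPoint X)).comp (b.stalkMap (genericPoint X)).hom).comp
    (Proj.stalkIso' (grading k) (b (genericPoint X))).symm.toRingHom

lemma apply_genericPoint_mem {V : (Plane k).Opens} {x : X} (hx : b x ∈ V) :
    b (genericPoint X) ∈ V :=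
  ((genericPoint_spec X).specializes (Set.mem_univ x)).mem_open (b ⁻¹ᵁ V).isOpen hx

/-- The function field is the local ring at the generic point, so only the value of the section at
the image of that point matters, whichever x is used. -/
lemma toFunctionField_app {V : (Plane k).Opens} {x : X} (hx : b x ∈ V) (f : Γ(Plane k, V)) :
    toFunctionField (U := b ⁻¹ᵁ V) ⟨x, hx⟩ (b.app V f) =
      pullbackFunction b (f.1 ⟨b (genericPoint X), apply_genericPoint_mem b hx⟩) := by
  rw [toFunctionField_eq _ (⟨genericPoint X, apply_genericPoint_mem b hx⟩ : b ⁻¹ᵁ V)]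
  have h3 := Proj.stalkIso'_germ (grading k) V (b (genericPoint X)) (apply_genericPoint_mem b hx) f
  have h4 := Scheme.Hom.germ_stalkMap_apply b V (genericPoint X) (apply_genericPoint_mem b hx) f
  exact (congrArg (stalkToFunctionField (genericPoint X)) h4.symm).trans
    (congrArg (fun z ↦ stalkToFunctionField (genericPoint X) ((b.stalkMap (genericPoint X)).hom z))
    (((Proj.stalkIso' (grading k) (b (genericPoint X))).symm_apply_apply _).symm.trans
      (congrArg _ h3)))

end

end BlowupPlane

namespace BlowupPlane

/-! ### Forms as rational functions on X -/

noncomputable section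

open MvPolynomial

variable {k : Type u} [Field k]

attribute [local instance] functionFieldCommRing

/-- The section `a / s` of the structure sheaf of the plane over the set `s ≠ 0`. -/
def fractionSection {n : ℕ} {a s : MvPolynomial (Fin 3) k} (ha : a ∈ grading k n)
    (hs : s ∈ grading k n) : Γ(Plane k, Proj.basicOpen (grading k) s) :=
  ⟨fun y => HomogeneousLocalization.mk ⟨n, ⟨a, ha⟩, ⟨s, hs⟩, y.2⟩, fun y =>
    ⟨ProjectiveSpectrum.basicOpen (grading k) s, y.2,
      ⟨𝟙 _, ⟨n, ⟨⟨a, ha⟩, ⟨s, hs⟩, _, fun _ => rfl⟩⟩⟩⟩⟩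

lemma awayToSection_mk {h f : MvPolynomial (Fin 3) k} (hh : h ∈ LinearForms k)
    (hf : f ∈ LinearForms k) (hf' : f ∈ grading k (1 • 1)) :
    Proj.awayToSection (grading k) h (HomogeneousLocalization.Away.mk (grading k) hh 1 f hf') =
      fractionSection hf hh := by
  refine Subtype.ext (funext fun y ↦ HomogeneousLocalization.val_injective _ ?_)
  have : y.1.asHomogeneousIdeal.toIdeal.IsPrime := y.1.isPrime
  refine (HomogeneousLocalization.val_mk (x := y.1.asHomogeneousIdeal.toIdeal.primeCompl)
    ⟨1 • 1, ⟨f, hf'⟩, ⟨h ^ 1, SetLike.pow_mem_graded 1 hh⟩,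
      Submonoid.powers_le.mpr y.2 ⟨1, rfl⟩⟩).trans ?_
  refine Eq.trans ?_ (HomogeneousLocalization.val_mk
    (x := y.1.asHomogeneousIdeal.toIdeal.primeCompl) ⟨1, ⟨f, hf⟩, ⟨h, hh⟩, y.2⟩).symm
  congr 1
  exact Subtype.ext (pow_one h)

lemma isUnit_mk_iff {y : Plane k} (c : HomogeneousLocalization.NumDenSameDeg (grading k)
    y.asHomogeneousIdeal.toIdeal.primeCompl) :
    IsUnit (HomogeneousLocalization.mk c) ↔ (c.num : MvPolynomial (Fin 3) k) ∉ y.asHomogeneousIdeal := by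
  refine (HomogeneousLocalization.isUnit_iff_isUnit_val _ _ _).symm.trans ?_
  rw [HomogeneousLocalization.val_mk, Localization.mk_eq_mk']
  exact (IsLocalization.AtPrime.isUnit_mk'_iff (Localization.AtPrime y.asHomogeneousIdeal.toIdeal)
    y.asHomogeneousIdeal.toIdeal c.num ⟨c.den, c.den_mem⟩)

lemma mem_basicOpen_iff_isUnit {V : (Plane k).Opens} {y : Plane k} (hy : y ∈ V) (f : Γ(Plane k, V)) :
    y ∈ (Plane k).basicOpen f ↔ IsUnit (f.1 ⟨y, hy⟩) := by
  have h3 := Proj.stalkIso'_germ (grading k) V y hy f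
  rw [← h3]
  refine ((Plane k).mem_basicOpen f y hy).trans ?_
  exact (MulEquiv.isUnit_map (Proj.stalkIso' (grading k) y)).symm

/-- A section of the structure sheaf of the plane is locally a fraction. -/
lemma exists_isFraction {V : (Plane k).Opens} {y : Plane k} (hy : y ∈ V) (f : Γ(Plane k, V)) :
    ∃ W : (Plane k).Opens, y ∈ W ∧ ∃ n, ∃ a ∈ grading k n, ∃ s ∈ grading k n,
      s ∉ y.asHomogeneousIdeal ∧ ∀ z (_ : z ∈ W), ∃ hz : z ∈ V,
      ∃ c : HomogeneousLocalization.NumDenSameDeg (grading k) z.asHomogeneousIdeal.toIdeal.primeCompl,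
        (c.num : MvPolynomial (Fin 3) k) = a ∧ (c.den : MvPolynomial (Fin 3) k) = s ∧
        f.1 ⟨z, hz⟩ = HomogeneousLocalization.mk c := by
  obtain ⟨W, hyW, i, n, a, s, h, e⟩ := f.2 ⟨y, hy⟩
  refine ⟨W, hyW, n, a, a.2, s, s.2, h ⟨y, hyW⟩, fun z hz ↦ ⟨i.le hz, ⟨n, a, s, h ⟨z, hz⟩⟩, rfl, rfl,
    e ⟨z, hz⟩⟩⟩

variable {X : Scheme.{u}} [IsIntegral X] {b : X ⟶ Plane k}
  (hη : b (genericPoint X) = Plane.genericPt k)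

include hη in
lemma mem_apply_genericPoint {f : MvPolynomial (Fin 3) k} :
    f ∈ (b (genericPoint X)).asHomogeneousIdeal ↔ f = 0 := by
  rw [hη, mem_genericPt]

/-- The rational function `f / X₀ ^ n` on `X`, for a form `f` of degree `n`, as a ring homomorphism
on all polynomials. -/
def formValue : MvPolynomial (Fin 3) k →+* X.functionField :=
  (pullbackFunction b).comp (dehom (b (genericPoint X))
    fun h ↦ X_ne_zero _ ((mem_apply_genericPoint hη).mp h))

lemma formValue_ne_zero {n : ℕ} {s : MvPolynomial (Fin 3) k} (hs : s ∈ grading k n)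
    (h0 : s ≠ 0) : formValue hη s ≠ 0 :=
  ((isUnit_dehom (b (genericPoint X)) _ hs
    (fun h ↦ h0 ((mem_apply_genericPoint hη).mp h))).map (pullbackFunction b)).ne_zero

lemma pullbackFunction_mk (c : HomogeneousLocalization.NumDenSameDeg (grading k)
    (b (genericPoint X)).asHomogeneousIdeal.toIdeal.primeCompl) :
    pullbackFunction b (HomogeneousLocalization.mk c) =
      formValue hη c.num / formValue hη c.den := by
  rw [eq_div_iff]
  · rw [formValue, RingHom.comp_apply, RingHom.comp_apply, ← map_mul, mk_mul_dehom]
  · exact formValue_ne_zero hη c.den.2 fun h ↦ c.den_mem ((mem_apply_genericPoint hη).mpr h)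

/-- The quotient is the pull-back of the section a / s of the structure sheaf over the set s ≠ 0. -/
lemma div_mem_localSubring {n : ℕ} {a s : MvPolynomial (Fin 3) k} (ha : a ∈ grading k n)
    (hs : s ∈ grading k n) {x : X} (hx : s ∉ (b x).asHomogeneousIdeal) :
    formValue hη a / formValue hη s ∈ localSubring x := by
  have h := toFunctionField_app b (V := Proj.basicOpen (grading k) s) hx (fractionSection ha hs)
  refine (?_ : _ = formValue hη a / formValue hη s) ▸ toFunctionField_mem_localSubring
    (U := b ⁻¹ᵁ Proj.basicOpen (grading k) s) hx (b.app _ (fractionSection ha hs))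
  rw [h]
  exact pullbackFunction_mk hη _

lemma formRatio_eq {h f : MvPolynomial (Fin 3) k} (hh : h ∈ LinearForms k) (h0 : h ≠ 0)
    (hf : f ∈ LinearForms k) : formRatio b hh hf = formValue hη f / formValue hη h := by
  have hmem : b (genericPoint X) ∈ Proj.basicOpen (grading k) h :=
    fun H ↦ h0 ((mem_apply_genericPoint hη).mp H)
  have hne : Nonempty (b ⁻¹ᵁ Proj.basicOpen (grading k) h) := ⟨⟨genericPoint X, hmem⟩⟩
  rw [formRatio, dif_pos hne]
  refine (Scheme.algebraMap_germ_eq_germToFunctionField X (x := genericPoint X) hmem _).symm.trans ?_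
  rw [awayToSection_mk hh hf]
  exact (toFunctionField_app b hmem _).trans (pullbackFunction_mk hη _)

include hη in
/-- The pull-back to `X` of a function on the plane is a quotient of forms, whose numerator cuts
out its zeros. -/
lemma exists_toFunctionField_app_eq {V : (Plane k).Opens} {x : X} (hx : b x ∈ V)
    (f : Γ(Plane k, V)) :
    ∃ n, ∃ a ∈ grading k n, ∃ s ∈ grading k n, s ∉ (b x).asHomogeneousIdeal ∧
      toFunctionField (U := b ⁻¹ᵁ V) ⟨x, hx⟩ (b.app V f) = formValue hη a / formValue hη s ∧
      ∃ W : (Plane k).Opens, b x ∈ W ∧ ∀ z ∈ W, z ∈ V ∧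
        (z ∈ (Plane k).basicOpen f ↔ a ∉ z.asHomogeneousIdeal) := by
  obtain ⟨W, hxW, n, a, ha, s, hs, hsx, H⟩ := exists_isFraction hx f
  refine ⟨n, a, ha, s, hs, hsx, ?_, W, hxW, fun z hz ↦ ?_⟩
  · obtain ⟨hz, c, rfl, rfl, e⟩ := H _ (apply_genericPoint_mem b hxW)
    rw [toFunctionField_app]
    exact (congrArg (pullbackFunction b) e).trans (pullbackFunction_mk hη c)
  · obtain ⟨hz, c, rfl, rfl, e⟩ := H _ hz
    refine ⟨hz, ?_⟩
    rw [mem_basicOpen_iff_isUnit hz, e]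
    exact isUnit_mk_iff c

lemma mem_vanishingIdeal {Y : Scheme.{u}} {Z : Closeds Y} {V : Y.affineOpens} {f : Γ(Y, V.1)} :
    f ∈ (Scheme.IdealSheafData.vanishingIdeal Z).ideal V ↔
      ∀ z ∈ Z, z ∈ V.1 → z ∉ Y.basicOpen f := by
  rw [Scheme.IdealSheafData.vanishingIdeal_ideal, PrimeSpectrum.mem_vanishingIdeal]
  constructor
  · intro h z hz hzV
    rw [← SetLike.mem_coe, ← V.2.range_fromSpec] at hzV
    obtain ⟨z, rfl⟩ := hzV
    have h1 := h z hz
    intro h2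
    have h3 : z ∈ V.2.fromSpec ⁻¹ᵁ Y.basicOpen f := h2
    rw [V.2.fromSpec_preimage_basicOpen] at h3
    exact h3 h1
  · intro h z hz
    by_contra h1
    have h3 : z ∈ V.2.fromSpec ⁻¹ᵁ Y.basicOpen f := by
      rw [V.2.fromSpec_preimage_basicOpen]
      exact h1
    refine h _ hz ?_ h3
    rw [← SetLike.mem_coe, ← V.2.range_fromSpec]
    exact ⟨z, rfl⟩

/-- Where b induces an isomorphism of local rings, regular functions come from the plane, and there
they are locally fractions of forms. -/
lemma exists_eq_div_of_isIso {x : X} [IsIso (b.stalkMap x)] {g : X.functionField}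
    (hg : g ∈ localSubring x) : ∃ n, ∃ a ∈ grading k n, ∃ s ∈ grading k n,
      s ∉ (b x).asHomogeneousIdeal ∧ g = formValue hη a / formValue hη s := by
  obtain ⟨r, rfl⟩ := mem_localSubring_iff.mp hg
  obtain ⟨r, rfl⟩ := (ConcreteCategory.bijective_of_isIso (b.stalkMap x)).2 r
  obtain ⟨V, hxV, f, rfl⟩ := (Plane k).presheaf.exists_germ_eq r
  obtain ⟨n, a, ha, s, hs, hsx, e, -⟩ := exists_toFunctionField_app_eq hη hxV f
  refine ⟨n, a, ha, s, hs, hsx, e ▸ ?_⟩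
  exact congrArg (stalkToFunctionField x) (Scheme.Hom.germ_stalkMap_apply b V x hxV f)

/-- Passing to global sections turns a description of a morphism to an affine scheme on `D` into one
of its ring map. It serves to follow constants from the base field to sections over basic opens. -/
lemma appTop_res_of_eq_toSpecΓ {Y : Scheme.{u}} (D : Y.Opens) {R : CommRingCat.{u}}
    (φ : R ⟶ Γ(Y, D)) (f : Y ⟶ Spec R) (h : D.ι ≫ f = D.toSpecΓ ≫ Spec.map φ) :
    (Scheme.ΓSpecIso R).inv ≫ f.appTop ≫ Y.presheaf.map (homOfLE (le_top : D ≤ ⊤)).op = φ := by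
  have h2 : (D.ι ≫ f).appTop = (D.toSpecΓ ≫ Spec.map φ).appTop := by rw [h]
  rw [Scheme.Hom.comp_appTop, Scheme.Hom.comp_appTop, Scheme.Opens.toSpecΓ_appTop] at h2
  have h3 : Y.presheaf.map (homOfLE (le_top : D ≤ ⊤)).op = D.ι.appTop ≫ D.topIso.hom := by
    rw [Scheme.Opens.ι_appTop, Scheme.Opens.topIso_hom]
    exact Y.presheaf.map_comp _ _
  rw [h3, reassoc_of% h2, ← Scheme.ΓSpecIso_inv_naturality_assoc,
    Iso.inv_hom_id_assoc, Iso.inv_hom_id, Category.comp_id]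

lemma basicOpen_ι_toSpecZero (s : MvPolynomial (Fin 3) k) :
    (Proj.basicOpen (grading k) s).ι ≫ Proj.toSpecZero (grading k) =
      (Proj.basicOpen (grading k) s).toSpecΓ ≫ Spec.map (CommRingCat.ofHom
        (HomogeneousLocalization.fromZeroRingHom (grading k) (Submonoid.powers s)) ≫
          Proj.awayToSection (grading k) s) := by
  rw [Proj.toSpecZero, Proj.basicOpenToSpec]
  have (U) (e : U = ⊤) : (Proj.basicOpen (grading k) s).ι ≫ (Scheme.topIso _).inv ≫
      (Scheme.isoOfEq _ e).inv = Scheme.homOfLE _ (le_top.trans_eq e.symm) := by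
    simp only [← Category.assoc, Iso.comp_inv_eq]
    simp only [Scheme.topIso_hom, Category.assoc, Scheme.isoOfEq_hom_ι, Scheme.homOfLE_ι]
  rw [reassoc_of% this, Category.assoc, ← Scheme.Opens.toSpecΓ_SpecMap_presheaf_map_assoc,
    ← Spec.map_comp, ← Spec.map_comp]
  rfl

lemma toBase_appTop_res (s : MvPolynomial (Fin 3) k) :
    (Scheme.ΓSpecIso (.of k)).inv ≫ (Plane.toBase k).appTop ≫
      (Plane k).presheaf.map (homOfLE (le_top : Proj.basicOpen (grading k) s ≤ ⊤)).op =
      CommRingCat.ofHom (algebraMap k (grading k 0)) ≫ CommRingCat.ofHom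
        (HomogeneousLocalization.fromZeroRingHom (grading k) (Submonoid.powers s)) ≫
          Proj.awayToSection (grading k) s := by
  refine appTop_res_of_eq_toSpecΓ (Proj.basicOpen (grading k) s) _ (Plane.toBase k) ?_
  rw [Spec.map_comp]
  exact ((Category.assoc _ _ _).symm.trans (congrArg (· ≫ _) (basicOpen_ι_toSpecZero s))).trans
    (Category.assoc _ _ _)

/-- Compute the constant over the basic open X₀ ≠ 0, where it is c as a fraction of degree zero.
This links the scalars of the path algebra with multiplication by sections. -/
lemma toFunctionField_constSection {U : X.Opens} {x : X} (hx : x ∈ U) (c : k) :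
    toFunctionField ⟨x, hx⟩ (constSection b U c) = formValue hη (MvPolynomial.C c) := by
  have h1 : constSection b U c = X.presheaf.map (homOfLE (le_top : U ≤ ⊤)).op
    (b.appTop ((Plane.toBase k).appTop ((Scheme.ΓSpecIso (.of k)).inv c))) := rfl
  rw [h1]
  refine (toFunctionField_homOfLE le_top hx _).trans ?_
  refine (toFunctionField_app b (V := ⊤) trivial _).trans ?_
  have h0 : b (genericPoint X) ∈ Proj.basicOpen (grading k) (MvPolynomial.X 0) :=
    fun H ↦ MvPolynomial.X_ne_zero _ ((mem_apply_genericPoint hη).mp H)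
  have h2 := toBase_appTop_res (k := k) (MvPolynomial.X 0)
  have h3 := congrArg (fun f ↦ (f.hom c)) h2
  have h4 := congrArg (fun f : Γ(Plane k, Proj.basicOpen (grading k) (MvPolynomial.X 0)) ↦ f.1 ⟨_, h0⟩) h3
  have h5 : pullbackFunction b _ = _ := congrArg (pullbackFunction b) h4
  refine Eq.trans ?_ (h5.trans ?_)
  · rfl
  · refine congrArg (pullbackFunction b) ?_
    rw [dehom, MvPolynomial.coe_eval₂Hom, MvPolynomial.eval₂_C]
    rfl

end

end BlowupPlane

namespace BlowupPlane

/-! ### Local generators and poles -/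

noncomputable section

open MvPolynomial

attribute [local instance] functionFieldCommRing

section Generator

variable {X : Scheme.{u}} [IsIntegral X]

/-- Here u generates the ideal of D at x, so the stalk of O(D) is u⁻¹ times the local ring. -/
lemma mem_divisorStalk_iff_of_generator {J : X.IdealSheafData} {x : X} {u g : X.functionField}
    (U : X.affineOpens) (hx : x ∈ U.1) (h₁ : ∃ f ∈ J.ideal U, toFunctionField ⟨x, hx⟩ f = u)
    (h₂ : ∀ f ∈ J.ideal U, ∃ r ∈ localSubring x, toFunctionField ⟨x, hx⟩ f = u * r) :
    g ∈ divisorStalk J x ↔ g * u ∈ localSubring x := by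
  rw [mem_divisorStalk_iff_of_mem U hx]
  constructor
  · obtain ⟨f, hf, rfl⟩ := h₁
    exact fun h ↦ h f hf
  · intro h f hf
    obtain ⟨r, hr, e⟩ := h₂ f hf
    rw [e, ← mul_assoc]
    exact (localSubring x).mul_mem h hr

lemma mem_divisorStalk_sq_iff_of_generator {J : X.IdealSheafData} {x : X} {u g : X.functionField}
    (U : X.affineOpens) (hx : x ∈ U.1) (h₁ : ∃ f ∈ J.ideal U, toFunctionField ⟨x, hx⟩ f = u)
    (h₂ : ∀ f ∈ J.ideal U, ∃ r ∈ localSubring x, toFunctionField ⟨x, hx⟩ f = u * r) :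
    g ∈ divisorStalk (J ^ 2) x ↔ g * u ^ 2 ∈ localSubring x := by
  have e : (J ^ 2).ideal U = J.ideal U * J.ideal U := by
    rw [Scheme.IdealSheafData.ideal_pow, Pi.pow_apply, pow_two]
  refine mem_divisorStalk_iff_of_generator U hx ?_ ?_
  · obtain ⟨f, hf, rfl⟩ := h₁
    exact ⟨f * f, e ▸ Ideal.mul_mem_mul hf hf, by rw [map_mul, pow_two]⟩
  · rw [e]
    intro f hf
    refine Submodule.mul_induction_on hf (fun a ha b hb ↦ ?_) fun a b ⟨r, hr, hr'⟩ ⟨s, hs, hs'⟩ ↦ ?_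
    · obtain ⟨r, hr, hr'⟩ := h₂ a ha
      obtain ⟨s, hs, hs'⟩ := h₂ b hb
      exact ⟨r * s, (localSubring x).mul_mem hr hs, by rw [map_mul, hr', hs']; ring⟩
    · exact ⟨r + s, (localSubring x).add_mem hr hs, by rw [map_add, hr', hs']; ring⟩

lemma exists_generator_comap {Y : Scheme.{u}} (b : X ⟶ Y) (I : Y.IdealSheafData) {x : X}
    {u : X.functionField} (V : Y.affineOpens) (hx : b x ∈ V.1)
    (h₁ : ∃ s ∈ I.ideal V, toFunctionField (U := b ⁻¹ᵁ V.1) ⟨x, hx⟩ (b.app V.1 s) = u)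
    (h₂ : ∀ s ∈ I.ideal V, ∃ r ∈ localSubring x,
      toFunctionField (U := b ⁻¹ᵁ V.1) ⟨x, hx⟩ (b.app V.1 s) = u * r) :
    ∃ (U : X.affineOpens) (hxU : x ∈ U.1),
      (∃ f ∈ (I.comap b).ideal U, toFunctionField ⟨x, hxU⟩ f = u) ∧
      ∀ f ∈ (I.comap b).ideal U, ∃ r ∈ localSubring x, toFunctionField ⟨x, hxU⟩ f = u * r := by
  obtain ⟨_, ⟨U, hU, rfl⟩, hxU, hUV⟩ :=
    X.isBasis_affineOpens.exists_subset_of_mem_open (show x ∈ (b ⁻¹ᵁ V.1 : X.Opens) from hx)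
      (b ⁻¹ᵁ V.1).isOpen
  have e : U ≤ b ⁻¹ᵁ V.1 := hUV
  have e' : ∀ s, toFunctionField (⟨x, hxU⟩ : U) ((b.appLE V.1 U e).hom s) =
      toFunctionField (U := b ⁻¹ᵁ V.1) ⟨x, hx⟩ (b.app V.1 s) :=
    fun s ↦ toFunctionField_homOfLE e hxU (b.app V.1 s)
  refine ⟨⟨U, hU⟩, hxU, ?_, ?_⟩
  · obtain ⟨s, hs, rfl⟩ := h₁
    refine ⟨(b.appLE V.1 U e).hom s, ?_, e' s⟩
    rw [ideal_comap b I V ⟨U, hU⟩ e]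
    exact Ideal.mem_map_of_mem _ hs
  · rw [ideal_comap b I V ⟨U, hU⟩ e]
    intro f hf
    induction hf using Submodule.span_induction with
    | mem f hf =>
      obtain ⟨s, hs, rfl⟩ := hf
      obtain ⟨r, hr, h⟩ := h₂ s hs
      exact ⟨r, hr, (e' s).trans h⟩
    | zero => exact ⟨0, zero_mem _, by rw [map_zero, mul_zero]⟩
    | add f g _ _ hf hg =>
      obtain ⟨r, hr, h⟩ := hf
      obtain ⟨s, hs, h'⟩ := hg
      exact ⟨r + s, (localSubring x).add_mem hr hs, by rw [map_add, h, h', mul_add]⟩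
    | smul a f _ hf =>
      obtain ⟨r, hr, h⟩ := hf
      exact ⟨toFunctionField ⟨x, hxU⟩ a * r,
        (localSubring x).mul_mem (toFunctionField_mem_localSubring hxU a) hr,
        by rw [smul_eq_mul, map_mul, h, mul_left_comm]⟩

lemma toFunctionField_injective {U : X.Opens} {x : X} (hx : x ∈ U) :
    Function.Injective (toFunctionField (⟨x, hx⟩ : U)) := by
  have : Nonempty U := ⟨⟨x, hx⟩⟩
  intro f g h
  apply Scheme.germToFunctionField_injective X U
  exact (Scheme.algebraMap_germ_eq_germToFunctionField X hx f).symm.trans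
    (h.trans (Scheme.algebraMap_germ_eq_germToFunctionField X hx g))

lemma stalkToFunctionField_injective (x : X) : Function.Injective (stalkToFunctionField x) :=
  FaithfulSMul.algebraMap_injective (X.presheaf.stalk x) X.functionField

lemma mem_basicOpen_of_inv_mem {U : X.Opens} {x : X} (hx : x ∈ U) {f : Γ(X, U)} (hf : f ≠ 0)
    (h : (toFunctionField ⟨x, hx⟩ f)⁻¹ ∈ localSubring x) : x ∈ X.basicOpen f := by
  obtain ⟨r, hr⟩ := mem_localSubring_iff.mp h
  refine (X.mem_basicOpen f x hx).mpr (.of_mul_eq_one r ?_)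
  apply stalkToFunctionField_injective x
  rw [map_mul, hr, map_one, ← toFunctionField_apply]
  refine mul_inv_cancel₀ fun h0 ↦ hf (toFunctionField_injective hx ?_)
  rw [h0, map_zero]

end Generator

variable {k : Type u} [Field k] {X : Scheme.{u}} [IsIntegral X] {b : X ⟶ Plane k}
  (hη : b (genericPoint X) = Plane.genericPt k)

include hη in
-- The ideal of the line consists of the functions that vanish on it as a set. That h / l generates
-- it therefore rests on primality of h: a form vanishing at the generic point of the line is
-- divisible by h.
lemma exists_generator_lineIdeal {h l : MvPolynomial (Fin 3) k} (hh : h ∈ LinearForms k)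
    (h0 : h ≠ 0) (hl : l ∈ LinearForms k) {x : X} (hx : l ∉ (b x).asHomogeneousIdeal) :
    ∃ (U : X.affineOpens) (hxU : x ∈ U.1),
      (∃ f ∈ ((lineIdeal h).comap b).ideal U,
        toFunctionField ⟨x, hxU⟩ f = formValue hη h / formValue hη l) ∧
      ∀ f ∈ ((lineIdeal h).comap b).ideal U, ∃ r ∈ localSubring x,
        toFunctionField ⟨x, hxU⟩ f = formValue hη h / formValue hη l * r := by
  have hl0 : formValue hη l ≠ 0 := formValue_ne_zero hη hl fun H ↦ hx (H ▸ zero_mem _)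
  have hh0 : formValue hη h ≠ 0 := formValue_ne_zero hη hh h0
  refine exists_generator_comap b (lineIdeal h)
    ⟨Proj.basicOpen (grading k) l, Proj.isAffineOpen_basicOpen (grading k) l hl one_pos⟩ hx
    ⟨fractionSection hh hl, ?_, ?_⟩ fun s hs ↦ ?_
  · refine mem_vanishingIdeal.mpr fun z hz hzl ↦ ?_
    rw [mem_basicOpen_iff_isUnit hzl]
    intro hu
    exact hz ((isUnit_mk_iff _).mp hu)
  · exact (toFunctionField_app b (V := Proj.basicOpen (grading k) l) hx _).trans
      (pullbackFunction_mk hη _)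
  · obtain ⟨n, a, ha, s', hs', hsx, e, W, hxW, H⟩ := exists_toFunctionField_app_eq hη hx s
    have hs0 : formValue hη s' ≠ 0 := formValue_ne_zero hη hs' fun H ↦ hsx (H ▸ zero_mem _)
    by_cases hhx : h ∈ (b x).asHomogeneousIdeal
    · have hirr := irreducible_of_linear hh h0
      have hP : (Ideal.span {h}).IsPrime :=
        (Ideal.span_singleton_prime h0).mpr hirr.prime
      have hX : ∃ i, MvPolynomial.X i ∉ Ideal.span {h} := by
        simp_rw [Ideal.mem_span_singleton]
        exact exists_X_not_dvd hirr
      -- The generic point of the line specializes to the point b x of the line, hence lies in the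
      -- neighbourhood where the section is a fraction with numerator `a`. Vanishing there means
      -- that h divides `a`.
      have hξ : corePoint _ hP hX ⤳ b x := specializes_of_le fun f hf ↦ by
        refine homogeneousIdeal_le_of_forall (I := (corePoint _ hP hX).asHomogeneousIdeal)
          (fun n f hf hfI ↦ ?_) hf
        rw [mem_corePoint hf, Ideal.mem_span_singleton] at hfI
        exact Ideal.mem_of_dvd _ hfI hhx
      have hξW := hξ.mem_open W.isOpen hxW
      obtain ⟨hξV, hξ'⟩ := H _ hξW
      have hha : h ∣ a := by
        rw [← Ideal.mem_span_singleton, ← mem_corePoint (hP := hP) (hX := hX) ha]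
        by_contra hc
        refine mem_vanishingIdeal.mp hs _ ?_ hξV (hξ'.mpr hc)
        intro hc'
        exact hc' ((mem_corePoint hh).mpr (Ideal.mem_span_singleton_self h))
      obtain ⟨a', rfl⟩ := hha
      rcases exists_homogeneous_quotient ha hh h0 rfl with ⟨hn, ha'⟩ | ⟨-, rfl⟩
      · refine ⟨formValue hη (a' * l) / formValue hη s', ?_, ?_⟩
        · refine div_mem_localSubring hη (n := n) ?_ hs' hsx
          have := MvPolynomial.IsHomogeneous.mul ha' hl
          rwa [Nat.sub_add_cancel hn] at this
        · rw [e, map_mul, map_mul]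
          field_simp
      · exact ⟨0, zero_mem _, by rw [e, mul_zero, map_zero, zero_div, mul_zero]⟩
    -- Off the line h / l is a unit, so it divides every section.
    · refine ⟨formValue hη (a * l) / formValue hη (s' * h), ?_, ?_⟩
      · refine div_mem_localSubring hη (MvPolynomial.IsHomogeneous.mul ha hl)
          (MvPolynomial.IsHomogeneous.mul hs' hh) fun hc ↦ ?_
        exact ((b x).isPrime.mem_or_mem hc).elim hsx hhx
      · rw [e, map_mul, map_mul]
        field_simp

lemma mem_divisorStalk_line {h l : MvPolynomial (Fin 3) k} (hh : h ∈ LinearForms k)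
    (h0 : h ≠ 0) (hl : l ∈ LinearForms k) {x : X} (hx : l ∉ (b x).asHomogeneousIdeal)
    {g : X.functionField} : g ∈ divisorStalk ((lineIdeal h).comap b) x ↔
      g * (formValue hη h / formValue hη l) ∈ localSubring x := by
  obtain ⟨U, hxU, h₁, h₂⟩ := exists_generator_lineIdeal hη hh h0 hl hx
  exact mem_divisorStalk_iff_of_generator U hxU h₁ h₂

lemma mem_divisorStalk_line_sq {h l : MvPolynomial (Fin 3) k} (hh : h ∈ LinearForms k)
    (h0 : h ≠ 0) (hl : l ∈ LinearForms k) {x : X} (hx : l ∉ (b x).asHomogeneousIdeal)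
    {g : X.functionField} : g ∈ divisorStalk ((lineIdeal h).comap b ^ 2) x ↔
      g * (formValue hη h / formValue hη l) ^ 2 ∈ localSubring x := by
  obtain ⟨U, hxU, h₁, h₂⟩ := exists_generator_lineIdeal hη hh h0 hl hx
  exact mem_divisorStalk_sq_iff_of_generator U hxU h₁ h₂

include hη in
-- Away from `y` some section of the ideal of `y` does not vanish at b x, and multiplying by its
-- regular inverse undoes the multiplication that defines the stalk.
lemma mem_divisorStalk_point_of_ne {y : Plane k} (hy : IsClosed {y}) {x : X} (hx : b x ≠ y)
    {g : X.functionField} :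
    g ∈ divisorStalk ((pointIdeal y hy).comap b) x ↔ g ∈ localSubring x := by
  refine ⟨fun h ↦ ?_, mem_divisorStalk_of_mem _ x⟩
  obtain ⟨_, ⟨V, hV, rfl⟩, hxV, -⟩ :=
    (Plane k).isBasis_affineOpens.exists_subset_of_mem_open (Set.mem_univ (b x)) isOpen_univ
  have h1 : b x ∉ (pointIdeal y hy).support := fun h ↦ hx ((mem_support_pointIdeal hy).mp h)
  rw [Scheme.IdealSheafData.mem_support_iff_of_mem (U := ⟨V, hV⟩) hxV] at h1
  simp only [Scheme.mem_zeroLocus_iff, not_forall, not_not] at h1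
  obtain ⟨s, hs, hxs⟩ := h1
  rw [mem_divisorStalk_comap_iff b _ ⟨V, hV⟩ hxV] at h
  have h2 := h s hs
  obtain ⟨n, a, ha, s', hs', hsx, e, W, hxW, H⟩ := exists_toFunctionField_app_eq hη hxV s
  have hax := (H _ hxW).2.mp hxs
  have ha0 : formValue hη a ≠ 0 := formValue_ne_zero hη ha fun H ↦ hax (H ▸ zero_mem _)
  have hs0 : formValue hη s' ≠ 0 := formValue_ne_zero hη hs' fun H ↦ hsx (H ▸ zero_mem _)
  have h3 := (localSubring x).mul_mem h2 (div_mem_localSubring hη hs' ha hax)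
  rw [e] at h3
  convert h3 using 1
  field_simp

lemma mul_div_mem_of_mem_formsThrough {y : Plane k} (hy : IsClosed {y})
    {f l : MvPolynomial (Fin 3) k} (hf : f ∈ formsThrough y) (hl : l ∈ LinearForms k)
    {x : X} (hx : l ∉ (b x).asHomogeneousIdeal) {g : X.functionField}
    (hg : g ∈ divisorStalk ((pointIdeal y hy).comap b) x) :
    g * (formValue hη f / formValue hη l) ∈ localSubring x := by
  rw [mem_divisorStalk_comap_iff b _ ⟨Proj.basicOpen (grading k) l,
    Proj.isAffineOpen_basicOpen (grading k) l hl one_pos⟩ hx] at hg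
  have := hg (fractionSection hf.1 hl) (mem_vanishingIdeal.mpr fun z hz hzl ↦ by
    rw [mem_basicOpen_iff_isUnit hzl]
    intro hu
    obtain rfl : z = y := hz
    exact (isUnit_mk_iff _).mp hu hf.2)
  have h2 := (toFunctionField_app b (V := Proj.basicOpen (grading k) l) hx
    (fractionSection hf.1 hl)).trans (pullbackFunction_mk hη _)
  exact h2 ▸ this

/-- Some rational function has a pole along the exceptional divisor over a given point. -/
lemma exists_mem_divisorStalk_notMem [IsAlgClosed k] {t : ℕ} {p : Fin t → Plane k}
    (hp : ∀ i, IsClosed {p i}) (hb : IsBlowup b (pointsIdeal p hp)) (i : Fin t) :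
    ∃ x, b x = p i ∧ ∃ g ∈ divisorStalk ((pointIdeal (p i) (hp i)).comap b) x,
      g ∉ localSubring x := by
  obtain ⟨x, hx⟩ := hb.surjective_of_points (p i)
  obtain ⟨U, hxU, a, ha, haU⟩ := hb.invertible x
  have ha0 : a ≠ 0 := by
    have : Nonempty U.1 := ⟨⟨x, hxU⟩⟩
    exact nonZeroDivisors.ne_zero ha
  -- The pole is the inverse of a local equation `a` of the exceptional divisor.
  refine ⟨x, hx, (toFunctionField ⟨x, hxU⟩ a)⁻¹, ?_, fun h ↦ ?_⟩
  -- Removing the other points makes the ideal of p i agree with the ideal of the whole centre near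
  -- p i.
  · let O : (Plane k).Opens := ⟨(p '' {j | p j ≠ p i})ᶜ, by
      rw [isOpen_compl_iff, ← Set.biUnion_of_singleton (p '' _), Set.biUnion_image]
      exact (Set.toFinite _).isClosed_biUnion fun j _ ↦ hp j⟩
    have hiO : b x ∈ O := by
      rw [hx]
      rintro ⟨j, hj, hj'⟩
      exact hj hj'
    obtain ⟨_, ⟨V, hV, rfl⟩, hxV, hVO⟩ :=
      (Plane k).isBasis_affineOpens.exists_subset_of_mem_open hiO O.isOpen
    rw [mem_divisorStalk_comap_iff b _ ⟨V, hV⟩ hxV]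
    have key : (toFunctionField ⟨x, hxU⟩ a)⁻¹ ∈ divisorStalk ((pointsIdeal p hp).comap b) x := by
      rw [mem_divisorStalk_iff_of_mem U hxU, haU]
      intro f hf
      obtain ⟨c, rfl⟩ := Ideal.mem_span_singleton'.mp hf
      rw [map_mul, mul_left_comm, inv_mul_cancel₀, mul_one]
      · exact toFunctionField_mem_localSubring hxU c
      · exact fun h0 ↦ ha0 (toFunctionField_injective hxU (h0.trans (map_zero _).symm))
    rw [mem_divisorStalk_comap_iff b _ ⟨V, hV⟩ hxV] at key
    intro s hs
    refine key s (mem_vanishingIdeal.mpr ?_)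
    rintro _ ⟨j, rfl⟩ hz
    have hj : p j = p i := by
      by_contra hj
      exact hVO hz ⟨j, hj, rfl⟩
    exact mem_vanishingIdeal.mp hs (p j) hj hz
  -- If the inverse were regular, `a` would be a unit at x, but it vanishes over the centre.
  · have h1 := mem_basicOpen_of_inv_mem hxU ha0 h
    have h2 : x ∈ ((pointsIdeal p hp).comap b).support := by
      rw [Scheme.IdealSheafData.support_comap]
      exact (mem_support_pointsIdeal hp).mpr ⟨i, hx.symm⟩
    rw [Scheme.IdealSheafData.mem_support_iff_of_mem hxU, Scheme.mem_zeroLocus_iff] at h2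
    exact h2 a (haU ▸ Ideal.mem_span_singleton_self a) h1

end

end BlowupPlane

namespace BlowupPlane

/-! ### Rational functions that multiply one sheaf into another -/

noncomputable section

open MvPolynomial

attribute [local instance] functionFieldCommRing

/-- The degree of the pull-back of a line on the sheaves of the exceptional sequence. -/
def Vertex.degree {t : ℕ} : Vertex t → ℕ
  | .zero => 0
  | .exc _ => 0
  | .line => 1
  | .conic => 2

lemma mul_eq_of_div_eq {K : Type*} [Field K] {a s h l a' s' : K} {m n : ℕ} (hs : s ≠ 0)
    (hs' : s' ≠ 0) (hh : h ≠ 0) (hl : l ≠ 0)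
    (e : a / s * ((h / l) ^ m)⁻¹ * (h / l) ^ n = a' / s') :
    a * h ^ n * (l ^ m * s') = s * h ^ m * (l ^ n * a') := by
  have e' : a = a' / s' * s * (h / l) ^ m * ((h / l) ^ n)⁻¹ := by
    rw [← e]
    field_simp
  rw [e', div_pow, div_pow, inv_div]
  field_simp

section Multiplier

variable {X : Scheme.{u}} [IsIntegral X]

/-- Multiplication by `r` maps `O_X(D)` to `O_X(D')`. -/
def IsMultiplier (J J' : X.IdealSheafData) (r : X.functionField) : Prop :=
  ∀ x, ∀ g ∈ divisorStalk J x, r * g ∈ divisorStalk J' x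

lemma mem_localSubring_genericPoint (r : X.functionField) : r ∈ localSubring (genericPoint X) := by
  obtain ⟨V, hV, f, rfl⟩ := X.presheaf.exists_germ_eq (x := genericPoint X) r
  have : Nonempty V := ⟨⟨_, hV⟩⟩
  have := toFunctionField_mem_localSubring hV f
  exact (Scheme.algebraMap_germ_eq_germToFunctionField X hV f) ▸ this

lemma isMultiplier_zero (J J' : X.IdealSheafData) : IsMultiplier J J' 0 :=
  fun x g _ ↦ by rw [zero_mul]; exact zero_mem _

lemma IsMultiplier.add {J J' : X.IdealSheafData} {r s : X.functionField} (hr : IsMultiplier J J' r)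
    (hs : IsMultiplier J J' s) : IsMultiplier J J' (r + s) :=
  fun x g hg ↦ by rw [add_mul]; exact add_mem (hr x g hg) (hs x g hg)

lemma IsMultiplier.mul {J J' J'' : X.IdealSheafData} {r s : X.functionField}
    (hr : IsMultiplier J' J'' r) (hs : IsMultiplier J J' s) : IsMultiplier J J'' (r * s) :=
  fun x g hg ↦ by rw [mul_assoc]; exact hr x _ (hs x g hg)

lemma isMultiplier_of_forall_mem (J : X.IdealSheafData) {r : X.functionField}
    (h : ∀ x, r ∈ localSubring x) : IsMultiplier J J r := fun x g hg ↦ by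
  obtain ⟨r, rfl⟩ := h x
  exact (divisorStalk J x).smul_mem r hg

end Multiplier

variable {k : Type u} [Field k] {X : Scheme.{u}} [IsIntegral X] {b : X ⟶ Plane k}

section
variable (hη : b (genericPoint X) = Plane.genericPt k)

/-- A common degree is essential: X₀ and 1 have the same value. This is why degrees are tracked
whenever an identity of values is turned into one of forms. -/
lemma formValue_injOn {n : ℕ} {f g : MvPolynomial (Fin 3) k} (hf : f ∈ grading k n)
    (hg : g ∈ grading k n) (h : formValue hη f = formValue hη g) : f = g := by
  by_contra hne
  refine formValue_ne_zero hη (sub_mem hf hg) (sub_ne_zero.mpr hne) ?_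
  rw [map_sub, h, sub_self]

lemma formValue_C_mem (c : k) (x : X) : formValue hη (C c) ∈ localSubring x := by
  have h := div_mem_localSubring hη (isHomogeneous_C (Fin 3) c) (isHomogeneous_one (Fin 3) k)
    (x := x) ((Ideal.ne_top_iff_one _).mp (b x).isPrime.ne_top)
  rwa [map_one, div_one] at h

end

section

variable {t : ℕ} {p : Fin t → Plane k} {hp : ∀ i, IsClosed {p i}}
  (hη : b (genericPoint X) = Plane.genericPt k)
  {h : MvPolynomial (Fin 3) k} (hh : h ∈ LinearForms k) (h0 : h ≠ 0)

include hh h0 in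
-- Away from its own exceptional divisor O(R_i) agrees with O, so every sheaf of the sequence is
-- locally generated by a power of l / h. Points over other p_j are allowed.
lemma mem_divisorStalk_of_forall_ne {x : X} (v : Vertex t) (hx : ∀ i, v = .exc i → b x ≠ p i)
    {l : MvPolynomial (Fin 3) k} (hl : l ∈ LinearForms k) (hlx : l ∉ (b x).asHomogeneousIdeal)
    {g : X.functionField} : g ∈ divisorStalk (divisorIdeal b p hp h v) x ↔
      g * (formValue hη h / formValue hη l) ^ v.degree ∈ localSubring x := by
  cases v with
  | zero =>
    rw [Vertex.degree, pow_zero, mul_one]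
    exact divisorStalk_top x
  | exc i =>
    rw [Vertex.degree, pow_zero, mul_one]
    exact mem_divisorStalk_point_of_ne hη (hp i) (hx i rfl)
  | line =>
    rw [Vertex.degree, pow_one]
    exact mem_divisorStalk_line hη hh h0 hl hlx
  | conic => exact mem_divisorStalk_line_sq hη hh h0 hl hlx

end

variable [IsAlgClosed k] {t : ℕ} {p : Fin t → Plane k} {hp : ∀ i, IsClosed {p i}}
  (hb : IsBlowup b (pointsIdeal p hp)) (hη : b (genericPoint X) = Plane.genericPt k)
  {h : MvPolynomial (Fin 3) k} (hh : h ∈ LinearForms k) (h0 : h ≠ 0)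

include hb hh h0

/-- A multiplier between two sheaves of the exceptional sequence is given by a form. -/
lemma exists_quotient_of_isMultiplier {v w : Vertex t} {r : X.functionField}
    (hr : IsMultiplier (divisorIdeal b p hp h v) (divisorIdeal b p hp h w) r) :
    ∃ f ∈ grading k (w.degree - v.degree), (w.degree < v.degree → f = 0) ∧
      r = formValue hη f * formValue hη h ^ v.degree / formValue hη h ^ w.degree := by
  have hh1 : formValue hη h ≠ 0 := formValue_ne_zero hη hh h0
  have hsupp : ∀ {x : X}, (∀ i, b x ≠ p i) → b x ∉ (pointsIdeal p hp).support := fun hx hc ↦ by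
    obtain ⟨i, hi⟩ := (mem_support_pointsIdeal hp).mp hc
    exact hx i hi.symm
  obtain ⟨n, a, ha, s, hs, hs0, rfl⟩ : ∃ n, ∃ a ∈ grading k n, ∃ s ∈ grading k n, s ≠ 0 ∧
      r = formValue hη a / formValue hη s := by
    have : IsIso (b.stalkMap (genericPoint X)) := hb.isIso_stalkMap (hsupp fun i ↦ by
      rw [hη]; exact genericPt_ne_of_isClosed (hp i))
    obtain ⟨n, a, ha, s, hs, hsx, e⟩ :=
      exists_eq_div_of_isIso hη (mem_localSubring_genericPoint r)
    exact ⟨n, a, ha, s, hs, fun H ↦ hsx (H ▸ zero_mem _), e⟩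
  have hs1 : formValue hη s ≠ 0 := formValue_ne_zero hη hs hs0
  have hN : a * h ^ w.degree ∈ grading k (n + w.degree) :=
    MvPolynomial.IsHomogeneous.mul ha (by simpa using MvPolynomial.IsHomogeneous.pow hh w.degree)
  have hD : s * h ^ v.degree ∈ grading k (n + v.degree) :=
    MvPolynomial.IsHomogeneous.mul hs (by simpa using MvPolynomial.IsHomogeneous.pow hh v.degree)
  have hD0 : s * h ^ v.degree ≠ 0 := mul_ne_zero hs0 (pow_ne_zero _ h0)
  -- Divisibility is tested at a point of X over the generic point of each curve q = 0. That point
  -- is outside the centre, so b is a local isomorphism there.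
  obtain ⟨f, hf⟩ : s * h ^ v.degree ∣ a * h ^ w.degree := by
    refine dvd_of_forall_irreducible hD0 fun q hq ↦ ?_
    obtain ⟨i, hi⟩ := exists_X_not_dvd hq
    have hP : (Ideal.span {q}).IsPrime := (Ideal.span_singleton_prime hq.ne_zero).mpr hq.prime
    have hX : ∃ i, MvPolynomial.X i ∉ Ideal.span {q} :=
      ⟨i, fun H ↦ hi (Ideal.mem_span_singleton.mp H)⟩
    obtain ⟨x, hx⟩ := hb.surjective_of_points (corePoint _ hP hX)
    have hxp : ∀ i, b x ≠ p i := fun i ↦ hx ▸ ne_corePoint_span (hp i) hq.not_isUnit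
    have hl : (MvPolynomial.X i : MvPolynomial (Fin 3) k) ∈ LinearForms k := isHomogeneous_X k i
    have hlx : MvPolynomial.X i ∉ (b x).asHomogeneousIdeal := by
      rw [hx, mem_corePoint hl, Ideal.mem_span_singleton]
      exact hi
    generalize (MvPolynomial.X i : MvPolynomial (Fin 3) k) = l at hl hlx hi
    have hl1 : formValue hη l ≠ 0 := formValue_ne_zero hη hl fun H ↦ hlx (H ▸ zero_mem _)
    have : IsIso (b.stalkMap x) := hb.isIso_stalkMap (hsupp hxp)
    -- The test germ is the local generator (l / h) ^ d(v) of the source. Its product with r must be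
    -- a regular multiple of (l / h) ^ d(w).
    have h1 := hr x ((formValue hη h / formValue hη l) ^ v.degree)⁻¹ (by
      rw [mem_divisorStalk_of_forall_ne hη hh h0 v (fun i _ ↦ hxp i) hl hlx, inv_mul_cancel₀]
      · exact one_mem _
      · exact pow_ne_zero _ (div_ne_zero hh1 hl1))
    rw [mem_divisorStalk_of_forall_ne hη hh h0 w (fun i _ ↦ hxp i) hl hlx] at h1
    obtain ⟨m, a', ha', s', hs', hsx', e⟩ := exists_eq_div_of_isIso hη h1
    have hs1' : formValue hη s' ≠ 0 := formValue_ne_zero hη hs' fun H ↦ hsx' (H ▸ zero_mem _)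
    have hqs : ¬ q ∣ s' := by
      rw [hx, mem_corePoint hs', Ideal.mem_span_singleton] at hsx'
      exact hsx'
    -- This factor clears the denominators of the local identity, and q divides neither l nor s'.
    refine ⟨l ^ v.degree * s', fun hc ↦ ?_, l ^ w.degree * a', ?_⟩
    · exact (hq.prime.dvd_or_dvd hc).elim (fun H ↦ hi (hq.prime.dvd_of_dvd_pow H)) hqs
    · have hlv : ∀ j, l ^ j ∈ grading k j := fun j ↦ by
        simpa using MvPolynomial.IsHomogeneous.pow hl j
      refine formValue_injOn hη (n := n + w.degree + (v.degree + m))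
        (MvPolynomial.IsHomogeneous.mul hN (MvPolynomial.IsHomogeneous.mul (hlv _) hs')) ?_ ?_
      · have := MvPolynomial.IsHomogeneous.mul hD (MvPolynomial.IsHomogeneous.mul (hlv w.degree) ha')
        have e : n + v.degree + (w.degree + m) = n + w.degree + (v.degree + m) := by omega
        rwa [e] at this
      · simp only [map_mul, map_pow]
        refine mul_eq_of_div_eq hs1 hs1' hh1 hl1 e
  have hr' : formValue hη a / formValue hη s =
      formValue hη f * formValue hη h ^ v.degree / formValue hη h ^ w.degree := by
    have := congrArg (formValue hη) hf
    simp only [map_mul, map_pow] at this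
    rw [div_eq_div_iff hs1 (pow_ne_zero _ hh1), this]
    ring
  rcases exists_homogeneous_quotient hN hD hD0 hf with ⟨hle, hf'⟩ | ⟨hlt, hf'⟩
  · refine ⟨f, ?_, fun hlt ↦ absurd hlt (by omega), hr'⟩
    rwa [Nat.add_sub_add_left] at hf'
  · exact ⟨f, hf' ▸ zero_mem _, fun _ ↦ hf', hr'⟩

/-- If f did not vanish at p_i, then f / l ^ d(w) would be a unit over p_i. Multiplication would
then carry a germ of O(R_i) with a pole there to a germ of the target with a pole relative to its
generator. -/
lemma mem_of_isMultiplier_exc (hinj : Function.Injective p) {i : Fin t} {w : Vertex t} (hw : w ≠ .exc i)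
    {f : MvPolynomial (Fin 3) k} (hf : f ∈ grading k w.degree)
    (hr : IsMultiplier (divisorIdeal b p hp h (.exc i)) (divisorIdeal b p hp h w)
      (formValue hη f / formValue hη h ^ w.degree)) : f ∈ (p i).asHomogeneousIdeal := by
  by_contra hfi
  obtain ⟨x, hx, g, hg, hgx⟩ := exists_mem_divisorStalk_notMem hp hb i
  obtain ⟨j, hj⟩ := exists_X_notMem (p i)
  have hl : (MvPolynomial.X j : MvPolynomial (Fin 3) k) ∈ LinearForms k := isHomogeneous_X k j
  generalize (MvPolynomial.X j : MvPolynomial (Fin 3) k) = l at hl hj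
  rw [← hx] at hj hfi
  have hh1 : formValue hη h ≠ 0 := formValue_ne_zero hη hh h0
  have hl1 : formValue hη l ≠ 0 := formValue_ne_zero hη hl fun H ↦ hj (H ▸ zero_mem _)
  have hf1 : formValue hη f ≠ 0 := formValue_ne_zero hη hf fun H ↦ hfi (H ▸ zero_mem _)
  have h1 := hr x g hg
  rw [mem_divisorStalk_of_forall_ne hη hh h0 w (fun j hwj hxj ↦ ?_) hl hj] at h1
  · have hlw : l ^ w.degree ∈ grading k w.degree := by
      simpa using MvPolynomial.IsHomogeneous.pow hl w.degree
    refine hgx ?_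
    convert (localSubring x).mul_mem h1 (div_mem_localSubring hη hlw hf hfi) using 1
    rw [map_pow, div_pow]
    field_simp
  · exact hw (hwj.trans (congrArg _ (hinj (hx.symm.trans hxj)).symm))

/-- The homomorphisms between two sheaves of the exceptional sequence are given by forms. -/
lemma exists_form_of_isMultiplier (hinj : Function.Injective p) {v w : Vertex t}
    {r : X.functionField}
    (hr : IsMultiplier (divisorIdeal b p hp h v) (divisorIdeal b p hp h w) r) :
    ∃ f ∈ grading k (w.degree - v.degree), (w.degree < v.degree → f = 0) ∧
      (∀ i, v = .exc i → w ≠ .exc i → f ∈ (p i).asHomogeneousIdeal) ∧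
      r = formValue hη f * formValue hη h ^ v.degree / formValue hη h ^ w.degree := by
  obtain ⟨f, hf, hlt, rfl⟩ := exists_quotient_of_isMultiplier hb hη hh h0 hr
  refine ⟨f, hf, hlt, ?_, rfl⟩
  rintro i rfl hw
  refine mem_of_isMultiplier_exc hb hη hh h0 hinj hw hf ?_
  simpa only [Vertex.degree, pow_zero, mul_one] using hr

omit hb [IsAlgClosed k]

lemma isMultiplier_exc_line {i : Fin t} {f : MvPolynomial (Fin 3) k} (hf : f ∈ formsThrough (p i)) :
    IsMultiplier (divisorIdeal b p hp h (.exc i)) (divisorIdeal b p hp h .line)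
      (formValue hη f / formValue hη h) := fun x g hg ↦ by
  obtain ⟨j, hj⟩ := exists_X_notMem (b x)
  have hl : (MvPolynomial.X j : MvPolynomial (Fin 3) k) ∈ LinearForms k := isHomogeneous_X k j
  have hh1 : formValue hη h ≠ 0 := formValue_ne_zero hη hh h0
  refine (mem_divisorStalk_line hη hh h0 hl hj).mpr ?_
  convert mul_div_mem_of_mem_formsThrough hη (hp i) hf hl hj hg using 1
  field_simp

lemma isMultiplier_line_conic {f : MvPolynomial (Fin 3) k} (hf : f ∈ LinearForms k) :
    IsMultiplier (divisorIdeal b p hp h .line) (divisorIdeal b p hp h .conic)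
      (formValue hη f / formValue hη h) := fun x g hg ↦ by
  obtain ⟨j, hj⟩ := exists_X_notMem (b x)
  have hl : (MvPolynomial.X j : MvPolynomial (Fin 3) k) ∈ LinearForms k := isHomogeneous_X k j
  have hh1 : formValue hη h ≠ 0 := formValue_ne_zero hη hh h0
  refine (mem_divisorStalk_line_sq hη hh h0 hl hj).mpr ?_
  convert (localSubring x).mul_mem ((mem_divisorStalk_line hη hh h0 hl hj).mp hg)
    (div_mem_localSubring hη hf hl hj) using 1
  field_simp

include hη in
lemma isMultiplier_arrow (β : ∀ i, Module.Basis (Fin 2) k (formsThrough (p i)))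
    (γ : Module.Basis (Fin 3) k (LinearForms k)) {v w : Vertex t} (a : v ⟶ w) :
    IsMultiplier (divisorIdeal b p hp h v) (divisorIdeal b p hp h w)
      (arrowFunction b p hh β γ a) := by
  match v, w, a with
  | _, _, .a i =>
    intro x g hg
    rw [arrowFunction, one_mul]
    exact mem_divisorStalk_of_mem _ x ((divisorStalk_top x).mp hg)
  | _, _, .b i j =>
    rw [arrowFunction, formRatio_eq hη hh h0]
    exact isMultiplier_exc_line hη hh h0 (β i j).2
  | _, _, .c j =>
    rw [arrowFunction, formRatio_eq hη hh h0]
    exact isMultiplier_line_conic hη hh h0 (γ j).2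

end

end BlowupPlane

namespace BlowupPlane

/-! ### Morphisms of divisor sheaves as rational functions -/

noncomputable section

attribute [local instance] functionFieldCommRing

variable {X : Scheme.{u}} [IsIntegral X] {J J' J'' : X.IdealSheafData}

lemma sectionValue_injective {U : X.Opens} :
    Function.Injective (sectionValue : Γ(divisorSheaf J, U) → _) := fun _ _ h ↦ Subtype.ext h

lemma sectionValue_mem {U : X.Opens} (s : Γ(divisorSheaf J, U)) (x : U) :
    sectionValue s x ∈ divisorStalk J x.1 := s.2.2 x

lemma sectionValue_smul {U : X.Opens} (a : Γ(X, U)) (s : Γ(divisorSheaf J, U)) (x : U) :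
    sectionValue (a • s) x = toFunctionField x a * sectionValue s x := rfl

lemma sectionValue_map {U V : X.Opens} (i : V ⟶ U) (s : Γ(divisorSheaf J, U)) (x : V) :
    sectionValue ((divisorSheaf J).presheaf.map i.op s) x = sectionValue s (i x) := rfl

/-- A locally constant function on an open subset of an irreducible space takes everywhere its value
at the generic point. -/
lemma sectionValue_eq {U : X.Opens} (s : Γ(divisorSheaf J, U)) (x y : U) :
    sectionValue s x = sectionValue s y := by
  have key : ∀ x : U, ∃ hη : genericPoint X ∈ U, sectionValue s x = sectionValue s ⟨_, hη⟩ := by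
    intro x
    obtain ⟨V, hxV, h⟩ := s.2.1 x
    have hη : ∀ W : X.Opens, x.1 ∈ W → genericPoint X ∈ W := fun W hW ↦
      ((genericPoint_spec X).specializes (Set.mem_univ x.1)).mem_open W.isOpen hW
    exact ⟨hη U x.2, (h ⟨_, hη U x.2⟩ (hη V hxV)).symm⟩
  obtain ⟨_, hx⟩ := key x
  obtain ⟨_, hy⟩ := key y
  rw [hx, hy]

/-- A rational function as a section of `O_X(D)`. -/
def constantSection (J : X.IdealSheafData) (U : X.Opens) (g : X.functionField)
    (hg : ∀ x ∈ U, g ∈ divisorStalk J x) : Γ(divisorSheaf J, U) :=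
  (⟨fun _ ↦ g, fun _ ↦ ⟨⊤, trivial, fun _ _ ↦ rfl⟩, fun x ↦ hg x.1 x.2⟩ : divisorSections J U)

/-- The canonical section `1` of `O_X(D)`. -/
def oneSection (J : X.IdealSheafData) (U : X.Opens) : Γ(divisorSheaf J, U) :=
  constantSection J U 1 fun x _ ↦ mem_divisorStalk_of_mem J x (one_mem _)

/-- The rational function by which a morphism `O_X(D) ⟶ O_X(D')` multiplies. -/
def homValue (φ : divisorSheaf J ⟶ divisorSheaf J') : X.functionField :=
  sectionValue (φ.app ⊤ (oneSection J ⊤)) ⟨genericPoint X, trivial⟩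

lemma app_map (φ : divisorSheaf J ⟶ divisorSheaf J') {U V : X.Opens} (i : V ⟶ U)
    (s : Γ(divisorSheaf J, U)) : φ.app V ((divisorSheaf J).presheaf.map i.op s) =
      (divisorSheaf J').presheaf.map i.op (φ.app U s) :=
  congr($(φ.mapPresheaf.naturality i.op) s)

/-- Near a point a section s is a fraction a / d of regular functions, so d s = a · 1 as sections.
Linearity gives d φ(s) = a φ(1), and φ is determined by its value on 1. -/
lemma isMultiplication_homValue (φ : divisorSheaf J ⟶ divisorSheaf J') :
    IsMultiplication φ (homValue φ) := by
  intro U s x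
  obtain ⟨a, d, hd, e⟩ := IsFractionRing.div_surjective (A := X.presheaf.stalk x.1) (sectionValue s x)
  obtain ⟨V, hxV, a, rfl⟩ := X.presheaf.exists_germ_eq a
  obtain ⟨W, hxW, d, rfl⟩ := X.presheaf.exists_germ_eq d
  have hd0 : toFunctionField ⟨x.1, hxW⟩ d ≠ 0 :=
    IsFractionRing.to_map_ne_zero_of_mem_nonZeroDivisors hd
  let O : X.Opens := U ⊓ V ⊓ W
  have hxO : x.1 ∈ O := ⟨⟨x.2, hxV⟩, hxW⟩
  let iU : O ⟶ U := homOfLE (inf_le_left.trans inf_le_left)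
  let iV : O ⟶ V := homOfLE (inf_le_left.trans inf_le_right)
  let iW : O ⟶ W := homOfLE inf_le_right
  have h1 : (X.presheaf.map iW.op d) • (divisorSheaf J).presheaf.map iU.op s =
      (X.presheaf.map iV.op a) • (divisorSheaf J).presheaf.map (homOfLE le_top : O ⟶ ⊤).op (oneSection J ⊤) := by
    apply sectionValue_injective
    funext y
    rw [sectionValue_smul, sectionValue_smul, sectionValue_map, toFunctionField_map,
      toFunctionField_map, sectionValue_eq s _ x, ← e, toFunctionField_eq _ ⟨x.1, hxW⟩,
      toFunctionField_eq _ ⟨x.1, hxV⟩]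
    change _ * (toFunctionField ⟨x.1, hxV⟩ a / toFunctionField ⟨x.1, hxW⟩ d) = _ * 1
    rw [mul_div_cancel₀ _ hd0, mul_one]
  have h2 := congrArg (fun z ↦ sectionValue (φ.app O z) ⟨x.1, hxO⟩) h1
  simp only [Scheme.Modules.Hom.app_smul, app_map] at h2
  rw [sectionValue_smul, sectionValue_smul, sectionValue_map, sectionValue_map, toFunctionField_map,
    toFunctionField_map] at h2
  have h3 : toFunctionField ⟨x.1, hxW⟩ d * sectionValue (φ.app U s) x =
      toFunctionField ⟨x.1, hxV⟩ a * homValue φ :=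
    h2.trans (congrArg (_ * ·) (sectionValue_eq (φ.app ⊤ (oneSection J ⊤)) _ _))
  rw [← e]
  change _ = _ * (toFunctionField ⟨x.1, hxV⟩ a / toFunctionField ⟨x.1, hxW⟩ d)
  field_simp
  rw [mul_comm, h3, mul_comm]

lemma IsMultiplication.homValue_eq {φ : divisorSheaf J ⟶ divisorSheaf J'} {r : X.functionField}
    (h : IsMultiplication φ r) : homValue φ = r :=
  (h ⊤ (oneSection J ⊤) ⟨genericPoint X, trivial⟩).trans (mul_one r)

lemma IsMultiplication.hom_ext {φ ψ : divisorSheaf J ⟶ divisorSheaf J'} {r : X.functionField}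
    (h : IsMultiplication φ r) (h' : IsMultiplication ψ r) : φ = ψ := by
  refine Scheme.Modules.hom_ext _ _ fun U ↦ ?_
  ext s
  apply sectionValue_injective
  funext x
  exact (h U s x).trans (h' U s x).symm

lemma homValue_injective :
    Function.Injective (homValue : (divisorSheaf J ⟶ divisorSheaf J') → X.functionField) :=
  fun φ ψ h ↦ (isMultiplication_homValue φ).hom_ext (h ▸ isMultiplication_homValue ψ)

lemma IsMultiplication.add {φ ψ : divisorSheaf J ⟶ divisorSheaf J'} {r s : X.functionField}
    (h : IsMultiplication φ r) (h' : IsMultiplication ψ s) : IsMultiplication (φ + ψ) (r + s) := by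
  intro U f x
  rw [add_mul, ← h U f x, ← h' U f x]
  rfl

lemma IsMultiplication.comp {φ : divisorSheaf J ⟶ divisorSheaf J'}
    {ψ : divisorSheaf J' ⟶ divisorSheaf J''} {r s : X.functionField}
    (h : IsMultiplication φ r) (h' : IsMultiplication ψ s) : IsMultiplication (φ ≫ ψ) (s * r) := by
  intro U f x
  rw [mul_assoc, ← h U f x]
  exact h' U _ x

lemma isMultiplication_id : IsMultiplication (𝟙 (divisorSheaf J)) 1 :=
  fun _ _ _ ↦ (one_mul _).symm

lemma isMultiplication_zero : IsMultiplication (0 : divisorSheaf J ⟶ divisorSheaf J') 0 :=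
  fun _ _ _ ↦ (zero_mul _).symm

lemma homValue_add (φ ψ : divisorSheaf J ⟶ divisorSheaf J') :
    homValue (φ + ψ) = homValue φ + homValue ψ :=
  ((isMultiplication_homValue φ).add (isMultiplication_homValue ψ)).homValue_eq

lemma homValue_comp (φ : divisorSheaf J ⟶ divisorSheaf J') (ψ : divisorSheaf J' ⟶ divisorSheaf J'') :
    homValue (φ ≫ ψ) = homValue ψ * homValue φ :=
  ((isMultiplication_homValue φ).comp (isMultiplication_homValue ψ)).homValue_eq

lemma homValue_id : homValue (𝟙 (divisorSheaf J)) = 1 := isMultiplication_id.homValue_eq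

lemma homValue_zero : homValue (0 : divisorSheaf J ⟶ divisorSheaf J') = 0 :=
  isMultiplication_zero.homValue_eq

/-- Multiplication by a rational function as a map on sections. -/
def mulSections {r : X.functionField} (hr : IsMultiplier J J' r) (U : X.Opens) :
    divisorSections J U →+ divisorSections J' U where
  toFun s := ⟨fun x ↦ r * s.1 x, fun x ↦ by
    obtain ⟨V, hxV, hV⟩ := s.2.1 x
    exact ⟨V, hxV, fun y hy ↦ congrArg (r * ·) (hV y hy)⟩, fun x ↦ hr x.1 _ (s.2.2 x)⟩
  map_zero' := Subtype.ext (funext fun _ ↦ mul_zero r)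
  map_add' s s' := Subtype.ext (funext fun x ↦ mul_add r (s.1 x) (s'.1 x))

/-- Multiplication by a rational function as a morphism of sheaves. -/
def mulHom {r : X.functionField} (hr : IsMultiplier J J' r) : divisorSheaf J ⟶ divisorSheaf J' :=
  ⟨PresheafOfModules.homMk
    { app := fun U ↦ AddCommGrpCat.ofHom (mulSections hr U.unop)
      naturality := fun _ _ _ ↦ rfl }
    fun _ _ _ ↦ Subtype.ext (funext fun _ ↦ mul_left_comm _ _ _)⟩

lemma isMultiplication_mulHom {r : X.functionField} (hr : IsMultiplier J J' r) :
    IsMultiplication (mulHom hr) r := fun _ _ _ ↦ rfl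

/-- An ideal sheaf is locally of finite type. -/
def IsLocallyFG (J : X.IdealSheafData) : Prop :=
  ∀ x, ∃ U : X.affineOpens, x ∈ U.1 ∧ (J.ideal U).FG

/-- Regularity of g times each of finitely many generators of the ideal is an open condition. -/
lemma exists_mem_divisorStalk_nhds (hJ : IsLocallyFG J) {x : X} {g : X.functionField}
    (hg : g ∈ divisorStalk J x) : ∃ W : X.Opens, x ∈ W ∧ ∀ y ∈ W, g ∈ divisorStalk J y := by
  obtain ⟨U, hxU, S, hS⟩ := hJ x
  have h1 : ∀ f ∈ S, ∃ W : X.Opens, x ∈ W ∧ W ≤ U.1 ∧ ∀ y (hyU : y ∈ U.1), y ∈ W →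
      g * toFunctionField ⟨y, hyU⟩ f ∈ localSubring y := by
    intro f hf
    have h2 := (mem_divisorStalk_iff_of_mem U hxU).mp hg f (hS ▸ Ideal.subset_span hf)
    obtain ⟨r, hr⟩ := mem_localSubring_iff.mp h2
    obtain ⟨W, hxW, c, rfl⟩ := X.presheaf.exists_germ_eq r
    refine ⟨W ⊓ U.1, ⟨hxW, hxU⟩, inf_le_right, fun y hyU hy ↦ ?_⟩
    rw [← toFunctionField_apply] at hr
    rw [toFunctionField_eq _ ⟨x, hxU⟩, ← hr, toFunctionField_eq _ ⟨y, hy.1⟩]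
    exact toFunctionField_mem_localSubring _ _
  choose! W hxW hWU hW using h1
  refine ⟨U.1 ⊓ S.inf W, ⟨hxU, ?_⟩, fun y hy ↦ ?_⟩
  · rw [TopologicalSpace.Opens.coe_finset_inf]
    simpa using hxW
  · rw [mem_divisorStalk_iff_of_mem U hy.1, ← hS]
    intro f hf
    induction hf using Submodule.span_induction with
    | mem f hf =>
      exact hW f hf y hy.1 ((Finset.inf_le (f := W) hf) hy.2)
    | zero => rw [map_zero, mul_zero]; exact zero_mem _
    | add f f' _ _ hf hf' => rw [map_add, mul_add]; exact (localSubring y).add_mem hf hf'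
    | smul a f _ hf =>
      rw [smul_eq_mul, map_mul, mul_left_comm]
      exact (localSubring y).mul_mem (toFunctionField_mem_localSubring hy.1 a) hf

/-- A morphism acts on sections, so a germ must first be extended to a neighbourhood. This is where
finite generation of the ideal is needed. -/
lemma isMultiplier_homValue (hJ : IsLocallyFG J) (φ : divisorSheaf J ⟶ divisorSheaf J') :
    IsMultiplier J J' (homValue φ) := by
  intro x g hg
  obtain ⟨W, hxW, hW⟩ := exists_mem_divisorStalk_nhds hJ hg
  have h := isMultiplication_homValue φ W (constantSection J W g hW) ⟨x, hxW⟩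
  exact (h.trans rfl) ▸ sectionValue_mem (φ.app W (constantSection J W g hW)) ⟨x, hxW⟩

omit [IsIntegral X] in
lemma isLocallyFG_top : IsLocallyFG (⊤ : X.IdealSheafData) := by
  intro x
  obtain ⟨_, ⟨U, hU, rfl⟩, hxU, -⟩ :=
    X.isBasis_affineOpens.exists_subset_of_mem_open (Set.mem_univ x) isOpen_univ
  exact ⟨⟨U, hU⟩, hxU, ⟨{1}, by simp [Scheme.IdealSheafData.ideal_top]⟩⟩

omit [IsIntegral X] in
lemma IsLocallyFG.sq (h : IsLocallyFG J) : IsLocallyFG (J ^ 2) := by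
  intro x
  obtain ⟨U, hxU, hU⟩ := h x
  exact ⟨U, hxU, hU.pow⟩

omit [IsIntegral X] in
lemma isLocallyFG_comap {Y : Scheme.{u}} [IsLocallyNoetherian Y] (b : X ⟶ Y)
    (I : Y.IdealSheafData) : IsLocallyFG (I.comap b) := by
  intro x
  obtain ⟨_, ⟨V, hV, rfl⟩, hxV, -⟩ :=
    Y.isBasis_affineOpens.exists_subset_of_mem_open (Set.mem_univ (b x)) isOpen_univ
  obtain ⟨_, ⟨U, hU, rfl⟩, hxU, hUV⟩ :=
    X.isBasis_affineOpens.exists_subset_of_mem_open (show x ∈ (b ⁻¹ᵁ V : X.Opens) from hxV)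
      (b ⁻¹ᵁ V).isOpen
  refine ⟨⟨U, hU⟩, hxU, ?_⟩
  rw [ideal_comap b I ⟨V, hV⟩ ⟨U, hU⟩ hUV]
  have : IsNoetherianRing Γ(Y, V) := IsLocallyNoetherian.component_noetherian ⟨V, hV⟩
  exact ((isNoetherianRing_iff_ideal_fg _).mp this _).map _

omit [IsIntegral X] in
lemma isLocallyFG_divisorIdeal {k : Type u} [Field k] (b : X ⟶ Plane k) {t : ℕ}
    (p : Fin t → Plane k) (hp : ∀ i, IsClosed {p i}) (h : MvPolynomial (Fin 3) k) (v : Vertex t) :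
    IsLocallyFG (divisorIdeal b p hp h v) := by
  cases v with
  | zero => exact isLocallyFG_top
  | exc i => exact isLocallyFG_comap b _
  | line => exact isLocallyFG_comap b _
  | conic => exact (isLocallyFG_comap b _).sq

end

end BlowupPlane

namespace BlowupPlane

noncomputable section

/-! ### Representations of the path algebra by matrices -/

section PathMatrix

variable {k : Type*} [CommRing k] {V : Type*} [Quiver V] [Fintype V]

lemma pathIdem_mul_self (v : V) : pathIdem k v * pathIdem k v = pathIdem k v := by
  rw [pathIdem, ← map_mul]
  exact RingQuot.mkAlgHom_rel k (.idem v)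

lemma pathIdem_mul_of_ne {v w : V} (h : v ≠ w) : pathIdem k v * pathIdem k w = 0 := by
  rw [pathIdem, pathIdem, ← map_mul, ← map_zero (RingQuot.mkAlgHom k (PathRel k V))]
  exact RingQuot.mkAlgHom_rel k (.orth v w h)

lemma sum_pathIdem : ∑ v : V, pathIdem k v = 1 := by
  simp only [pathIdem]
  rw [← map_sum, ← map_one (RingQuot.mkAlgHom k (PathRel k V))]
  exact RingQuot.mkAlgHom_rel k .one

lemma pathArrow_mul_pathIdem {v w : V} (a : v ⟶ w) : pathArrow k a * pathIdem k v = pathArrow k a := by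
  rw [pathArrow, pathIdem, ← map_mul]
  exact RingQuot.mkAlgHom_rel k (.source a)

lemma pathIdem_mul_pathArrow {v w : V} (a : v ⟶ w) : pathIdem k w * pathArrow k a = pathArrow k a := by
  rw [pathArrow, pathIdem, ← map_mul]
  exact RingQuot.mkAlgHom_rel k (.target a)

/-- To prove a property of all elements of the path algebra, multiply by generators on the left. -/
lemma PathAlgebra.induction_mul {P : PathAlgebra k V → Prop} (one : P 1)
    (add : ∀ a b, P a → P b → P (a + b)) (smul : ∀ (c : k) a, P a → P (c • a))
    (idem : ∀ v a, P a → P (pathIdem k v * a))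
    (arrow : ∀ (v w : V) (x : v ⟶ w) a, P a → P (pathArrow k x * a)) (a : PathAlgebra k V) : P a := by
  obtain ⟨y, rfl⟩ := RingQuot.mkAlgHom_surjective k (PathRel k V) a
  suffices ∀ y a, P a → P (RingQuot.mkAlgHom k (PathRel k V) y * a) by
    simpa using this y 1 one
  intro y
  induction y using FreeAlgebra.induction with
  | grade0 c =>
    intro a ha
    rw [AlgHom.commutes, ← Algebra.smul_def]
    exact smul c a ha
  | grade1 g =>
    intro a ha
    cases g with
    | vertex v => exact idem v a ha
    | arrow x => exact arrow _ _ x a ha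
  | mul x y hx hy =>
    intro a ha
    rw [map_mul, mul_assoc]
    exact hx _ (hy a ha)
  | add x y hx hy =>
    intro a ha
    rw [map_add, add_mul]
    exact add _ _ (hx a ha) (hy a ha)

/-- The ring homomorphisms are not assumed linear over k, so agreement on scalars is a separate
condition. -/
lemma PathAlgebra.ringHom_ext {R : Type*} [Ring R] {f g : PathAlgebra k V →+* R}
    (h : ∀ c : k, f (algebraMap k _ c) = g (algebraMap k _ c))
    (hv : ∀ v, f (pathIdem k v) = g (pathIdem k v))
    (ha : ∀ (v w : V) (x : v ⟶ w), f (pathArrow k x) = g (pathArrow k x)) : f = g := by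
  refine RingHom.ext fun (a : PathAlgebra k V) ↦ ?_
  induction a using PathAlgebra.induction_mul with
  | one => rw [map_one, map_one]
  | add a b ha hb => rw [map_add, map_add, ha, hb]
  | smul c a ih => rw [Algebra.smul_def, map_mul, map_mul, h, ih]
  | idem v a ih => rw [map_mul, map_mul, hv, ih]
  | arrow v w x a ih => rw [map_mul, map_mul, ha, ih]

variable [DecidableEq V] {K : Type*} [CommRing K] (σ : k →+* K) (F : ∀ {v w : V}, (v ⟶ w) → K)

/-- The representation of the path algebra by matrices that sends an arrow to a matrix with a
single entry. -/
def pathMatrix : PathAlgebra k V →+* Matrix V V K :=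
  letI : Algebra k K := σ.toAlgebra
  (RingQuot.liftAlgHom k (s := PathRel k V) ⟨FreeAlgebra.lift k fun
    | .vertex v => Matrix.single v v 1
    | @PathGen.arrow _ _ v w x => Matrix.single w v (F x), fun a b h ↦ by
    induction h with
    | idem v => simp
    | orth v w h => simp [h]
    | one => simp [Matrix.sum_single_one]
    | source x => simp
    | target x => simp⟩).toRingHom

lemma pathMatrix_algebraMap (c : k) :
    pathMatrix σ F (algebraMap k _ c) = Matrix.diagonal fun _ ↦ σ c := by
  let : Algebra k K := σ.toAlgebra
  refine (AlgHom.commutes (RingQuot.liftAlgHom k (s := PathRel k V) _) c).trans ?_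
  rfl

lemma pathMatrix_pathIdem (v : V) : pathMatrix σ F (pathIdem k v) = Matrix.single v v 1 := by
  let : Algebra k K := σ.toAlgebra
  refine (RingQuot.liftAlgHom_mkAlgHom_apply k _ _ _).trans ?_
  rw [FreeAlgebra.lift_ι_apply]

lemma pathMatrix_pathArrow {v w : V} (x : v ⟶ w) :
    pathMatrix σ F (pathArrow k x) = Matrix.single w v (F x) := by
  let : Algebra k K := σ.toAlgebra
  refine (RingQuot.liftAlgHom_mkAlgHom_apply k _ _ _).trans ?_
  rw [FreeAlgebra.lift_ι_apply]

lemma pathMatrix_smul (c : k) (a : PathAlgebra k V) :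
    pathMatrix σ F (c • a) = σ c • pathMatrix σ F a := by
  rw [Algebra.smul_def, map_mul, pathMatrix_algebraMap]
  ext i j
  simp

end PathMatrix

/-! ### Spans of paths between two vertices -/

section PathSpace

variable {k : Type u} [Field k] {t : ℕ} (p : Fin t → Plane k)
  (β : ∀ i, Module.Basis (Fin 2) k (formsThrough (p i)))
  (γ : Module.Basis (Fin 3) k (LinearForms k))

/-- The span of the paths from `v` to `w`. -/
def pathSpace : Vertex t → Vertex t → Submodule k (PathAlgebra k (Vertex t))
  | .zero, .zero => Submodule.span k {pathIdem k .zero}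
  | .exc i, .exc j => if i = j then Submodule.span k {pathIdem k (.exc i)} else ⊥
  | .line, .line => Submodule.span k {pathIdem k .line}
  | .conic, .conic => Submodule.span k {pathIdem k .conic}
  | .exc i, .zero => Submodule.span k {pathArrow k (Arrow.a i : Vertex.zero ⟶ Vertex.exc i)}
  | .line, .exc i => (embH p β i).range
  | .conic, .line => (embV γ).range
  | .conic, .exc i => (embHV p β γ i).range
  | .line, .zero => (embSum p β).range
  | .conic, .zero => (embSumV p β γ).range
  | _, _ => ⊥

lemma pathIdem_mem_pathSpace (v : Vertex t) : pathIdem k v ∈ pathSpace p β γ v v := by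
  cases v with
  | exc i =>
    rw [pathSpace, if_pos rfl]
    exact Submodule.mem_span_singleton_self _
  | _ => exact Submodule.mem_span_singleton_self _

lemma embH_basis (i : Fin t) (j : Fin 2) :
    embH p β i (β i j) = pathArrow k (Arrow.b i j : Vertex.exc i ⟶ Vertex.line) :=
  (β i).constr_basis k _ j

lemma embV_basis (j : Fin 3) :
    embV γ (γ j) = pathArrow k (Arrow.c j : (Vertex.line : Vertex t) ⟶ Vertex.conic) :=
  γ.constr_basis k _ j

lemma embHV_tmul (i : Fin t) (y : formsThrough (p i)) (z : LinearForms k) :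
    embHV p β γ i (y ⊗ₜ z) = embV γ z * embH p β i y := rfl

lemma embSumV_tmul (y : ∀ i, formsThrough (p i)) (z : LinearForms k) :
    embSumV p β γ (y ⊗ₜ z) = embV γ z * embSum p β y := rfl

lemma embSum_apply (y : ∀ i, formsThrough (p i)) :
    embSum p β y = ∑ i, embH p β i (y i) *
      pathArrow k (Arrow.a i : Vertex.zero ⟶ Vertex.exc i) := by
  simp [embSum]

lemma pathArrow_mul_mem_pathSpace {u w : Vertex t} (x : u ⟶ w) (v : Vertex t)
    {z : PathAlgebra k (Vertex t)} (hz : z ∈ pathSpace p β γ u v) :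
    pathArrow k x * z ∈ pathSpace p β γ w v := by
  match u, w, x with
  | _, _, .a i =>
    cases v with
    | zero =>
      obtain ⟨c, rfl⟩ := Submodule.mem_span_singleton.mp hz
      rw [mul_smul_comm, pathArrow_mul_pathIdem]
      exact Submodule.smul_mem _ _ (Submodule.mem_span_singleton_self _)
    | _ =>
      rw [(Submodule.mem_bot k).mp hz, mul_zero]
      exact zero_mem _
  | _, _, .b i j =>
    cases v with
    | zero =>
      obtain ⟨c, rfl⟩ := Submodule.mem_span_singleton.mp hz
      rw [mul_smul_comm]
      -- The path through O(R_i) is the tuple concentrated in the summand H_i.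
      refine Submodule.smul_mem _ _ ⟨Pi.single i (β i j), ?_⟩
      rw [embSum_apply, Finset.sum_eq_single i, Pi.single_eq_same, embH_basis]
      · intro l _ hl
        rw [Pi.single_eq_of_ne hl, map_zero, zero_mul]
      · exact fun h ↦ absurd (Finset.mem_univ i) h
    | exc l =>
      rw [pathSpace] at hz
      split_ifs at hz with hil
      · subst hil
        obtain ⟨c, rfl⟩ := Submodule.mem_span_singleton.mp hz
        rw [mul_smul_comm, pathArrow_mul_pathIdem]
        exact Submodule.smul_mem _ _ ⟨β i j, embH_basis p β i j⟩
      · rw [(Submodule.mem_bot k).mp hz, mul_zero]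
        exact zero_mem _
    | _ =>
      rw [(Submodule.mem_bot k).mp hz, mul_zero]
      exact zero_mem _
  | _, _, .c j =>
    cases v with
    | zero =>
      obtain ⟨s, rfl⟩ := hz
      exact ⟨s ⊗ₜ γ j, by rw [embSumV_tmul, embV_basis]⟩
    | exc i =>
      obtain ⟨s, rfl⟩ := hz
      exact ⟨s ⊗ₜ γ j, by rw [embHV_tmul, embV_basis]⟩
    | line =>
      obtain ⟨c, rfl⟩ := Submodule.mem_span_singleton.mp hz
      rw [mul_smul_comm, pathArrow_mul_pathIdem]
      exact Submodule.smul_mem _ _ ⟨γ j, embV_basis γ j⟩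
    | conic =>
      rw [(Submodule.mem_bot k).mp hz, mul_zero]
      exact zero_mem _

/-- Build the element by left multiplication with generators. The end vertex is left free in the
induction, since an arrow moves it. -/
lemma pathIdem_mul_mul_pathIdem_mem (a : PathAlgebra k (Vertex t)) (w v : Vertex t) :
    pathIdem k w * a * pathIdem k v ∈ pathSpace p β γ w v := by
  induction a using PathAlgebra.induction_mul generalizing w with
  | one =>
    rw [mul_one]
    by_cases h : w = v
    · subst h
      rw [pathIdem_mul_self]
      exact pathIdem_mem_pathSpace p β γ w
    · rw [pathIdem_mul_of_ne h]
      exact zero_mem _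
  | add a b ha hb =>
    rw [mul_add, add_mul]
    exact add_mem (ha w) (hb w)
  | smul c a ih =>
    rw [mul_smul_comm, smul_mul_assoc]
    exact Submodule.smul_mem _ _ (ih w)
  | idem u a ih =>
    by_cases h : w = u
    · subst h
      rw [← mul_assoc, pathIdem_mul_self]
      exact ih w
    · rw [← mul_assoc, pathIdem_mul_of_ne h, zero_mul, zero_mul]
      exact zero_mem _
  | arrow u u' x a ih =>
    by_cases h : w = u'
    · subst h
      have := pathArrow_mul_mem_pathSpace p β γ x v (ih u)
      rwa [← mul_assoc, ← mul_assoc, pathArrow_mul_pathIdem, ← pathIdem_mul_pathArrow x,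
        mul_assoc (pathIdem k w)] at this
    · rw [← mul_assoc, ← pathIdem_mul_pathArrow x, ← mul_assoc, pathIdem_mul_of_ne h, zero_mul,
        zero_mul, zero_mul]
      exact zero_mem _

end PathSpace

end

end BlowupPlane

namespace BlowupPlane

/-! ### Values of the spaces of paths -/

noncomputable section

attribute [local instance] functionFieldCommRing

variable {k : Type u} [Field k] {X : Scheme.{u}} [IsIntegral X] {b : X ⟶ Plane k}
  (hη : b (genericPoint X) = Plane.genericPt k) {t : ℕ} {p : Fin t → Plane k}
  {h : MvPolynomial (Fin 3) k} (hh : h ∈ LinearForms k) (h0 : h ≠ 0)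
  (β : ∀ i, Module.Basis (Fin 2) k (formsThrough (p i)))
  (γ : Module.Basis (Fin 3) k (LinearForms k))

/-- The matrices of rational functions attached to the elements of the path algebra. -/
def valueMatrix : PathAlgebra k (Vertex t) →+* Matrix (Vertex t) (Vertex t) X.functionField :=
  pathMatrix ((formValue hη).comp MvPolynomial.C) (arrowFunction b p hh β γ)

lemma formValue_smul (c : k) (f : MvPolynomial (Fin 3) k) :
    formValue hη (c • f) = formValue hη (MvPolynomial.C c) * formValue hη f := by
  rw [MvPolynomial.smul_eq_C_mul, map_mul]

lemma valueMatrix_smul (c : k) (a : PathAlgebra k (Vertex t)) :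
    valueMatrix hη hh β γ (c • a) =
      formValue hη (MvPolynomial.C c) • valueMatrix hη hh β γ a := pathMatrix_smul _ _ c a

lemma valueMatrix_pathIdem (v : Vertex t) :
    valueMatrix hη hh β γ (pathIdem k v) = Matrix.single v v 1 := pathMatrix_pathIdem _ _ v

lemma valueMatrix_pathArrow {v w : Vertex t} (x : v ⟶ w) :
    valueMatrix hη hh β γ (pathArrow k x) = Matrix.single w v (arrowFunction b p hh β γ x) :=
  pathMatrix_pathArrow _ _ x

include h0

lemma valueMatrix_embH (i : Fin t) (y : formsThrough (p i)) :
    valueMatrix hη hh β γ (embH p β i y) =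
      Matrix.single .line (.exc i) (formValue hη y / formValue hη h) := by
  have key : ∀ c : Fin 2 → k, valueMatrix hη hh β γ (embH p β i (∑ j, c j • β i j)) =
      Matrix.single .line (.exc i) (formValue hη (∑ j, c j • β i j : formsThrough (p i)) / formValue hη h) := by
    intro c
    simp only [map_sum, map_smul, embH_basis, valueMatrix_smul, valueMatrix_pathArrow,
      arrowFunction, Submodule.coe_sum, Submodule.coe_smul, formValue_smul, formRatio_eq hη hh h0]
    simp only [Matrix.smul_single, Fin.sum_univ_two, ← Matrix.single_add, smul_eq_mul, add_div, mul_div_assoc]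
  rw [← (β i).sum_equivFun y]
  exact key _

lemma valueMatrix_embV (y : LinearForms k) :
    valueMatrix hη hh β γ (embV γ y) =
      Matrix.single .conic .line (formValue hη y / formValue hη h) := by
  have key : ∀ c : Fin 3 → k, valueMatrix hη hh β γ (embV γ (∑ j, c j • γ j)) =
      Matrix.single .conic .line (formValue hη (∑ j, c j • γ j : LinearForms k) / formValue hη h) := by
    intro c
    simp only [map_sum, map_smul, embV_basis, valueMatrix_smul, valueMatrix_pathArrow,
      arrowFunction, Submodule.coe_sum, Submodule.coe_smul, formValue_smul, formRatio_eq hη hh h0]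
    simp only [Matrix.smul_single, Fin.sum_univ_three, ← Matrix.single_add, smul_eq_mul, add_div, mul_div_assoc]
  rw [← γ.sum_equivFun y]
  exact key _

/-- Concatenation of paths becomes a product of one-entry matrices, hence of forms. Each of the two
factors contributes one denominator h. -/
lemma valueMatrix_embHV (i : Fin t) (x : formsThrough (p i) ⊗[k] LinearForms k) :
    valueMatrix hη hh β γ (embHV p β γ i x) = Matrix.single .conic (.exc i)
      (formValue hη (multToS2 (formsThrough (p i)) (formsThrough_le (p i)) x) /
        formValue hη h ^ 2) := by
  induction x with
  | zero => simp
  | add x y hx hy => rw [map_add, map_add, hx, hy, map_add, Submodule.coe_add, map_add, add_div, Matrix.single_add]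
  | tmul y z =>
    rw [embHV_tmul, map_mul, valueMatrix_embH hη hh h0, valueMatrix_embV hη hh h0,
      Matrix.single_mul_single_same]
    congr 1
    change _ = formValue hη ((y : MvPolynomial (Fin 3) k) * (z : MvPolynomial (Fin 3) k)) / _
    rw [map_mul]
    ring

lemma valueMatrix_embSum (y : ∀ i, formsThrough (p i)) :
    valueMatrix hη hh β γ (embSum p β y) =
      Matrix.single .line .zero (formValue hη (sumToV p y) / formValue hη h) := by
  rw [embSum_apply, map_sum]
  have e : (sumToV p y : MvPolynomial (Fin 3) k) = ∑ i, (y i : MvPolynomial (Fin 3) k) := by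
    simp [sumToV]
  rw [e, map_sum, Finset.sum_div]
  have : ∀ (s : Finset (Fin t)) (f : Fin t → X.functionField),
      (Matrix.single .line .zero (∑ i ∈ s, f i) : Matrix (Vertex t) (Vertex t) X.functionField) =
      ∑ i ∈ s, Matrix.single .line .zero (f i) := fun s f ↦
    map_sum (Matrix.singleAddMonoidHom (.line : Vertex t) (.zero : Vertex t)) f s
  rw [this]
  refine Finset.sum_congr rfl fun i _ ↦ ?_
  rw [map_mul, valueMatrix_embH hη hh h0, valueMatrix_pathArrow, Matrix.single_mul_single_same,
    arrowFunction, mul_one]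

lemma valueMatrix_embSumV (x : (∀ i, formsThrough (p i)) ⊗[k] LinearForms k) :
    valueMatrix hη hh β γ (embSumV p β γ x) = Matrix.single .conic .zero
      (formValue hη (multToS2 (LinearForms k) le_rfl ((sumToV p).rTensor (LinearForms k) x)) /
        formValue hη h ^ 2) := by
  induction x with
  | zero => simp
  | add x y hx hy => rw [map_add, map_add, hx, hy, map_add, map_add, Submodule.coe_add, map_add, add_div, Matrix.single_add]
  | tmul y z =>
    rw [embSumV_tmul, map_mul, valueMatrix_embSum hη hh h0, valueMatrix_embV hη hh h0,
      Matrix.single_mul_single_same]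
    congr 1
    change _ = formValue hη ((sumToV p y : MvPolynomial (Fin 3) k) * (z : MvPolynomial (Fin 3) k)) / _
    rw [map_mul]
    ring

end

end BlowupPlane

namespace BlowupPlane

/-! ### Kernel and image of the matrix representation -/

noncomputable section

attribute [local instance] functionFieldCommRing

variable {k : Type u} [Field k] {X : Scheme.{u}} [IsIntegral X] {b : X ⟶ Plane k}

lemma exists_eq_C_of_mem_grading_zero {f : MvPolynomial (Fin 3) k} (hf : f ∈ grading k 0) :
    ∃ c, f = MvPolynomial.C c :=
  ⟨_, MvPolynomial.totalDegree_eq_zero_iff_eq_C.mp (Nat.le_zero.mp (MvPolynomial.IsHomogeneous.totalDegree_le hf))⟩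

/-- A nonzero constant vanishes nowhere. This excludes nonzero morphisms from O(R_i) to O or to
O(R_j) with j ≠ i. -/
lemma eq_zero_of_mem_grading_zero {f : MvPolynomial (Fin 3) k} (hf : f ∈ grading k 0) {y : Plane k}
    (hy : f ∈ y.asHomogeneousIdeal) : f = 0 := by
  obtain ⟨c, rfl⟩ := exists_eq_C_of_mem_grading_zero hf
  by_contra hc
  refine y.isPrime.ne_top (Ideal.eq_top_of_isUnit_mem _ hy ?_)
  rw [MvPolynomial.isUnit_iff_eq_C_of_isReduced]
  exact ⟨c, isUnit_iff_ne_zero.mpr fun h ↦ hc (by rw [h, map_zero]), rfl⟩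

lemma exists_multToS2_eq (M : Submodule k (MvPolynomial (Fin 3) k)) (hM : M ≤ LinearForms k)
    {f : MvPolynomial (Fin 3) k} (hf : f ∈ M * LinearForms k) :
    ∃ x : M ⊗[k] LinearForms k, (multToS2 M hM x : MvPolynomial (Fin 3) k) = f := by
  rw [← Submodule.mulMap_range] at hf
  exact hf

lemma mem_linearForms_mul {f : MvPolynomial (Fin 3) k} (hf : f ∈ grading k 2) :
    f ∈ LinearForms k * LinearForms k := by
  rw [← pow_two, LinearForms, MvPolynomial.homogeneousSubmodule_one_pow]
  exact hf

lemma sumToV_surjective [IsAlgClosed k] {t : ℕ} (ht : 1 < t) {p : Fin t → Plane k}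
    (hp : ∀ i, IsClosed {p i}) (hinj : Function.Injective p) : Function.Surjective (sumToV p) := by
  intro f
  let i : Fin t := ⟨0, by omega⟩
  let j : Fin t := ⟨1, ht⟩
  have hij : i ≠ j := fun h ↦ by simp [i, j] at h
  obtain ⟨a, ha, c, hc, e⟩ := exists_add_of_ne (hp i) (hp j) (hinj.ne hij) f.2
  refine ⟨Pi.single i ⟨a, ha⟩ + Pi.single j ⟨c, hc⟩, ?_⟩
  have key : ∀ (i : Fin t) (y : formsThrough (p i)), sumToV p (Pi.single i y) =
      Submodule.inclusion (formsThrough_le (p i)) y := by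
    intro i y
    simp only [sumToV, LinearMap.sum_apply, LinearMap.comp_apply, LinearMap.proj_apply]
    rw [Finset.sum_eq_single i, Pi.single_eq_same]
    · intro l _ hl
      rw [Pi.single_eq_of_ne hl, map_zero]
    · exact fun h ↦ absurd (Finset.mem_univ i) h
  rw [map_add, key, key]
  exact Subtype.ext e.symm

variable (hη : b (genericPoint X) = Plane.genericPt k) {t : ℕ} {p : Fin t → Plane k}
  {h : MvPolynomial (Fin 3) k} (hh : h ∈ LinearForms k) (h0 : h ≠ 0)
  (β : ∀ i, Module.Basis (Fin 2) k (formsThrough (p i)))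
  (γ : Module.Basis (Fin 3) k (LinearForms k))

lemma single_eq_zero {n : Type*} [DecidableEq n] {K : Type*} [Zero K] {i j : n} {r : K}
    (h : Matrix.single i j r = 0) : r = 0 := by
  have := congrFun₂ h i j
  simpa using this

include h0

/-- The single entry is a form over a power of h and determines the form. On the blocks from O(R_i)
or O to O(2H) and from O to O(H), its vanishing is membership in a kernel among the relations; on
all other blocks it gives z = 0. -/
lemma mem_span_relations_of_mem_pathSpace {v w : Vertex t} {z : PathAlgebra k (Vertex t)}
    (hz : z ∈ pathSpace p β γ w v) (hz0 : valueMatrix hη hh β γ z = 0) :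
    z ∈ TwoSidedIdeal.span (relations p β γ) := by
  have hh1 : formValue hη h ≠ 0 := formValue_ne_zero hη hh h0
  have hC : ∀ {c : k} {v w : Vertex t} {a : PathAlgebra k (Vertex t)},
      valueMatrix hη hh β γ a = Matrix.single w v 1 → c • a ∈ pathSpace p β γ w v →
      valueMatrix hη hh β γ (c • a) = 0 → c • a ∈ TwoSidedIdeal.span (relations p β γ) := by
    intro c v w a ha _ hca
    rw [valueMatrix_smul, ha, Matrix.smul_single, smul_eq_mul, mul_one] at hca
    have hc : c = 0 := by
      by_contra hc
      refine formValue_ne_zero hη (MvPolynomial.isHomogeneous_C (Fin 3) c) ?_ (single_eq_zero hca)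
      rwa [Ne, MvPolynomial.C_eq_zero]
    rw [hc, zero_smul]
    exact zero_mem _
  have hbot : z ∈ (⊥ : Submodule k (PathAlgebra k (Vertex t))) →
      z ∈ TwoSidedIdeal.span (relations p β γ) := fun hz ↦ by
    rw [(Submodule.mem_bot k).mp hz]
    exact zero_mem _
  have hform : ∀ {n m : ℕ} {f : MvPolynomial (Fin 3) k}, f ∈ grading k n →
      formValue hη f / formValue hη h ^ m = 0 → f = 0 := by
    intro n m f hf hf0
    by_contra hne
    exact (div_ne_zero (formValue_ne_zero hη hf hne) (pow_ne_zero _ hh1)) hf0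
  have hidem : ∀ {v}, z ∈ Submodule.span k {pathIdem k v} →
      z ∈ TwoSidedIdeal.span (relations p β γ) := by
    intro v hz
    obtain ⟨c, rfl⟩ := Submodule.mem_span_singleton.mp hz
    exact hC (valueMatrix_pathIdem hη hh β γ v)
      (Submodule.smul_mem _ _ (pathIdem_mem_pathSpace p β γ v)) hz0
  match w, v with
  | .zero, .zero => exact hidem hz
  | .line, .line => exact hidem hz
  | .conic, .conic => exact hidem hz
  | .exc i, .exc j =>
    rw [pathSpace] at hz
    split_ifs at hz
    · exact hidem hz
    · exact hbot hz
  | .exc i, .zero =>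
    obtain ⟨c, rfl⟩ := Submodule.mem_span_singleton.mp hz
    exact hC (valueMatrix_pathArrow hη hh β γ (Arrow.a i)) hz hz0
  | .line, .exc i =>
    obtain ⟨y, rfl⟩ := hz
    rw [valueMatrix_embH hη hh h0] at hz0
    have hy : (y : MvPolynomial (Fin 3) k) = 0 :=
      hform (m := 1) y.2.1 (by rw [pow_one]; exact single_eq_zero hz0)
    obtain rfl : y = 0 := Subtype.ext hy
    rw [map_zero]
    exact zero_mem _
  | .conic, .line =>
    obtain ⟨y, rfl⟩ := hz
    rw [valueMatrix_embV hη hh h0] at hz0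
    have hy : (y : MvPolynomial (Fin 3) k) = 0 :=
      hform (m := 1) y.2 (by rw [pow_one]; exact single_eq_zero hz0)
    obtain rfl : y = 0 := Subtype.ext hy
    rw [map_zero]
    exact zero_mem _
  | .conic, .exc i =>
    obtain ⟨y, rfl⟩ := hz
    rw [valueMatrix_embHV hη hh h0] at hz0
    have hy := hform (multToS2 _ _ y).2 (single_eq_zero hz0)
    exact TwoSidedIdeal.subset_span (.inl (.inl (Set.mem_iUnion.mpr ⟨i, y, Subtype.ext hy, rfl⟩)))
  | .line, .zero =>
    obtain ⟨y, rfl⟩ := hz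
    rw [valueMatrix_embSum hη hh h0] at hz0
    have hy := hform (m := 1) (sumToV p y).2 (by rw [pow_one]; exact single_eq_zero hz0)
    exact TwoSidedIdeal.subset_span (.inl (.inr ⟨y, Subtype.ext hy, rfl⟩))
  | .conic, .zero =>
    obtain ⟨y, rfl⟩ := hz
    rw [valueMatrix_embSumV hη hh h0] at hz0
    have hy := hform (multToS2 _ _ _).2 (single_eq_zero hz0)
    exact TwoSidedIdeal.subset_span (.inr ⟨y, Subtype.ext hy, rfl⟩)
  | .zero, .exc _ => exact hbot hz
  | .zero, .line => exact hbot hz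
  | .zero, .conic => exact hbot hz
  | .exc _, .line => exact hbot hz
  | .exc _, .conic => exact hbot hz
  | .line, .conic => exact hbot hz

lemma ker_valueMatrix :
    TwoSidedIdeal.ker (valueMatrix hη hh β γ) = TwoSidedIdeal.span (relations p β γ) := by
  apply le_antisymm
  · intro a ha
    rw [TwoSidedIdeal.mem_ker] at ha
    -- Peirce decomposition: the trivial paths are idempotents with sum 1, and each piece stays in
    -- the kernel.
    have e : a = ∑ w, ∑ v, pathIdem k w * a * pathIdem k v := by
      simp_rw [← Finset.mul_sum, sum_pathIdem, mul_one, ← Finset.sum_mul, sum_pathIdem, one_mul]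
    rw [e]
    refine sum_mem fun w _ ↦ sum_mem fun v _ ↦ ?_
    refine mem_span_relations_of_mem_pathSpace hη hh h0 β γ
      (pathIdem_mul_mul_pathIdem_mem p β γ a w v) ?_
    rw [map_mul, map_mul, ha, mul_zero, zero_mul]
  · rw [TwoSidedIdeal.span_le]
    rintro _ ((hz | ⟨y, hy, rfl⟩) | ⟨y, hy, rfl⟩)
    · obtain ⟨i, y, hy, rfl⟩ := Set.mem_iUnion.mp hz
      rw [SetLike.mem_coe, TwoSidedIdeal.mem_ker, valueMatrix_embHV hη hh h0, hy.out]
      simp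
    · rw [SetLike.mem_coe, TwoSidedIdeal.mem_ker, valueMatrix_embSum hη hh h0, hy.out]
      simp
    · rw [SetLike.mem_coe, TwoSidedIdeal.mem_ker, valueMatrix_embSumV hη hh h0, hy.out]
      simp

variable [IsAlgClosed k] {hp : ∀ i, IsClosed {p i}} (hb : IsBlowup b (pointsIdeal p hp))

include hb

/-- The entry is given by a form of known degree, subject to vanishing at p_i if the source is
O(R_i) and the target is different. What remains is to write such forms as values of paths, block by
block. -/
lemma exists_valueMatrix_eq_single (ht : 1 < t) (hinj : Function.Injective p) {v w : Vertex t}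
    {r : X.functionField}
    (hr : IsMultiplier (divisorIdeal b p hp h v) (divisorIdeal b p hp h w) r) :
    ∃ z, valueMatrix hη hh β γ z = Matrix.single w v r := by
  have hh1 : formValue hη h ≠ 0 := formValue_ne_zero hη hh h0
  obtain ⟨f, hf, hlt, hexc, rfl⟩ := exists_form_of_isMultiplier hb hη hh h0 hinj hr
  clear hr
  have hzero : f = 0 → ∃ z, valueMatrix hη hh β γ z = Matrix.single w v
      (formValue hη f * formValue hη h ^ v.degree / formValue hη h ^ w.degree) := by
    rintro rfl
    exact ⟨0, by simp⟩
  have hC : ∀ {a : PathAlgebra k (Vertex t)}, valueMatrix hη hh β γ a = Matrix.single w v 1 →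
      v.degree = w.degree → ∃ z, valueMatrix hη hh β γ z = Matrix.single w v
      (formValue hη f * formValue hη h ^ v.degree / formValue hη h ^ w.degree) := by
    intro a ha e
    rw [e, Nat.sub_self] at hf
    obtain ⟨c, rfl⟩ := exists_eq_C_of_mem_grading_zero hf
    refine ⟨c • a, ?_⟩
    rw [valueMatrix_smul, ha, Matrix.smul_single, smul_eq_mul, mul_one, e,
      mul_div_cancel_right₀ _ (pow_ne_zero _ hh1)]
  match w, v with
  | .zero, .zero => exact hC (valueMatrix_pathIdem hη hh β γ _) rfl
  | .line, .line => exact hC (valueMatrix_pathIdem hη hh β γ _) rfl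
  | .conic, .conic => exact hC (valueMatrix_pathIdem hη hh β γ _) rfl
  | .exc i, .exc j =>
    by_cases hij : i = j
    · subst hij
      exact hC (valueMatrix_pathIdem hη hh β γ _) rfl
    · refine hzero (eq_zero_of_mem_grading_zero hf (hexc j rfl fun e ↦ hij ?_))
      injection e
  | .exc i, .zero => exact hC (valueMatrix_pathArrow hη hh β γ (Arrow.a i)) rfl
  | .line, .exc i =>
    exact ⟨embH p β i ⟨f, hf, hexc i rfl nofun⟩, by
      rw [valueMatrix_embH hη hh h0]; simp [Vertex.degree]⟩
  | .conic, .line =>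
    refine ⟨embV γ ⟨f, hf⟩, ?_⟩
    rw [valueMatrix_embV hη hh h0]
    congr 1
    simp only [Vertex.degree]
    field_simp
  | .conic, .exc i =>
    obtain ⟨y, hy⟩ := exists_multToS2_eq _ (formsThrough_le (p i))
      (mem_formsThrough_mul (hp i) hf (hexc i rfl nofun))
    refine ⟨embHV p β γ i y, ?_⟩
    rw [valueMatrix_embHV hη hh h0, hy]
    simp [Vertex.degree]
  | .line, .zero =>
    obtain ⟨y, hy⟩ := sumToV_surjective ht hp hinj ⟨f, hf⟩
    refine ⟨embSum p β y, ?_⟩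
    rw [valueMatrix_embSum hη hh h0, hy]
    simp [Vertex.degree]
  | .conic, .zero =>
    obtain ⟨y, hy⟩ := exists_multToS2_eq _ le_rfl (mem_linearForms_mul hf)
    -- Tensoring with V* keeps the sum map onto V* surjective, so the tensor in V* ⊗ V* lifts to the
    -- paths starting at O.
    obtain ⟨y, rfl⟩ := LinearMap.rTensor_surjective (LinearForms k)
      (sumToV_surjective ht hp hinj) y
    refine ⟨embSumV p β γ y, ?_⟩
    rw [valueMatrix_embSumV hη hh h0, hy]
    simp [Vertex.degree]
  | .zero, .exc i => exact hzero (eq_zero_of_mem_grading_zero hf (hexc i rfl nofun))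
  | .zero, .line => exact hzero (hlt (by simp [Vertex.degree]))
  | .zero, .conic => exact hzero (hlt (by simp [Vertex.degree]))
  | .exc _, .line => exact hzero (hlt (by simp [Vertex.degree]))
  | .exc _, .conic => exact hzero (hlt (by simp [Vertex.degree]))
  | .line, .conic => exact hzero (hlt (by simp [Vertex.degree]))

end

end BlowupPlane

namespace BlowupPlane

/-! ### The endomorphism ring as a ring of matrices -/

noncomputable section

attribute [local instance] functionFieldCommRing

section EndMatrix

variable {X : Scheme.{u}} [IsIntegral X] {n : Type} [Fintype n] [DecidableEq n]
  (J : n → X.IdealSheafData)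

open Limits

lemma homValue_sum {J J' : X.IdealSheafData} {ι : Type*} (s : Finset ι)
    (φ : ι → (divisorSheaf J ⟶ divisorSheaf J')) :
    homValue (∑ i ∈ s, φ i) = ∑ i ∈ s, homValue (φ i) :=
  map_sum (⟨⟨homValue, homValue_zero⟩, homValue_add⟩ :
    (divisorSheaf J ⟶ divisorSheaf J') →+ X.functionField) φ s

/-- The endomorphisms of a direct sum of sheaves `O_X(D)` as matrices of rational functions. -/
def endMatrix : End (⨁ fun v ↦ divisorSheaf (J v)) →+* Matrix n n X.functionField where
  toFun φ := .of fun w v ↦ homValue (J := J v) (J' := J w)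
    (biproduct.ι (fun v ↦ divisorSheaf (J v)) v ≫ φ ≫ biproduct.π (fun v ↦ divisorSheaf (J v)) w)
  map_one' := by
    ext w v
    rw [Matrix.of_apply, End.one_def, Category.id_comp, Matrix.one_apply]
    split_ifs with h
    · subst h
      rw [biproduct.ι_π_self, homValue_id]
    · rw [biproduct.ι_π_ne _ (Ne.symm h), homValue_zero]
  map_zero' := by
    ext w v
    rw [Matrix.of_apply, zero_comp, comp_zero, homValue_zero, Matrix.zero_apply]
  map_add' φ ψ := by
    ext w v
    rw [Matrix.add_apply, Matrix.of_apply, Matrix.of_apply, Matrix.of_apply,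
      Preadditive.add_comp, Preadditive.comp_add, homValue_add]
  map_mul' φ ψ := by
    ext w v
    rw [Matrix.mul_apply, Matrix.of_apply]
    simp only [Matrix.of_apply]
    have e : biproduct.ι (fun v ↦ divisorSheaf (J v)) v ≫ (φ * ψ) ≫
        biproduct.π (fun v ↦ divisorSheaf (J v)) w =
        ∑ u, (biproduct.ι (fun v ↦ divisorSheaf (J v)) v ≫ ψ ≫ biproduct.π _ u) ≫
          (biproduct.ι (fun v ↦ divisorSheaf (J v)) u ≫ φ ≫ biproduct.π _ w) := by
      rw [End.mul_def]
      -- The identity of the direct sum, written as the sum of its projectors, is inserted between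
      -- the two factors; this produces the matrix product.
      conv_lhs => rw [← Category.id_comp φ, ← biproduct.total]
      simp only [Preadditive.sum_comp, Preadditive.comp_sum, Category.assoc]
    rw [e, homValue_sum]
    exact Finset.sum_congr rfl fun u _ ↦ homValue_comp _ _

lemma endMatrix_apply (φ : End (⨁ fun v ↦ divisorSheaf (J v))) (w v : n) :
    endMatrix J φ w v = homValue (J := J v) (J' := J w)
      (biproduct.ι (fun v ↦ divisorSheaf (J v)) v ≫ φ ≫
        biproduct.π (fun v ↦ divisorSheaf (J v)) w) := rfl

lemma endMatrix_injective : Function.Injective (endMatrix J) := by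
  intro φ ψ h
  refine biproduct.hom_ext' _ _ fun v ↦ biproduct.hom_ext _ _ fun w ↦ homValue_injective ?_
  rw [Category.assoc, Category.assoc]
  exact congrFun₂ h w v

lemma endMatrix_comp (v w : n) (φ : divisorSheaf (J v) ⟶ divisorSheaf (J w)) :
    endMatrix J (biproduct.π (fun v ↦ divisorSheaf (J v)) v ≫ φ ≫
      biproduct.ι (fun v ↦ divisorSheaf (J v)) w :) = Matrix.single w v (homValue φ) := by
  ext w' v'
  rw [endMatrix_apply, Category.assoc, Category.assoc]
  by_cases hv : v' = v
  · subst hv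
    rw [biproduct.ι_π_self_assoc]
    by_cases hw : w = w'
    · subst hw
      rw [biproduct.ι_π_self, Category.comp_id, Matrix.single_apply_same]
    · rw [biproduct.ι_π_ne _ hw, comp_zero, homValue_zero,
        Matrix.single_apply_of_row_ne hw]
  · rw [biproduct.ι_π_ne_assoc _ hv, zero_comp, homValue_zero,
      Matrix.single_apply_of_col_ne _ _ (Ne.symm hv)]

lemma mem_range_endMatrix {M : Matrix n n X.functionField}
    (h : ∀ w v, IsMultiplier (J v) (J w) (M w v)) : M ∈ (endMatrix J).range := by
  refine ⟨biproduct.matrix fun v w ↦ mulHom (h w v), ?_⟩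
  ext w v
  rw [endMatrix_apply, biproduct.ι_matrix_assoc, biproduct.lift_π]
  exact (isMultiplication_mulHom (h w v)).homValue_eq

lemma isMultiplier_endMatrix (hJ : ∀ v, IsLocallyFG (J v)) (φ : End (⨁ fun v ↦ divisorSheaf (J v)))
    (w v : n) : IsMultiplier (J v) (J w) (endMatrix J φ w v) :=
  isMultiplier_homValue (hJ v) _

omit [IsIntegral X] in
lemma app_sum_apply {M N : X.Modules} {U : X.Opens} (s : Γ(M, U)) {ι : Type*} (S : Finset ι)
    (φ : ι → (M ⟶ N)) : (∑ i ∈ S, φ i).app U s = ∑ i ∈ S, (φ i).app U s :=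
  map_sum (⟨⟨fun ψ ↦ ψ.app U s, rfl⟩, fun _ _ ↦ rfl⟩ : (M ⟶ N) →+ Γ(N, U)) φ S

/-- A scalar matrix makes the endomorphism the sum of its diagonal components, each of which
multiplies by r. Over `U` this is the action of the section c. -/
lemma app_eq_smul_of_endMatrix_eq {φ : End (⨁ fun v ↦ divisorSheaf (J v))} {r : X.functionField}
    (h : endMatrix J φ = Matrix.diagonal fun _ ↦ r) {U : X.Opens} {c : Γ(X, U)}
    (hc : ∀ x : U, toFunctionField x c = r) (s : Γ((⨁ fun v ↦ divisorSheaf (J v) : X.Modules), U)) :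
    Scheme.Modules.Hom.app φ U s = c • s := by
  let μ : ∀ v, divisorSheaf (J v) ⟶ divisorSheaf (J v) := fun v ↦
    biproduct.ι (fun v ↦ divisorSheaf (J v)) v ≫ φ ≫ biproduct.π (fun v ↦ divisorSheaf (J v)) v
  have hμr : ∀ v, homValue (μ v) = r := fun v ↦ by
    have := congrFun₂ h v v
    rwa [Matrix.diagonal_apply_eq] at this
  have hμ : ∀ v (s : Γ(divisorSheaf (J v), U)), (μ v).app U s = c • s := fun v s ↦ by
    apply sectionValue_injective
    funext x
    rw [sectionValue_smul, hc, ← hμr v]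
    exact isMultiplication_homValue (μ v) U s x
  have hφ : (φ : (⨁ fun v ↦ divisorSheaf (J v)) ⟶ ⨁ fun v ↦ divisorSheaf (J v)) =
      ∑ v, biproduct.π (fun v ↦ divisorSheaf (J v)) v ≫ μ v ≫ biproduct.ι (fun v ↦ divisorSheaf (J v)) v := by
    apply endMatrix_injective J
    rw [h]
    refine Eq.trans ?_ (map_sum (endMatrix J) _ _).symm
    have : ∀ v, endMatrix J (biproduct.π (fun v ↦ divisorSheaf (J v)) v ≫ μ v ≫
        biproduct.ι (fun v ↦ divisorSheaf (J v)) v :) = Matrix.single v v r := fun v ↦ by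
      rw [endMatrix_comp, hμr]
    refine Eq.trans ?_ (Finset.sum_congr rfl fun v _ ↦ (this v).symm)
    ext w v
    rw [Matrix.sum_apply, Finset.sum_eq_single v]
    · rw [Matrix.single_apply, Matrix.diagonal_apply]
      simp [eq_comm]
    · exact fun u _ hu ↦ Matrix.single_apply_of_col_ne _ _ hu _
    · exact fun hv ↦ absurd (Finset.mem_univ v) hv
  have hid := congrArg (fun ψ : (⨁ fun v ↦ divisorSheaf (J v)) ⟶ ⨁ fun v ↦ divisorSheaf (J v) ↦
    ψ.app U s) (biproduct.total (f := fun v ↦ divisorSheaf (J v)))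
  dsimp only at hid
  rw [app_sum_apply] at hid
  rw [hφ, app_sum_apply]
  refine Eq.trans ?_ (congrArg (c • ·) hid)
  dsimp only
  rw [Finset.smul_sum]
  refine Finset.sum_congr rfl fun v _ ↦ ?_
  change (biproduct.ι (fun v ↦ divisorSheaf (J v)) v).app U
    ((μ v).app U ((biproduct.π (fun v ↦ divisorSheaf (J v)) v).app U s)) =
    c • (biproduct.ι (fun v ↦ divisorSheaf (J v)) v).app U
      ((biproduct.π (fun v ↦ divisorSheaf (J v)) v).app U s)
  rw [hμ, Scheme.Modules.Hom.app_smul]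

end EndMatrix

lemma exists_lift {A B M : Type*} [Ring A] [Ring B] [Ring M] (f : A →+* M) (g : B →+* M)
    (hg : Function.Injective g) (hfg : ∀ a, f a ∈ g.range) :
    ∃ q : A →+* B, ∀ a, g (q a) = f a := by
  let e : B ≃+* g.range := RingEquiv.ofBijective g.rangeRestrict
    ⟨fun x y h ↦ hg (congrArg Subtype.val h), g.rangeRestrict_surjective⟩
  refine ⟨e.symm.toRingHom.comp (f.codRestrict g.range hfg), fun a ↦ ?_⟩
  exact congrArg Subtype.val (e.apply_symm_apply ⟨f a, hfg a⟩)

lemma ker_eq_of_comp_eq {A B M : Type*} [Ring A] [Ring B] [Ring M] {f : A →+* M} {g : B →+* M}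
    {q : A →+* B} (hg : Function.Injective g) (h : ∀ a, g (q a) = f a) :
    TwoSidedIdeal.ker q = TwoSidedIdeal.ker f := by
  ext a
  rw [TwoSidedIdeal.mem_ker, TwoSidedIdeal.mem_ker, ← h]
  exact (map_eq_zero_iff _ hg).symm

end

end BlowupPlane

namespace BlowupPlane

/-! ### The canonical homomorphism -/

noncomputable section

attribute [local instance] functionFieldCommRing

variable {k : Type u} [Field k] [IsAlgClosed k] {X : Scheme.{u}} [IsIntegral X] {b : X ⟶ Plane k}
  {t : ℕ} {p : Fin t → Plane k} {hp : ∀ i, IsClosed {p i}} (hinj : Function.Injective p)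
  (hb : IsBlowup b (pointsIdeal p hp))
  {h : MvPolynomial (Fin 3) k} (hh : h ∈ LinearForms k) (h0 : h ≠ 0)

include hinj hb h0 in
/-- The homomorphisms `O(R_i) ⟶ O(H)` are the linear forms through the point `p i`. -/
lemma exists_isMultiplication_exc_line_iff (i : Fin t) (r : X.functionField) :
    (∃ φ : exceptionalSheaf b p hp h (.exc i) ⟶ exceptionalSheaf b p hp h .line,
      IsMultiplication φ r) ↔ ∃ f : formsThrough (p i), r = formRatio b hh f.2.1 := by
  have hη := hb.apply_genericPoint
  constructor
  · rintro ⟨φ, hφ⟩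
    have hr := isMultiplier_homValue (isLocallyFG_divisorIdeal b p hp h (.exc i)) φ
    rw [hφ.homValue_eq] at hr
    obtain ⟨f, hf, -, hexc, rfl⟩ := exists_form_of_isMultiplier hb hη hh h0 hinj hr
    refine ⟨⟨f, hf, hexc i rfl nofun⟩, ?_⟩
    rw [formRatio_eq hη hh h0]
    simp [Vertex.degree]
  · rintro ⟨f, rfl⟩
    rw [formRatio_eq hη hh h0]
    exact ⟨mulHom (isMultiplier_exc_line hη hh h0 f.2), isMultiplication_mulHom _⟩

variable (β : ∀ i, Module.Basis (Fin 2) k (formsThrough (p i)))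
  (γ : Module.Basis (Fin 3) k (LinearForms k))

include h0 in
omit [IsAlgClosed k] in
-- The image of End T is a subring, so it suffices that scalars, trivial paths and arrows multiply
-- the sheaves into each other as required.
lemma valueMatrix_mem_range (hη : b (genericPoint X) = Plane.genericPt k)
    (a : PathAlgebra k (Vertex t)) :
    valueMatrix hη hh β γ a ∈ (endMatrix (divisorIdeal b p hp h)).range := by
  have hsingle : ∀ {v w : Vertex t} {r : X.functionField},
      IsMultiplier (divisorIdeal b p hp h v) (divisorIdeal b p hp h w) r →
      Matrix.single w v r ∈ (endMatrix (divisorIdeal b p hp h)).range := fun {v w r} hr ↦ by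
    refine mem_range_endMatrix _ fun w' v' ↦ ?_
    rw [Matrix.single_apply]
    split_ifs with e
    · obtain ⟨rfl, rfl⟩ := e
      exact hr
    · exact isMultiplier_zero _ _
  induction a using PathAlgebra.induction_mul with
  | one => rw [map_one]; exact one_mem _
  | add a c ha hc => rw [map_add]; exact add_mem ha hc
  | smul c a ha =>
    rw [Algebra.smul_def, map_mul]
    refine mul_mem (mem_range_endMatrix _ fun w v ↦ ?_) ha
    rw [valueMatrix, pathMatrix_algebraMap, Matrix.diagonal_apply]
    split_ifs with e
    · subst e
      exact isMultiplier_of_forall_mem _ (formValue_C_mem hη c)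
    · exact isMultiplier_zero _ _
  | idem v a ha =>
    rw [map_mul, valueMatrix_pathIdem]
    exact mul_mem (hsingle (isMultiplier_of_forall_mem _ fun x ↦ one_mem _)) ha
  | arrow v w x a ha =>
    rw [map_mul, valueMatrix_pathArrow]
    exact mul_mem (hsingle (isMultiplier_arrow hη hh h0 β γ x)) ha

omit [IsAlgClosed k] in
-- The conditions on trivial paths and arrows may be checked on matrices, since an endomorphism is
-- determined by its matrix. Scalars go to scalar matrices, which act on sections as constants.
lemma IsCanonical.endMatrix_eq (hη : b (genericPoint X) = Plane.genericPt k)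
    {π : PathAlgebra k (Vertex t) →+* End (tiltingSheaf b p hp h)}
    (hπ : ∀ a, endMatrix (divisorIdeal b p hp h) (π a) = valueMatrix hη hh β γ a) (h0 : h ≠ 0) :
    IsCanonical b p hp hh β γ π where
  const c U s := by
    refine app_eq_smul_of_endMatrix_eq (divisorIdeal b p hp h) (r := formValue hη (MvPolynomial.C c))
      ?_ (fun x ↦ toFunctionField_constSection hη x.2 c) s
    rw [hπ, valueMatrix, pathMatrix_algebraMap]
    rfl
  idem v := by
    apply endMatrix_injective (divisorIdeal b p hp h)
    rw [hπ, valueMatrix_pathIdem]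
    have := endMatrix_comp (divisorIdeal b p hp h) v v (𝟙 _)
    rw [homValue_id, Category.id_comp] at this
    exact this.symm
  arrow {v w} x := by
    refine ⟨mulHom (isMultiplier_arrow hη hh h0 β γ x), isMultiplication_mulHom _, ?_⟩
    apply endMatrix_injective (divisorIdeal b p hp h)
    rw [hπ, valueMatrix_pathArrow]
    have := endMatrix_comp (divisorIdeal b p hp h) v w (mulHom (isMultiplier_arrow hη hh h0 β γ x))
    rw [(isMultiplication_mulHom _).homValue_eq] at this
    exact this.symm

omit [IsAlgClosed k] in
lemma IsCanonical.eq {π π' : PathAlgebra k (Vertex t) →+* End (tiltingSheaf b p hp h)}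
    (hπ : IsCanonical b p hp hh β γ π) (hπ' : IsCanonical b p hp hh β γ π') : π' = π := by
  refine PathAlgebra.ringHom_ext (fun c ↦ ?_) (fun v ↦ ?_) fun v w x ↦ ?_
  · refine Scheme.Modules.hom_ext _ _ fun U ↦ ?_
    ext s
    exact (hπ'.const c U s).trans (hπ.const c U s).symm
  · exact (hπ'.idem v).trans (hπ.idem v).symm
  · obtain ⟨φ, hφ, e⟩ := hπ.arrow x
    obtain ⟨φ', hφ', e'⟩ := hπ'.arrow x
    rw [e, e', hφ'.hom_ext hφ]

end

end BlowupPlane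

open BlowupPlane

theorem theorem6p2 {k : Type u} [Field k] [IsAlgClosed k] {t : ℕ} (ht : 1 < t)
    (p : Fin t → Plane k) (hp : ∀ i, IsClosed {p i}) (hinj : Function.Injective p)
    {X : Scheme.{u}} [IsIntegral X] (b : X ⟶ Plane k) (hb : IsBlowup b (pointsIdeal p hp))
    {h : MvPolynomial (Fin 3) k} (hh : h ∈ LinearForms k) (h0 : h ≠ 0) :
    (∀ i, Module.finrank k (formsThrough (p i)) = 2 ∧
      ∀ r : X.functionField,
        (∃ φ : exceptionalSheaf b p hp h (.exc i) ⟶ exceptionalSheaf b p hp h .line,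
          IsMultiplication φ r) ↔
        ∃ f : formsThrough (p i), r = formRatio b hh f.2.1) ∧
    ∀ (β : ∀ i, Module.Basis (Fin 2) k (formsThrough (p i)))
      (γ : Module.Basis (Fin 3) k (LinearForms k)),
      ∃ π : PathAlgebra k (Vertex t) →+* End (tiltingSheaf b p hp h),
        IsCanonical b p hp hh β γ π ∧
        (∀ π', IsCanonical b p hp hh β γ π' → π' = π) ∧
        Function.Surjective π ∧
        TwoSidedIdeal.ker π = TwoSidedIdeal.span (relations p β γ) := by
  refine ⟨fun i ↦ ⟨finrank_formsThrough (hp i),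
    exists_isMultiplication_exc_line_iff hinj hb hh h0 i⟩, fun β γ ↦ ?_⟩
  have hη := hb.apply_genericPoint
  have hg := endMatrix_injective (divisorIdeal b p hp h)
  obtain ⟨π, hπ⟩ := exists_lift (valueMatrix hη hh β γ) (endMatrix (divisorIdeal b p hp h)) hg
    (valueMatrix_mem_range hh h0 β γ hη)
  have hcan := IsCanonical.endMatrix_eq hh β γ hη hπ h0
  refine ⟨π, hcan, fun π' hπ' ↦ hcan.eq hh β γ hπ', fun φ ↦ ?_, ?_⟩
  · have hz : ∀ w v, ∃ z, valueMatrix hη hh β γ z =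
        Matrix.single w v (endMatrix (divisorIdeal b p hp h) φ w v) := fun w v ↦
      exists_valueMatrix_eq_single hη hh h0 β γ hb ht hinj
        (isMultiplier_endMatrix _ (isLocallyFG_divisorIdeal b p hp h) φ w v)
    choose z hz using hz
    -- The matrix of φ is the sum of its entries, each of which is the value of some element of the
    -- path algebra.
    refine ⟨∑ w, ∑ v, z w v, hg ?_⟩
    refine (hπ _).trans ?_
    simp only [map_sum, hz]
    exact (Matrix.matrix_eq_sum_single _).symm
  · exact (ker_eq_of_comp_eq hg hπ).trans (ker_valueMatrix hη hh h0 β γ)
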